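/- Let $T>0$ and let $(\Omega,\mathcal F,P)$ be a complete probability space carrying a one-dimensional Brownian motion $(B_t)_{0\le t\le T}$, where $\mathcal F$ is the $\sigma$-algebra generated by $(B_t)_{0\le t\le T}$ augmented by the $P$-null sets. Let $I_n$ denote the $n$-th order multiple Itô integral with respect to $B$. Every $X\in L^2(\Omega)$ has a unique Wiener–Itô chaos decomposition $X=\sum_{n\ge0}I_n(h_n)$ (convergence in $L^2(\Omega)$) with symmetric $h_n\in L^2([0,T]^n)$. Let $\mathcal G_\lambda$, $\lambda\ge1$, be the set of those $X$ with $\sum_n n!\,\lambda^{2n}\,|h_n|^2_{L^2([0,T]^n)}<\infty$, and let $\mathcal G=\bigcap_{\lambda\ge1}\mathcal G_\lambda$. For $X=\sum_n I_n(h_n)\in\mathcal G$ and $n\ge 0$ define, for almost every $t=(t_1,\dots,t_n)\in[0,T]^n$, the $n$-th order Hida–Malliavin derivative $$D^n_tX=\sum_{k\ge n}k(k-1)\cdots(k-n+1)\,I_{k-n}\big(h_k(\cdot,t_1,\dots,t_n)\big).$$ For $X=\sum_kI_k(f_k)$ and $Y=\sum_lI_l(g_l)$ in $\mathcal G$ define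 the Wick product $$X\diamond Y=\sum_{n\ge0}\ \sum_{k+l=n}I_{k+l}(f_k\,\widehat\otimes\,g_l)\in L^2(\Omega),$$ where $\widehat\otimes$ is the symmetrized tensor product, and the anti-Wick product $$X\circ Y=\sum_{m\ge0}\frac1{m!}\int_{[0,T]^m}D^m_sX\cdot D^m_sY\,ds\in L^1(\Omega).$$ Then for all $X,Y\in\mathcal G$: the series defining $X\diamond Y$ converges in $L^2(\Omega)$; for every $n\ge0$ and almost every $t\in[0,T]^n$ the derivatives $D^n_tX$ and $D^n_tY$ exist and belong to $\mathcal G$, and the integrals and the series that define $D^n_tX\circ D^n_tY$ converge in $L^1(\Omega)$; for every $n\ge0$ the function $t\mapsto D^n_tX\circ D^n_tY$ is integrable over $[0,T]^n$ as an $L^1(\Omega)$-valued function; and $$X\diamond Y=\sum_{n\ge0}\frac{(-2)^n}{n!}\int_{[0,T]^n}D^n_tX\circ D^n_tY\,dt,$$ where the series converges unconditionally in $L^1(\Omega)$. -/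

import Mathlib

open MeasureTheory ProbabilityTheory

namespace WickCalculus

noncomputable section

/-- Lebesgue measure on the cube `[0,T]ⁿ`, as a measure on `ℝⁿ`. -/
abbrev cube (T : ℝ) (n : ℕ) : Measure (Fin n → ℝ) :=
  Measure.pi fun _ : Fin n => (volume : Measure ℝ).restrict (Set.Icc 0 T)

/-- The space `L²([0,T]ⁿ)`. -/
abbrev L2Cube (T : ℝ) (n : ℕ) : Type := Lp ℝ 2 (cube T n)

/-- The class in `L²` of a square integrable function (and `0` if the function is not
square integrable). -/
def toL2 {α : Type*} [MeasurableSpace α] (μ : Measure α) (f : α → ℝ) : Lp ℝ 2 μ :=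
  open scoped Classical in if h : MemLp f 2 μ then h.toLp f else 0

/-- `(B_t)_{0 ≤ t ≤ T}` is a one dimensional standard Brownian motion under `P`. -/
structure IsBrownianMotionOn {Ω : Type*} [MeasurableSpace Ω] {T : ℝ}
    (B : Set.Icc (0 : ℝ) T → Ω → ℝ) (P : Measure Ω) : Prop where
  /-- every `B_t` is a random variable -/
  measurable : ∀ t, Measurable (B t)
  /-- `B` starts at zero -/
  start : ∀ t : Set.Icc (0 : ℝ) T, (t : ℝ) = 0 → ∀ᵐ ω ∂P, B t ω = 0
  /-- the increments over successive intervals are independent -/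
  indep : HasIndepIncrements B P
  /-- `B_t - B_s` is centred Gaussian with variance `t - s` -/
  law : ∀ s t : Set.Icc (0 : ℝ) T, s ≤ t →
    HasLaw (B t - B s) (gaussianReal 0 (Real.toNNReal ((t : ℝ) - (s : ℝ)))) P
  /-- the paths are almost surely continuous -/
  cont : ∀ᵐ ω ∂P, Continuous fun t => B t ω

/-- The probability space is complete, carries the Brownian motion `(B_t)_{0 ≤ t ≤ T}`, and its
`σ`-algebra is the one generated by `(B_t)_{0 ≤ t ≤ T}` augmented by the `P`-null sets: every
event coincides up to a null set with an event of `σ(B_t : 0 ≤ t ≤ T)`. -/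
structure IsBrownianSpace {Ω : Type*} [MeasurableSpace Ω] {T : ℝ}
    (B : Set.Icc (0 : ℝ) T → Ω → ℝ) (P : Measure Ω) : Prop where
  complete : P.IsComplete
  brownian : IsBrownianMotionOn B P
  generated : ∀ A : Set Ω, MeasurableSet A →
    ∃ A' : Set Ω, MeasurableSet[⨆ t, MeasurableSpace.comap (B t) (borel ℝ)] A' ∧ A =ᵐ[P] A'

section Chaos

variable {Ω : Type*} [MeasurableSpace Ω] {T : ℝ} (B : Set.Icc (0 : ℝ) T → Ω → ℝ) (P : Measure Ω)

/-- The pairs `(1_{A₁ × ⋯ × Aₙ}, B(A₁) ⋯ B(Aₙ))`, where `A₁, …, Aₙ ⊆ [0,T]` are pairwise disjoint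
intervals `Aᵢ = (aᵢ, bᵢ]` and `B(Aᵢ) = B_{bᵢ} - B_{aᵢ}`. -/
def elementaryPairs (n : ℕ) : Set (L2Cube T n × Lp ℝ 2 P) :=
  {p | ∃ a b : Fin n → Set.Icc (0 : ℝ) T,
    (∀ i, a i ≤ b i) ∧
    (Pairwise fun i j => Disjoint (Set.Ioc (a i : ℝ) (b i)) (Set.Ioc (a j : ℝ) (b j))) ∧
    (p.1 : (Fin n → ℝ) → ℝ) =ᵐ[cube T n]
      Set.indicator (Set.pi Set.univ fun i => Set.Ioc (a i : ℝ) (b i)) (fun _ => (1 : ℝ)) ∧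
    (p.2 : Ω → ℝ) =ᵐ[P] fun ω => ∏ i, (B (b i) ω - B (a i) ω)}

/-- The graph of the `n`-th order multiple Itô integral: the closure in `L²([0,T]ⁿ) × L²(Ω)` of the
graph of its restriction to the elementary functions, that is, to the linear combinations of
indicators of products of pairwise disjoint intervals. -/
def multipleItoGraph (n : ℕ) : Submodule ℝ (L2Cube T n × Lp ℝ 2 P) :=
  (Submodule.span ℝ (elementaryPairs B P n)).topologicalClosure

/-- The `n`-th order multiple Itô integral `Iₙ(h)` of `h ∈ L²([0,T]ⁿ)` with respect to the
Brownian motion `B`: the element of `L²(Ω)` that corresponds to `h` in the graph above. -/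
def multipleIto (n : ℕ) (h : L2Cube T n) : Lp ℝ 2 P :=
  open scoped Classical in
  if ex : ∃ Y : Lp ℝ 2 P, (h, Y) ∈ multipleItoGraph B P n then ex.choose else 0

/-- `h ∈ L²([0,T]ⁿ)` is a symmetric function. -/
def IsSymmetric {n : ℕ} (h : L2Cube T n) : Prop :=
  ∀ σ : Equiv.Perm (Fin n), (fun u : Fin n → ℝ => h (u ∘ σ)) =ᵐ[cube T n] h

/-- `X = ∑ₙ Iₙ(hₙ)` in `L²(Ω)` with symmetric kernels `hₙ ∈ L²([0,T]ⁿ)`: the Wiener–Itô chaos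
decomposition of `X`. -/
def IsChaosExpansion (X : Lp ℝ 2 P) (h : ∀ n, L2Cube T n) : Prop :=
  (∀ n, IsSymmetric (h n)) ∧ HasSum (fun n => multipleIto B P n (h n)) X

/-- The (unique) kernels of the chaos decomposition of `X`. -/
def chaosKernel (X : Lp ℝ 2 P) : ∀ n, L2Cube T n :=
  open scoped Classical in
  if ex : ∃ h : ∀ n, L2Cube T n, IsChaosExpansion B P X h then ex.choose else fun _ => 0

/-- The space `𝒢_r` of those `X = ∑ₙ Iₙ(hₙ)` for which `∑ₙ n! r²ⁿ |hₙ|² < ∞`. -/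
def GSpace (r : ℝ) : Set (Lp ℝ 2 P) :=
  {X | ∃ h : ∀ n, L2Cube T n, IsChaosExpansion B P X h ∧
    Summable fun n : ℕ => (n.factorial : ℝ) * r ^ (2 * n) * ‖h n‖ ^ 2}

/-- The space `𝒢 = ⋂_{r ≥ 1} 𝒢_r` of smooth random variables. -/
def G : Set (Lp ℝ 2 P) := ⋂ r : ℝ, ⋂ _ : 1 ≤ r, GSpace B P r

/-- The section `hₘ₊ₙ(·, t₁, …, tₙ)`, a function of `m` variables, of the kernel `hₘ₊ₙ` of `X`. -/
def kernelSection (n : ℕ) (X : Lp ℝ 2 P) (t : Fin n → ℝ) (m : ℕ) : (Fin m → ℝ) → ℝ :=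
  fun s => chaosKernel B P X (m + n) (Fin.append s t)

/-- The term `(m+n)(m+n-1)⋯(m+1) Iₘ(hₘ₊ₙ(·, t₁, …, tₙ))` of the series for `Dⁿ_{t₁,…,tₙ} X`. -/
def hidaTerm (n : ℕ) (X : Lp ℝ 2 P) (t : Fin n → ℝ) (m : ℕ) : Lp ℝ 2 P :=
  ((m + n).descFactorial n : ℝ) •
    multipleIto B P m (toL2 (cube T m) (kernelSection B P n X t m))

/-- The `n`-th order Hida–Malliavin derivative
`Dⁿ_{t₁,…,tₙ} X = ∑_{k ≥ n} k(k-1)⋯(k-n+1) I_{k-n}(h_k(·, t₁, …, tₙ))`; here `k = m + n`. -/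
def hidaDeriv (n : ℕ) (X : Lp ℝ 2 P) (t : Fin n → ℝ) : Lp ℝ 2 P :=
  ∑' m, hidaTerm B P n X t m

/-- `Dⁿ_{t₁,…,tₙ} X` exists: the sections are in `L²` and the defining series converges. -/
def HidaDerivExists (n : ℕ) (X : Lp ℝ 2 P) (t : Fin n → ℝ) : Prop :=
  (∀ m, MemLp (kernelSection B P n X t m) 2 (cube T m)) ∧ Summable (hidaTerm B P n X t)

/-- The symmetric tensor product `f ⊗̂ g` of `f ∈ L²([0,T]ᵏ)` and `g ∈ L²([0,T]ˡ)`: the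
symmetrization of `(u₁, …, u_{k+l}) ↦ f(u₁, …, u_k) g(u_{k+1}, …, u_{k+l})`. -/
def symTensor {k l : ℕ} (f : L2Cube T k) (g : L2Cube T l) : L2Cube T (k + l) :=
  toL2 (cube T (k + l)) fun u =>
    ((k + l).factorial : ℝ)⁻¹ * ∑ σ : Equiv.Perm (Fin (k + l)),
      f (fun i => u (σ (Fin.castAdd l i))) * g (fun j => u (σ (Fin.natAdd k j)))

/-- The `n`-th chaos component `∑_{k+l=n} I_{k+l}(f_k ⊗̂ g_l)` of the Wick product of
`X = ∑ₖ Iₖ(fₖ)` and `Y = ∑ₗ Iₗ(gₗ)`. -/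
def wickTerm (X Y : Lp ℝ 2 P) (n : ℕ) : Lp ℝ 2 P :=
  ∑ p ∈ Finset.HasAntidiagonal.antidiagonal n,
    multipleIto B P (p.1 + p.2) (symTensor (chaosKernel B P X p.1) (chaosKernel B P Y p.2))

/-- The Wick product `X ◇ Y = ∑ₙ ∑_{k+l=n} I_{k+l}(f_k ⊗̂ g_l)`. -/
def wick (X Y : Lp ℝ 2 P) : Lp ℝ 2 P := ∑' n, wickTerm B P X Y n

/-- The pointwise product `U · V ∈ L¹(Ω)` of `U, V ∈ L²(Ω)`. -/
def mulL1 {P : Measure Ω} (U V : Lp ℝ 2 P) : Lp ℝ 1 P :=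
  MemLp.toLp (fun ω => U ω * V ω)
    (memLp_one_iff_integrable.2 ((Lp.memLp U).integrable_mul (Lp.memLp V)))

/-- The inclusion `L²(Ω) ⊆ L¹(Ω)`. -/
def toL1 {P : Measure Ω} [IsFiniteMeasure P] (U : Lp ℝ 2 P) : Lp ℝ 1 P :=
  MemLp.toLp (U : Ω → ℝ) ((Lp.memLp U).mono_exponent one_le_two)

/-- The term `(1/m!) ∫_{[0,T]ᵐ} Dᵐ_s U · Dᵐ_s V ds`, an `L¹(Ω)`-valued integral. -/
def antiWickTerm (U V : Lp ℝ 2 P) (m : ℕ) : Lp ℝ 1 P :=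
  ((m.factorial : ℝ)⁻¹) •
    ∫ s, mulL1 (hidaDeriv B P m U s) (hidaDeriv B P m V s) ∂(cube T m)

/-- The anti-Wick product `U ∘ V = ∑ₘ (1/m!) ∫_{[0,T]ᵐ} Dᵐ_s U · Dᵐ_s V ds ∈ L¹(Ω)`. -/
def antiWick (U V : Lp ℝ 2 P) : Lp ℝ 1 P := ∑' m, antiWickTerm B P U V m

/-- `U ∘ V` exists: the integrals and the series that define it converge in `L¹(Ω)`. -/
def AntiWickExists (U V : Lp ℝ 2 P) : Prop :=
  (∀ m, Integrable (fun s => mulL1 (hidaDeriv B P m U s) (hidaDeriv B P m V s)) (cube T m)) ∧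
  Summable (antiWickTerm B P U V)

end Chaos

end

end WickCalculus

open MeasureTheory ProbabilityTheory Filter Topology
open scoped ENNReal

namespace WickCalculus

noncomputable section

/-! ### Kernels on the cube: relabelling of variables, symmetrization, tensor products. -/

section MeasureTheoryFacts

/-! Let `K_N` be the `L¹(Ω)`-valued integral of `D^N X · D^N Y` over `[0,T]^N`. Two expansions in
the `K_N` give the theorem. The Wick product is the alternating series `X ◇ Y = ∑ (-1)^N / N! K_N`
(`hasSum_toL1_wick`). Since `D^m D^n = D^(m+n)`, Fubini gives `∫ D^n X ∘ D^n Y = ∑_m K_(m+n) / m!`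
(`antiWick_hidaDeriv`). Inserting the second into `∑ (-2)^n / n!` and grouping by `N = m + n`, the
binomial theorem produces `(-2 + 1)^N / N!`, which is the first (`hasSum_neg_two_pow_of_hasSum`).
For elements of `𝒢` the norm of `K_N` is at most `N! C 16^(-N)`, so the double series converges
absolutely and may be regrouped.

The Wick expansion is proved one pair of chaoses at a time (`mulCLM_itoCLM_tensorL2`): for symmetric
`f`, `g`, `I_(k+l)(f ⊗ g) = ∑_r (-1)^r / r! ∫ D^r I_k(f) · D^r I_l(g)`. Both sides are continuous
and linear in each kernel with values in `L¹(Ω)`, where a product of two elements of `L²(Ω)` lives.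
By polarization the powers `w^{⊗n}` span a dense subspace of the symmetric kernels
(`mem_closure_span_powKernel`), so `f = u^{⊗k}` and `g = v^{⊗l}` suffice. Up to the factor
`C(k+l,k)`, `I_(k+l)(u^{⊗k} ⊗ v^{⊗l})` is the coefficient of `a^k` in `I_(k+l)((a u + v)^{⊗(k+l)})`.
The latter is a Hermite polynomial in `I_1(a u + v)` with variance parameter `|a u + v|²`. Its
generating function is an exponential of a quadratic, which splits into a part from `u`, a part from
`v` and a part from the covariance `a ⟨u, v⟩`; the last part yields the alternating sum over `r`
(`hermiteDiv_add_eq_sum`).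

The Hermite formula (`itoPow_ae_eq`) is obtained from Newton's identities. On a grid, `I_n(w^{⊗n}) /
n!` is approximated by the elementary symmetric function `e_n` of the weighted increments. As the
mesh shrinks the power sum `p_1` tends to `I_1(w)`, `p_2` to `|w|²`, and `p_r` to `0` for `r ≥ 3`.
Newton's identities then become `n e_n = p_1 e_(n-1) - p_2 e_(n-2)`, the Hermite recursion.

All this rests on the isometry for the closed graph that defines `I_n` (`inner_multipleItoGraph`),
and on the density of off-diagonal step functions, which makes `I_n` defined on the whole of `L²`
(`exists_mem_multipleItoGraph`). -/

theorem toL2_ae_eq {α : Type*} [MeasurableSpace α] {μ : Measure α} {f : α → ℝ}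
    (hf : MemLp f 2 μ) : toL2 μ f =ᵐ[μ] f := by
  rw [toL2, dif_pos hf]; exact hf.coeFn_toLp

theorem toL2_eq_of_ae_eq {α : Type*} [MeasurableSpace α] {μ : Measure α} {f : α → ℝ}
    {g : Lp ℝ 2 μ} (h : f =ᵐ[μ] g) : toL2 μ f = g := by
  have hf : MemLp f 2 μ := (Lp.memLp g).ae_eq h.symm
  exact Lp.ext ((toL2_ae_eq hf).trans h)

theorem toL2_congr {α : Type*} [MeasurableSpace α] {μ : Measure α} {f g : α → ℝ}
    (h : f =ᵐ[μ] g) : toL2 μ f = toL2 μ g := by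
  by_cases hf : MemLp f 2 μ
  · exact toL2_eq_of_ae_eq (h.trans (toL2_ae_eq (hf.ae_eq h)).symm)
  · have hg : ¬ MemLp g 2 μ := fun hg => hf (hg.ae_eq h.symm)
    rw [toL2, toL2, dif_neg hf, dif_neg hg]

theorem toL2_const_smul {α : Type*} [MeasurableSpace α] {μ : Measure α} {f : α → ℝ} (c : ℝ)
    (hf : MemLp f 2 μ) : toL2 μ (fun x => c * f x) = c • toL2 μ f := by
  refine toL2_eq_of_ae_eq ?_
  filter_upwards [toL2_ae_eq hf, Lp.coeFn_smul c (toL2 μ f)] with x h1 h2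
  rw [h2, Pi.smul_apply, h1, smul_eq_mul]

variable (T : ℝ)

theorem measurePreserving_comp_equiv {k k' : ℕ} (e : Fin k ≃ Fin k') :
    MeasurePreserving (fun u : Fin k' → ℝ => u ∘ e) (cube T k') (cube T k) := by
  have hm : Measurable (fun u : Fin k' → ℝ => u ∘ e) := by
    exact measurable_pi_lambda _ fun i => measurable_pi_apply _
  refine ⟨hm, (Measure.pi_eq fun s hs => ?_).symm⟩
  rw [Measure.map_apply hm (MeasurableSet.univ_pi hs)]
  have : (fun u : Fin k' → ℝ => u ∘ e) ⁻¹' (Set.univ.pi s)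
      = Set.univ.pi (fun j => s (e.symm j)) := by
    ext u
    simp only [Set.mem_preimage, Set.mem_univ_pi, Function.comp]
    exact ⟨fun h j => by simpa using h (e.symm j), fun h i => by simpa using h (e i)⟩
  rw [this, cube, Measure.pi_pi]
  exact Fintype.prod_equiv e.symm _ _ fun j => rfl

theorem measurePreserving_append (m n : ℕ) :
    MeasurePreserving (fun p : (Fin m → ℝ) × (Fin n → ℝ) => Fin.append p.1 p.2)
      ((cube T m).prod (cube T n)) (cube T (m + n)) := by
  have hm : Measurable (fun p : (Fin m → ℝ) × (Fin n → ℝ) => Fin.append p.1 p.2) := by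
    refine measurable_pi_lambda _ fun i => ?_
    refine Fin.addCases (fun j => ?_) (fun j => ?_) i
    · simp only [Fin.append_left]; fun_prop
    · simp only [Fin.append_right]; fun_prop
  refine ⟨hm, (Measure.pi_eq fun s hs => ?_).symm⟩
  rw [Measure.map_apply hm (MeasurableSet.univ_pi hs)]
  have : (fun p : (Fin m → ℝ) × (Fin n → ℝ) => Fin.append p.1 p.2) ⁻¹' (Set.univ.pi s)
      = (Set.univ.pi fun i => s (Fin.castAdd n i)) ×ˢ (Set.univ.pi fun i => s (Fin.natAdd m i)) := by
    ext p
    simp only [Set.mem_preimage, Set.mem_univ_pi, Set.mem_prod]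
    constructor
    · exact fun h => ⟨fun i => by simpa using h (Fin.castAdd n i),
        fun i => by simpa using h (Fin.natAdd m i)⟩
    · rintro ⟨h1, h2⟩ i
      refine Fin.addCases (fun j => ?_) (fun j => ?_) i
      · simpa using h1 j
      · simpa using h2 j
  rw [this, Measure.prod_prod, cube, cube, Measure.pi_pi, Measure.pi_pi, Fin.prod_univ_add]

/-- Composition of a kernel with a relabelling of its variables. -/
def reindexL2 {k k' : ℕ} (e : Fin k ≃ Fin k') : L2Cube T k →ₗᵢ[ℝ] L2Cube T k' :=
  Lp.compMeasurePreservingₗᵢ ℝ (fun u : Fin k' → ℝ => u ∘ e) (measurePreserving_comp_equiv T e)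

theorem reindexL2_ae_eq {k k' : ℕ} (e : Fin k ≃ Fin k') (h : L2Cube T k) :
    reindexL2 T e h =ᵐ[cube T k'] fun u => h (u ∘ e) :=
  Lp.coeFn_compMeasurePreserving h (measurePreserving_comp_equiv T e)

theorem reindexL2_ae_eq_of {k k' : ℕ} (e : Fin k ≃ Fin k') {h : L2Cube T k} {f : (Fin k → ℝ) → ℝ}
    (hf : h =ᵐ[cube T k] f) : reindexL2 T e h =ᵐ[cube T k'] fun u => f (u ∘ e) :=
  (reindexL2_ae_eq T e h).trans
    ((measurePreserving_comp_equiv T e).quasiMeasurePreserving.ae_eq_comp hf)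

theorem reindexL2_refl {k : ℕ} (h : L2Cube T k) : reindexL2 T (Equiv.refl (Fin k)) h = h :=
  Lp.ext (reindexL2_ae_eq T _ h)

theorem reindexL2_trans {k k' k'' : ℕ} (e : Fin k ≃ Fin k') (e' : Fin k' ≃ Fin k'')
    (h : L2Cube T k) : reindexL2 T e' (reindexL2 T e h) = reindexL2 T (e.trans e') h := by
  refine Lp.ext ?_
  exact (reindexL2_ae_eq_of T e' (reindexL2_ae_eq T e h)).trans
    (reindexL2_ae_eq T (e.trans e') h).symm

variable {T}

theorem isSymmetric_iff {n : ℕ} (h : L2Cube T n) :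
    IsSymmetric h ↔ ∀ σ : Equiv.Perm (Fin n), reindexL2 T σ h = h := by
  refine forall_congr' fun σ => ⟨fun H => ?_, fun H => ?_⟩
  · exact Lp.ext ((reindexL2_ae_eq T σ h).trans H)
  · have := reindexL2_ae_eq T σ h
    rw [H] at this
    exact this.symm

variable (T)

/-- The symmetrization of kernels. -/
def symL2 (n : ℕ) : L2Cube T n →L[ℝ] L2Cube T n :=
  (n.factorial : ℝ)⁻¹ • ∑ σ : Equiv.Perm (Fin n), (reindexL2 T σ).toContinuousLinearMap

theorem symL2_apply {n : ℕ} (h : L2Cube T n) :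
    symL2 T n h = (n.factorial : ℝ)⁻¹ • ∑ σ : Equiv.Perm (Fin n), reindexL2 T σ h := by
  simp [symL2]

theorem isSymmetric_symL2 {n : ℕ} (h : L2Cube T n) : IsSymmetric (symL2 T n h) := by
  rw [isSymmetric_iff]
  intro σ
  rw [symL2_apply, map_smul, map_sum]
  congr 1
  simp_rw [reindexL2_trans]
  exact Fintype.sum_equiv (Equiv.mulLeft σ) _ _ fun τ => rfl

theorem symL2_of_isSymmetric {n : ℕ} {h : L2Cube T n} (hh : IsSymmetric h) : symL2 T n h = h := by
  rw [isSymmetric_iff] at hh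
  rw [symL2_apply, Finset.sum_congr rfl fun σ _ => hh σ, Finset.sum_const, Finset.card_univ,
    Fintype.card_perm, Fintype.card_fin, ← Nat.cast_smul_eq_nsmul ℝ, smul_smul,
    inv_mul_cancel₀ (by positivity), one_smul]

variable {T}

theorem IsSymmetric.smul {n : ℕ} {h : L2Cube T n} (hh : IsSymmetric h) (c : ℝ) :
    IsSymmetric (c • h) := by
  rw [isSymmetric_iff] at hh ⊢
  intro σ; rw [map_smul, hh]

theorem IsSymmetric.sub {n : ℕ} {h g : L2Cube T n} (hh : IsSymmetric h) (hg : IsSymmetric g) :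
    IsSymmetric (h - g) := by
  rw [isSymmetric_iff] at hh hg ⊢
  intro σ; rw [map_sub, hh, hg]

/-- The tensor product of two kernels, as a function. -/
theorem memLp_tensor {k l : ℕ} (f : L2Cube T k) (g : L2Cube T l) :
    MemLp (fun u : Fin (k + l) → ℝ =>
      f (fun i => u (Fin.castAdd l i)) * g (fun j => u (Fin.natAdd k j))) 2 (cube T (k + l)) ∧
    eLpNorm (fun u : Fin (k + l) → ℝ =>
      f (fun i => u (Fin.castAdd l i)) * g (fun j => u (Fin.natAdd k j))) 2 (cube T (k + l))
      = eLpNorm f 2 (cube T k) * eLpNorm g 2 (cube T l) := by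
  set F : (Fin (k + l) → ℝ) → ℝ := fun u =>
      f (fun i => u (Fin.castAdd l i)) * g (fun j => u (Fin.natAdd k j)) with hF
  have hFm : StronglyMeasurable F := by
    refine StronglyMeasurable.mul ?_ ?_
    · exact (Lp.stronglyMeasurable f).comp_measurable (by fun_prop)
    · exact (Lp.stronglyMeasurable g).comp_measurable (by fun_prop)
  have key : eLpNorm F 2 (cube T (k + l)) = eLpNorm f 2 (cube T k) * eLpNorm g 2 (cube T l) := by
    rw [eLpNorm_eq_lintegral_rpow_enorm_toReal (by norm_num) (by norm_num),
      eLpNorm_eq_lintegral_rpow_enorm_toReal (by norm_num) (by norm_num),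
      eLpNorm_eq_lintegral_rpow_enorm_toReal (by norm_num) (by norm_num),
      ← (measurePreserving_append T k l).lintegral_comp (by fun_prop)]
    have h1 : ∀ p : (Fin k → ℝ) × (Fin l → ℝ), ‖F (Fin.append p.1 p.2)‖ₑ ^ (2 : ℝ≥0∞).toReal
        = ‖f p.1‖ₑ ^ (2 : ℝ≥0∞).toReal * ‖g p.2‖ₑ ^ (2 : ℝ≥0∞).toReal := by
      intro p
      simp only [hF, Fin.append_left, Fin.append_right]
      rw [enorm_mul, ENNReal.mul_rpow_of_nonneg _ _ (by norm_num)]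
    simp_rw [h1]
    rw [lintegral_prod_mul (f := fun x => ‖f x‖ₑ ^ (2 : ℝ≥0∞).toReal)
      (g := fun x => ‖g x‖ₑ ^ (2 : ℝ≥0∞).toReal) (by fun_prop) (by fun_prop), ENNReal.mul_rpow_of_nonneg _ _ (by norm_num)]
  refine ⟨⟨hFm.aestronglyMeasurable, ?_⟩, key⟩
  rw [key]
  exact ENNReal.mul_lt_top (Lp.eLpNorm_lt_top f) (Lp.eLpNorm_lt_top g)

/-- The tensor product of two kernels. -/
def tensorL2 {k l : ℕ} (f : L2Cube T k) (g : L2Cube T l) : L2Cube T (k + l) :=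
  toL2 (cube T (k + l)) fun u =>
      f (fun i => u (Fin.castAdd l i)) * g (fun j => u (Fin.natAdd k j))

theorem tensorL2_ae_eq {k l : ℕ} (f : L2Cube T k) (g : L2Cube T l) :
    tensorL2 f g =ᵐ[cube T (k + l)] fun u =>
      f (fun i => u (Fin.castAdd l i)) * g (fun j => u (Fin.natAdd k j)) :=
  toL2_ae_eq (memLp_tensor f g).1

/-- Projecting away `l` variables multiplies the measure by `T ^ l`, so it is not measure preserving
in general. It still pulls null sets back to null sets, which is enough to modify a factor of a
tensor product on a null set. -/
theorem quasiMeasurePreserving_castAdd (k l : ℕ) :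
    Measure.QuasiMeasurePreserving (fun (u : Fin (k + l) → ℝ) (i : Fin k) => u (Fin.castAdd l i))
      (cube T (k + l)) (cube T k) := by
  refine ⟨by fun_prop, ?_⟩
  rw [← (measurePreserving_append T k l).map_eq,
    Measure.map_map (by fun_prop) (measurePreserving_append T k l).measurable]
  have : (fun (u : Fin (k + l) → ℝ) (i : Fin k) => u (Fin.castAdd l i)) ∘
      (fun p : (Fin k → ℝ) × (Fin l → ℝ) => Fin.append p.1 p.2) = Prod.fst := by
    ext p i; simp
  rw [this]
  exact Measure.quasiMeasurePreserving_fst.absolutelyContinuous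

theorem quasiMeasurePreserving_natAdd (k l : ℕ) :
    Measure.QuasiMeasurePreserving (fun (u : Fin (k + l) → ℝ) (i : Fin l) => u (Fin.natAdd k i))
      (cube T (k + l)) (cube T l) := by
  refine ⟨by fun_prop, ?_⟩
  rw [← (measurePreserving_append T k l).map_eq,
    Measure.map_map (by fun_prop) (measurePreserving_append T k l).measurable]
  have : (fun (u : Fin (k + l) → ℝ) (i : Fin l) => u (Fin.natAdd k i)) ∘
      (fun p : (Fin k → ℝ) × (Fin l → ℝ) => Fin.append p.1 p.2) = Prod.snd := by
    ext p i; simp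
  rw [this]
  exact Measure.quasiMeasurePreserving_snd.absolutelyContinuous

theorem tensorL2_ae_eq_of {k l : ℕ} {f : L2Cube T k} {g : L2Cube T l}
    {f' : (Fin k → ℝ) → ℝ} {g' : (Fin l → ℝ) → ℝ} (hf : f =ᵐ[cube T k] f')
    (hg : g =ᵐ[cube T l] g') :
    tensorL2 f g =ᵐ[cube T (k + l)] fun u =>
      f' (fun i => u (Fin.castAdd l i)) * g' (fun j => u (Fin.natAdd k j)) := by
  filter_upwards [tensorL2_ae_eq f g, (quasiMeasurePreserving_castAdd k l).ae_eq_comp hf,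
    (quasiMeasurePreserving_natAdd k l).ae_eq_comp hg] with u h1 h2 h3
  simp only [Function.comp] at h2 h3
  rw [h1, h2, h3]

theorem norm_tensorL2 {k l : ℕ} (f : L2Cube T k) (g : L2Cube T l) :
    ‖tensorL2 f g‖ = ‖f‖ * ‖g‖ := by
  rw [Lp.norm_def, Lp.norm_def, Lp.norm_def, eLpNorm_congr_ae (tensorL2_ae_eq f g),
    (memLp_tensor f g).2, ENNReal.toReal_mul]

/-- The tensor product of kernels as a continuous bilinear map. -/
def tensorCLM (T : ℝ) (k l : ℕ) : L2Cube T k →L[ℝ] L2Cube T l →L[ℝ] L2Cube T (k + l) :=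
  LinearMap.mkContinuous₂ (LinearMap.mk₂ ℝ tensorL2
    (fun f f' g => by
      refine Lp.ext ?_
      filter_upwards [tensorL2_ae_eq_of (Lp.coeFn_add f f') (EventuallyEq.refl _ g),
        tensorL2_ae_eq f g, tensorL2_ae_eq f' g, Lp.coeFn_add (tensorL2 f g) (tensorL2 f' g)]
        with u h1 h2 h3 h4
      rw [h1, h4, Pi.add_apply, Pi.add_apply, h2, h3, add_mul])
    (fun c f g => by
      refine Lp.ext ?_
      filter_upwards [tensorL2_ae_eq_of (Lp.coeFn_smul c f) (EventuallyEq.refl _ g),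
        tensorL2_ae_eq f g, Lp.coeFn_smul c (tensorL2 f g)] with u h1 h2 h4
      rw [h1, h4, Pi.smul_apply, Pi.smul_apply, h2, smul_eq_mul, smul_eq_mul, mul_assoc])
    (fun f g g' => by
      refine Lp.ext ?_
      filter_upwards [tensorL2_ae_eq_of (EventuallyEq.refl _ f) (Lp.coeFn_add g g'),
        tensorL2_ae_eq f g, tensorL2_ae_eq f g', Lp.coeFn_add (tensorL2 f g) (tensorL2 f g')]
        with u h1 h2 h3 h4
      rw [h1, h4, Pi.add_apply, Pi.add_apply, h2, h3, mul_add])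
    (fun c f g => by
      refine Lp.ext ?_
      filter_upwards [tensorL2_ae_eq_of (EventuallyEq.refl _ f) (Lp.coeFn_smul c g),
        tensorL2_ae_eq f g, Lp.coeFn_smul c (tensorL2 f g)] with u h1 h2 h4
      rw [h1, h4, Pi.smul_apply, Pi.smul_apply, h2, smul_eq_mul, smul_eq_mul]; ring))
    1 (fun f g => by simp [norm_tensorL2])

theorem tensorCLM_apply {k l : ℕ} (f : L2Cube T k) (g : L2Cube T l) :
    tensorCLM T k l f g = tensorL2 f g := rfl

/-- Separates symmetrization from the tensor product; the multiple integral does not see the former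
(`itoCLM_symL2`). -/
theorem symTensor_eq {k l : ℕ} (f : L2Cube T k) (g : L2Cube T l) :
    symTensor f g = symL2 T (k + l) (tensorL2 f g) := by
  refine toL2_eq_of_ae_eq ?_
  have h1 : ∀ σ : Equiv.Perm (Fin (k + l)), ∀ᵐ u ∂(cube T (k + l)),
      reindexL2 T σ (tensorL2 f g) u =
        f (fun i => u (σ (Fin.castAdd l i))) * g (fun j => u (σ (Fin.natAdd k j))) := fun σ =>
    reindexL2_ae_eq_of T σ (tensorL2_ae_eq f g)
  rw [symL2_apply]
  filter_upwards [ae_all_iff.2 h1, Lp.coeFn_smul ((k + l).factorial : ℝ)⁻¹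
    (∑ σ : Equiv.Perm (Fin (k + l)), reindexL2 T σ (tensorL2 f g)),
    Lp.coeFn_finsetSum (p := 2) Finset.univ
      (fun σ : Equiv.Perm (Fin (k + l)) => reindexL2 T σ (tensorL2 f g))] with u h2 h3 h4
  rw [h3, Pi.smul_apply, h4, smul_eq_mul]
  simp only [Finset.sum_apply, h2]

end MeasureTheoryFacts

/-! ### Brownian increments over the cells of a grid and their moments. -/

section Increments

/-- All exponents are needed at once: each use of Hölder's inequality in the induction trades `p`
for `2 * p`. -/
theorem memLp_finset_prod {Ω ι : Type*} [MeasurableSpace Ω] {P : Measure Ω} [IsFiniteMeasure P]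
    (s : Finset ι) (f : ι → Ω → ℝ) (hf : ∀ i ∈ s, ∀ p : NNReal, MemLp (f i) p P) (p : NNReal) :
    MemLp (fun ω => ∏ i ∈ s, f i ω) p P := by
  classical
  induction s using Finset.induction_on generalizing p with
  | empty => simpa using memLp_const (1 : ℝ)
  | insert a s ha ih =>
    simp_rw [Finset.prod_insert ha]
    have h1 := hf a (Finset.mem_insert_self a s) (2 * p)
    have h2 := ih (fun i hi => hf i (Finset.mem_insert_of_mem hi)) (2 * p)
    have : ENNReal.HolderTriple ((2 * p : NNReal) : ℝ≥0∞) ((2 * p : NNReal) : ℝ≥0∞) p := by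
      constructor
      push_cast
      rw [ENNReal.mul_inv (by simp) (by simp), ← add_mul, ENNReal.inv_two_add_inv_two, one_mul]
    exact h2.mul h1

variable {Ω : Type*} [MeasurableSpace Ω] {T : ℝ} {B : Set.Icc (0 : ℝ) T → Ω → ℝ} {P : Measure Ω}

/-- The increment of `B` over the `c`-th cell of a grid. -/
def increment (B : Set.Icc (0 : ℝ) T → Ω → ℝ) (t : ℕ → Set.Icc (0 : ℝ) T) (c : ℕ) (ω : Ω) : ℝ :=
  B (t (c + 1)) ω - B (t c) ω

/-- The length of the `c`-th cell of a grid. -/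
def meshSize (t : ℕ → Set.Icc (0 : ℝ) T) (c : ℕ) : ℝ := (t (c + 1) : ℝ) - t c

/-- The `c`-th cell of a grid. -/
def cell (t : ℕ → Set.Icc (0 : ℝ) T) (c : ℕ) : Set ℝ := Set.Ioc (t c : ℝ) (t (c + 1))

theorem meshSize_nonneg {t : ℕ → Set.Icc (0 : ℝ) T} (ht : Monotone t) (c : ℕ) :
    0 ≤ meshSize t c := sub_nonneg.2 (ht (Nat.le_succ c))

theorem disjoint_cell {t : ℕ → Set.Icc (0 : ℝ) T} (ht : Monotone t) {c d : ℕ} (h : c ≠ d) :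
    Disjoint (cell t c) (cell t d) := by
  have ht' : Monotone fun c => (t c : ℝ) := ht
  exact ht'.pairwise_disjoint_on_Ioc_succ h

theorem measurableSet_cell (t : ℕ → Set.Icc (0 : ℝ) T) (c : ℕ) : MeasurableSet (cell t c) :=
  measurableSet_Ioc

theorem measure_cell (t : ℕ → Set.Icc (0 : ℝ) T) (c : ℕ) :
    ((volume : Measure ℝ).restrict (Set.Icc 0 T)) (cell t c) = ENNReal.ofReal (meshSize t c) := by
  rw [Measure.restrict_apply (measurableSet_cell t c), Set.inter_eq_left.2, cell, Real.volume_Ioc,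
    meshSize]
  exact fun x hx => ⟨(t c).2.1.trans hx.1.le, hx.2.trans (t (c + 1)).2.2⟩

theorem measurable_increment (hB : IsBrownianMotionOn B P) (t : ℕ → Set.Icc (0 : ℝ) T) (c : ℕ) :
    Measurable (increment B t c) := (hB.measurable _).sub (hB.measurable _)

theorem hasLaw_increment (hB : IsBrownianMotionOn B P) {t : ℕ → Set.Icc (0 : ℝ) T}
    (ht : Monotone t) (c : ℕ) :
    HasLaw (increment B t c) (gaussianReal 0 (Real.toNNReal (meshSize t c))) P :=
  hB.law (t c) (t (c + 1)) (ht (Nat.le_succ c))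

theorem iIndepFun_increment (hB : IsBrownianMotionOn B P) {t : ℕ → Set.Icc (0 : ℝ) T}
    (ht : Monotone t) : iIndepFun (increment B t) P := hB.indep.nat ht

/-- The moments of the standard Gaussian distribution. -/
def gaussMoment (r : ℕ) : ℝ := ∫ x, x ^ r ∂(gaussianReal 0 1)

theorem memLp_of_hasLaw_gaussian {X : Ω → ℝ} {v : NNReal} (h : HasLaw X (gaussianReal 0 v) P)
    (p : NNReal) : MemLp X p P := by
  have := memLp_id_gaussianReal (μ := 0) (v := v) p
  rw [← h.map_eq] at this
  exact (memLp_map_measure_iff aestronglyMeasurable_id h.aemeasurable).1 this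

theorem integral_pow_of_hasLaw_gaussian {X : Ω → ℝ} {δ : ℝ} (hδ : 0 ≤ δ)
    (h : HasLaw X (gaussianReal 0 (Real.toNNReal δ)) P) (r : ℕ) :
    ∫ ω, X ω ^ r ∂P = Real.sqrt δ ^ r * gaussMoment r := by
  have h1 : gaussianReal 0 (Real.toNNReal δ) = (gaussianReal 0 1).map (fun x => Real.sqrt δ * x) := by
    have := gaussianReal_map_const_mul (μ := 0) (v := 1) (Real.sqrt δ)
    rw [this]
    congr 1
    · simp
    · ext; simp [hδ]
  have h2 := h.integral_comp (f := fun x : ℝ => x ^ r) (by fun_prop)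
  have h3 : ∫ ω, X ω ^ r ∂P = ∫ x, x ^ r ∂(gaussianReal 0 (Real.toNNReal δ)) := h2
  rw [h3, h1, integral_map (by fun_prop) (by fun_prop), gaussMoment, ← integral_const_mul]
  simp_rw [mul_pow]

theorem gaussMoment_one : gaussMoment 1 = 0 := by
  simp [gaussMoment, integral_id_gaussianReal]

theorem gaussMoment_two : gaussMoment 2 = 1 := by
  have h := variance_fun_id_gaussianReal (μ := 0) (v := 1)
  rw [variance_eq_integral (by fun_prop)] at h
  simpa [gaussMoment, integral_id_gaussianReal] using h

theorem memLp_increment (hB : IsBrownianMotionOn B P) {t : ℕ → Set.Icc (0 : ℝ) T}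
    (ht : Monotone t) (c : ℕ) (p : NNReal) : MemLp (increment B t c) p P :=
  memLp_of_hasLaw_gaussian (hasLaw_increment hB ht c) p

theorem integral_increment_pow (hB : IsBrownianMotionOn B P) {t : ℕ → Set.Icc (0 : ℝ) T}
    (ht : Monotone t) (c r : ℕ) :
    ∫ ω, increment B t c ω ^ r ∂P = Real.sqrt (meshSize t c) ^ r * gaussMoment r :=
  integral_pow_of_hasLaw_gaussian (meshSize_nonneg ht c) (hasLaw_increment hB ht c) r

theorem integral_increment (hB : IsBrownianMotionOn B P) {t : ℕ → Set.Icc (0 : ℝ) T}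
    (ht : Monotone t) (c : ℕ) : ∫ ω, increment B t c ω ∂P = 0 := by
  simpa [gaussMoment_one] using integral_increment_pow hB ht c 1

theorem integral_increment_sq (hB : IsBrownianMotionOn B P) {t : ℕ → Set.Icc (0 : ℝ) T}
    (ht : Monotone t) (c : ℕ) : ∫ ω, increment B t c ω ^ 2 ∂P = meshSize t c := by
  rw [integral_increment_pow hB ht c 2, gaussMoment_two, Real.sq_sqrt (meshSize_nonneg ht c), mul_one]

theorem integral_prod_increment_pow (hB : IsBrownianMotionOn B P) {t : ℕ → Set.Icc (0 : ℝ) T}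
    (ht : Monotone t) (s : Finset ℕ) (e : ℕ → ℕ) :
    ∫ ω, ∏ c ∈ s, increment B t c ω ^ e c ∂P = ∏ c ∈ s, ∫ ω, increment B t c ω ^ e c ∂P := by
  have h1 : iIndepFun (fun c : s => increment B t c) P :=
    (iIndepFun_increment hB ht).precomp Subtype.val_injective
  have h2 := h1.integral_fun_prod_comp (f := fun c : s => fun x : ℝ => x ^ e c)
    (fun c => (measurable_increment hB t c).aemeasurable) (fun c => by fun_prop)
  rw [← Finset.prod_coe_sort]
  simp_rw [← h2, ← Finset.prod_coe_sort s (fun c => increment B t c _ ^ e c)]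

/-- The increment over `c` occurs exactly once, so by independence the expectation contains the
factor `E[ΔB_c] = 0`. -/
theorem integral_prod_increment_mul_of_notMem [IsProbabilityMeasure P]
    (hB : IsBrownianMotionOn B P) {t : ℕ → Set.Icc (0 : ℝ) T}
    (ht : Monotone t) {s s' : Finset ℕ} {c : ℕ} (hc : c ∈ s) (hc' : c ∉ s') :
    ∫ ω, (∏ c ∈ s, increment B t c ω) * ∏ c ∈ s', increment B t c ω ∂P = 0 := by
  -- The exponent of a cell counts in how many of the two sets it lies, so that the independence
  -- lemma for powers applies to one product over the union.
  have h : ∀ ω, (∏ c ∈ s, increment B t c ω) * ∏ c ∈ s', increment B t c ω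
      = ∏ c ∈ s ∪ s', increment B t c ω ^ ((if c ∈ s then 1 else 0) + (if c ∈ s' then 1 else 0)) := by
    intro ω
    simp_rw [pow_add, Finset.prod_mul_distrib]
    congr 1
    · rw [← Finset.prod_subset (Finset.subset_union_left (s₂ := s'))]
      · exact Finset.prod_congr rfl fun d hd => by simp [hd]
      · intro d _ hd; simp [hd]
    · rw [← Finset.prod_subset (Finset.subset_union_right (s₁ := s))]
      · exact Finset.prod_congr rfl fun d hd => by simp [hd]
      · intro d _ hd; simp [hd]
  simp_rw [h]
  rw [integral_prod_increment_pow hB ht]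
  refine Finset.prod_eq_zero (Finset.mem_union_left _ hc) ?_
  simp [hc, hc', integral_increment hB ht c]

theorem integral_prod_increment_mul_self (hB : IsBrownianMotionOn B P)
    {t : ℕ → Set.Icc (0 : ℝ) T} (ht : Monotone t) (s : Finset ℕ) :
    ∫ ω, (∏ c ∈ s, increment B t c ω) * ∏ c ∈ s, increment B t c ω ∂P = ∏ c ∈ s, meshSize t c := by
  simp_rw [← Finset.prod_mul_distrib, ← pow_two]
  rw [integral_prod_increment_pow hB ht s fun _ => 2]
  simp_rw [integral_increment_sq hB ht]

/-- The indicator of a product of cells of a grid. -/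
def gridKernel (t : ℕ → Set.Icc (0 : ℝ) T) {n : ℕ} (i : Fin n → ℕ) : L2Cube T n :=
  toL2 (cube T n) (Set.indicator (Set.univ.pi fun r => cell t (i r)) fun _ => (1 : ℝ))

theorem gridKernel_ae_eq (t : ℕ → Set.Icc (0 : ℝ) T) {n : ℕ} (i : Fin n → ℕ) :
    gridKernel t i =ᵐ[cube T n]
      Set.indicator (Set.univ.pi fun r => cell t (i r)) fun _ => (1 : ℝ) :=
  toL2_ae_eq (memLp_indicator_const 2 (MeasurableSet.univ_pi fun r => measurableSet_cell t (i r)) 1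
    (Or.inr (measure_ne_top _ _)))

/-- The product of the increments over cells of a grid. -/
def gridValue (B : Set.Icc (0 : ℝ) T → Ω → ℝ) (P : Measure Ω) (t : ℕ → Set.Icc (0 : ℝ) T) {n : ℕ}
    (i : Fin n → ℕ) : Lp ℝ 2 P :=
  toL2 P fun ω => ∏ r, increment B t (i r) ω

theorem gridValue_ae_eq [IsProbabilityMeasure P] (hB : IsBrownianMotionOn B P)
    {t : ℕ → Set.Icc (0 : ℝ) T} (ht : Monotone t) {n : ℕ} (i : Fin n → ℕ) :
    gridValue B P t i =ᵐ[P] fun ω => ∏ r, increment B t (i r) ω :=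
  toL2_ae_eq (memLp_finset_prod _ _ (fun r _ p => memLp_increment hB ht (i r) p) 2)

theorem inner_gridKernel {t : ℕ → Set.Icc (0 : ℝ) T} (ht : Monotone t) {n : ℕ} (i j : Fin n → ℕ) :
    inner ℝ (gridKernel t i) (gridKernel t j) = if i = j then ∏ r, meshSize t (i r) else 0 := by
  rw [L2.inner_def]
  have h : (fun u => inner ℝ (gridKernel t i u) (gridKernel t j u)) =ᵐ[cube T n]
      Set.indicator (Set.univ.pi fun r => cell t (i r) ∩ cell t (j r)) fun _ => (1 : ℝ) := by
    filter_upwards [gridKernel_ae_eq t i, gridKernel_ae_eq t j] with u h1 h2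
    rw [h1, h2, Set.pi_inter_distrib]
    by_cases ha : u ∈ Set.univ.pi fun r => cell t (i r) <;>
      by_cases hb : u ∈ Set.univ.pi fun r => cell t (j r) <;>
      simp [Set.indicator, ha, hb, -Set.mem_pi]
  rw [integral_congr_ae h, integral_indicator_const _ (MeasurableSet.univ_pi fun r =>
    (measurableSet_cell t (i r)).inter (measurableSet_cell t (j r))), smul_eq_mul, mul_one,
    measureReal_def, cube, Measure.pi_pi]
  split_ifs with hij
  · subst hij
    simp_rw [Set.inter_self, measure_cell]
    rw [ENNReal.toReal_prod]
    exact Finset.prod_congr rfl fun r _ => ENNReal.toReal_ofReal (meshSize_nonneg ht _)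
  · obtain ⟨r, hr⟩ := Function.ne_iff.1 hij
    rw [Finset.prod_eq_zero (Finset.mem_univ r), ENNReal.toReal_zero]
    rw [(disjoint_cell ht hr).inter_eq, measure_empty]

theorem reindexL2_gridKernel (t : ℕ → Set.Icc (0 : ℝ) T) {n : ℕ} (i : Fin n → ℕ)
    (σ : Equiv.Perm (Fin n)) :
    reindexL2 T σ (gridKernel t i) = gridKernel t (i ∘ σ.symm) := by
  refine Lp.ext ((reindexL2_ae_eq_of T σ (gridKernel_ae_eq t i)).trans
    (EventuallyEq.trans ?_ (gridKernel_ae_eq t (i ∘ σ.symm)).symm))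
  refine Eventually.of_forall fun u => ?_
  have : (u ∘ σ ∈ Set.univ.pi fun r => cell t (i r)) ↔
      u ∈ Set.univ.pi fun r => cell t ((i ∘ σ.symm) r) := by
    simp only [Set.mem_univ_pi, Function.comp]
    exact ⟨fun h r => by simpa using h (σ.symm r), fun h r => by simpa using h (σ r)⟩
  by_cases h : u ∈ Set.univ.pi fun r => cell t ((i ∘ σ.symm) r)
  · simp only [Set.indicator_of_mem h, Set.indicator_of_mem (this.2 h)]
  · simp only [Set.indicator_of_notMem h, Set.indicator_of_notMem (fun h' => h (this.1 h'))]

/-- A product of increments over distinct cells remembers only the set of cells, not their order.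
Equal sets give a product of second moments; otherwise some cell occurs on one side only. -/
theorem inner_gridValue [IsProbabilityMeasure P] (hB : IsBrownianMotionOn B P)
    {t : ℕ → Set.Icc (0 : ℝ) T} (ht : Monotone t) {n m : ℕ} {i : Fin n → ℕ} {j : Fin m → ℕ}
    (hi : Function.Injective i) (hj : Function.Injective j) :
    inner ℝ (gridValue B P t i) (gridValue B P t j) =
      if Finset.univ.image i = Finset.univ.image j then ∏ r, meshSize t (i r) else 0 := by
  rw [L2.inner_def]
  have h : (fun ω => inner ℝ (gridValue B P t i ω) (gridValue B P t j ω)) =ᵐ[P] fun ω =>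
      (∏ c ∈ Finset.univ.image i, increment B t c ω) *
        ∏ c ∈ Finset.univ.image j, increment B t c ω := by
    filter_upwards [gridValue_ae_eq hB ht i, gridValue_ae_eq hB ht j] with ω h1 h2
    rw [h1, h2, Finset.prod_image fun a _ b _ h => hi h, Finset.prod_image fun a _ b _ h => hj h]
    simp [mul_comm]
  rw [integral_congr_ae h]
  split_ifs with hij
  · rw [← hij, integral_prod_increment_mul_self hB ht, Finset.prod_image fun a _ b _ h => hi h]
  · by_cases hs : Finset.univ.image i ⊆ Finset.univ.image j
    · have : ¬ Finset.univ.image j ⊆ Finset.univ.image i := fun h => hij (hs.antisymm h)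
      obtain ⟨c, hc, hc'⟩ := Finset.not_subset.1 this
      simp_rw [mul_comm (∏ c ∈ Finset.univ.image i, _)]
      exact integral_prod_increment_mul_of_notMem hB ht hc hc'
    · obtain ⟨c, hc, hc'⟩ := Finset.not_subset.1 hs
      exact integral_prod_increment_mul_of_notMem hB ht hc hc'

theorem inner_gridValue_of_ne [IsProbabilityMeasure P] (hB : IsBrownianMotionOn B P)
    {t : ℕ → Set.Icc (0 : ℝ) T} (ht : Monotone t) {n m : ℕ} (hnm : n ≠ m)
    {i : Fin n → ℕ} {j : Fin m → ℕ}
    (hi : Function.Injective i) (hj : Function.Injective j) :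
    inner ℝ (gridValue B P t i) (gridValue B P t j) = 0 := by
  rw [inner_gridValue hB ht hi hj, if_neg]
  intro h
  have := congrArg Finset.card h
  rw [Finset.card_image_of_injective _ hi, Finset.card_image_of_injective _ hj] at this
  simp at this
  exact hnm this

/-- The isometry on the grid. The kernel of a product of cells depends on the order of the cells
while the product of increments does not, and the sum over permutations compensates: if the sets of
cells agree, exactly one permutation matches the two index maps, and otherwise none does. -/
theorem inner_gridValue_eq_sum [IsProbabilityMeasure P] (hB : IsBrownianMotionOn B P)
    {t : ℕ → Set.Icc (0 : ℝ) T} (ht : Monotone t) {n : ℕ} {i j : Fin n → ℕ}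
    (hi : Function.Injective i) (hj : Function.Injective j) :
    inner ℝ (gridValue B P t i) (gridValue B P t j) =
      ∑ σ : Equiv.Perm (Fin n), inner ℝ (gridKernel t i) (reindexL2 T σ (gridKernel t j)) := by
  simp_rw [reindexL2_gridKernel, inner_gridKernel ht, inner_gridValue hB ht hi hj]
  split_ifs with hij
  · have hex : ∀ r, ∃ r', j r' = i r := fun r => by
      have : i r ∈ Finset.univ.image j := hij ▸ Finset.mem_image_of_mem i (Finset.mem_univ r)
      simpa using this
    choose τ hτ using hex
    have hτi : Function.Injective τ := fun a b h => hi (by rw [← hτ, ← hτ, h])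
    let τ' : Equiv.Perm (Fin n) := Equiv.ofBijective τ (Finite.injective_iff_bijective.1 hτi)
    rw [Finset.sum_eq_single τ'.symm]
    · rw [if_pos]
      ext r; simp [τ', hτ]
    · intro σ _ hσ
      rw [if_neg]
      intro h
      apply hσ
      rw [← Equiv.symm_symm σ]
      congr 1
      ext r
      have := congrFun h r
      simp only [Function.comp] at this
      rw [← hτ] at this
      exact congrArg Fin.val (hj this).symm
    · simp
  · refine (Finset.sum_eq_zero fun σ _ => if_neg ?_).symm
    rintro rfl
    apply hij
    ext c
    simp only [Finset.mem_image, Finset.mem_univ, true_and, Function.comp]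
    exact ⟨fun ⟨r, hr⟩ => ⟨_, hr⟩, fun ⟨r, hr⟩ => ⟨σ r, by simpa using hr⟩⟩

end Increments

/-! ### The isometry on the graph of the multiple integral. -/

section Isometry

variable {Ω : Type*} [MeasurableSpace Ω] {T : ℝ} {B : Set.Icc (0 : ℝ) T → Ω → ℝ} {P : Measure Ω}

/-- Sorting all end points gives a common refinement. The point `0` only guarantees that there is at
least one grid point. Past index `N` the grid is constant, hence strict growth is claimed below `N`
only. -/
theorem exists_grid (hT : 0 < T) {ι : Type*} [Fintype ι] (a b : ι → Set.Icc (0 : ℝ) T)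
    (hab : ∀ i, a i ≤ b i) :
    ∃ (t : ℕ → Set.Icc (0 : ℝ) T) (N : ℕ) (p q : ι → ℕ), Monotone t ∧
      (∀ c < N, t c < t (c + 1)) ∧ ∀ i, p i ≤ q i ∧ q i ≤ N ∧ t (p i) = a i ∧ t (q i) = b i := by
  classical
  let S : Finset (Set.Icc (0 : ℝ) T) :=
    insert ⟨0, le_rfl, hT.le⟩ (Finset.univ.image a ∪ Finset.univ.image b)
  obtain ⟨N, hN⟩ : ∃ N, S.card = N + 1 :=
    ⟨S.card - 1, by have : 0 < S.card := Finset.card_pos.2 ⟨_, Finset.mem_insert_self _ _⟩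
                    omega⟩
  let t : ℕ → Set.Icc (0 : ℝ) T := fun k => S.orderEmbOfFin hN ⟨min k N, by omega⟩
  have ht : Monotone t := fun k l hkl =>
    (S.orderEmbOfFin hN).monotone (by simp only [Fin.mk_le_mk]; omega)
  have hS : ∀ s ∈ S, ∃ k ≤ N, t k = s := by
    intro s hs
    have : s ∈ Set.range (S.orderEmbOfFin hN) := by rw [Finset.range_orderEmbOfFin]; exact hs
    obtain ⟨k, hk⟩ := this
    refine ⟨k, by omega, ?_⟩
    rw [← hk]
    simp only [t]
    congr 1
    ext; simp; omega
  have hp : ∀ i, ∃ p q : ℕ, p ≤ q ∧ q ≤ N ∧ t p = a i ∧ t q = b i := by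
    intro i
    obtain ⟨p, hpN, hp⟩ := hS (a i) (by simp [S])
    obtain ⟨q, hqN, hq⟩ := hS (b i) (by simp [S])
    rcases le_total p q with h | h
    · exact ⟨p, q, h, hqN, hp, hq⟩
    -- If the indices come out in the wrong order, then `b i ≤ a i`, so the interval is empty and
    -- both ends can share one index.
    · refine ⟨p, p, le_rfl, hpN, hp, ?_⟩
      have h1 := ht h
      rw [hp, hq] at h1
      rw [hp]
      exact le_antisymm (hab i) h1
  choose p q h using hp
  refine ⟨t, N, p, q, ht, fun c hc => ?_, h⟩
  refine (S.orderEmbOfFin hN).strictMono ?_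
  simp only [Fin.mk_lt_mk]; omega

theorem indicator_univ_pi {n : ℕ} (A : Fin n → Set ℝ) (u : Fin n → ℝ) :
    Set.indicator (Set.univ.pi A) (fun _ => (1 : ℝ)) u
      = ∏ r, Set.indicator (A r) (fun _ => (1 : ℝ)) (u r) := by
  by_cases h : u ∈ Set.univ.pi A
  · rw [Set.indicator_of_mem h]
    exact (Finset.prod_eq_one fun r _ => Set.indicator_of_mem (h r trivial) _).symm
  · rw [Set.indicator_of_notMem h]
    simp only [Set.mem_univ_pi, not_forall] at h
    obtain ⟨r, hr⟩ := h
    exact (Finset.prod_eq_zero (Finset.mem_univ r) (Set.indicator_of_notMem hr _)).symm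

theorem indicator_Ioc_eq_sum_cell {t : ℕ → Set.Icc (0 : ℝ) T} (ht : Monotone t) {p q : ℕ}
    (hpq : p ≤ q) (x : ℝ) :
    Set.indicator (Set.Ioc (t p : ℝ) (t q)) (fun _ => (1 : ℝ)) x =
      ∑ c ∈ Finset.Ico p q, Set.indicator (cell t c) (fun _ => (1 : ℝ)) x := by
  induction q, hpq using Nat.le_induction with
  | base => simp
  | succ q hq ih =>
    have h1 : (t p : ℝ) ≤ t q := ht hq
    have h2 : (t q : ℝ) ≤ t (q + 1) := ht (Nat.le_succ q)
    rw [Finset.sum_Ico_succ_top hq, ← ih, cell, ← Set.Ioc_union_Ioc_eq_Ioc h1 h2,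
      Set.indicator_union_of_disjoint (Set.Ioc_disjoint_Ioc_of_le le_rfl)]

theorem sub_eq_sum_increment {Ω : Type*} {B : Set.Icc (0 : ℝ) T → Ω → ℝ} (t : ℕ → Set.Icc (0 : ℝ) T) {p q : ℕ} (hpq : p ≤ q) (ω : Ω) :
    B (t q) ω - B (t p) ω = ∑ c ∈ Finset.Ico p q, increment B t c ω := by
  induction q, hpq using Nat.le_induction with
  | base => simp
  | succ q hq ih => rw [Finset.sum_Ico_succ_top hq, ← ih, increment]; ring

/-- Each interval is a union of cells and each of its increments a sum of cell increments; expanding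
the two products gives the same index set on both sides. Strict growth of the grid makes the cells
nonempty, and this turns disjointness of the intervals into injectivity of the index maps. -/
theorem elementaryPair_eq_sum [IsProbabilityMeasure P] (hB : IsBrownianMotionOn B P)
    {t : ℕ → Set.Icc (0 : ℝ) T} (ht : Monotone t) {N : ℕ} (htN : ∀ c < N, t c < t (c + 1))
    {n : ℕ} {a b : Fin n → Set.Icc (0 : ℝ) T} {p q : Fin n → ℕ}
    (h : ∀ i, p i ≤ q i ∧ q i ≤ N ∧ t (p i) = a i ∧ t (q i) = b i)
    (hd : Pairwise fun i j => Disjoint (Set.Ioc (a i : ℝ) (b i)) (Set.Ioc (a j : ℝ) (b j)))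
    {z : L2Cube T n × Lp ℝ 2 P}
    (h1 : (z.1 : (Fin n → ℝ) → ℝ) =ᵐ[cube T n]
      Set.indicator (Set.pi Set.univ fun i => Set.Ioc (a i : ℝ) (b i)) (fun _ => (1 : ℝ)))
    (h2 : (z.2 : Ω → ℝ) =ᵐ[P] fun ω => ∏ i, (B (b i) ω - B (a i) ω)) :
    ∃ S : Finset (Fin n → ℕ), (∀ i ∈ S, Function.Injective i) ∧
      z.1 = ∑ i ∈ S, gridKernel t i ∧ z.2 = ∑ i ∈ S, gridValue B P t i := by
  refine ⟨Fintype.piFinset fun r => Finset.Ico (p r) (q r), fun i hi r s hrs => ?_, ?_, ?_⟩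
  · by_contra hne
    rw [Fintype.mem_piFinset] at hi
    have hr := Finset.mem_Ico.1 (hi r)
    have hs := Finset.mem_Ico.1 (hi s)
    have h3 : (t (i r) : ℝ) < t (i r + 1) := htN _ (hr.2.trans_le (h r).2.1)
    -- If the coordinates `r` and `s` used the same cell, its right end point would lie in both
    -- intervals.
    refine Set.disjoint_left.1 (hd hne)
      (show (t (i r + 1) : ℝ) ∈ Set.Ioc (a r : ℝ) (b r) from ⟨?_, ?_⟩) ⟨?_, ?_⟩
    · rw [← (h r).2.2.1]; exact lt_of_le_of_lt (show (t (p r) : ℝ) ≤ t (i r) from ht hr.1) h3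
    · rw [← (h r).2.2.2]; exact ht hr.2
    · rw [← (h s).2.2.1]
      refine lt_of_le_of_lt (show (t (p s) : ℝ) ≤ t (i r) from ht ?_) h3
      rw [hrs]; exact hs.1
    · rw [← (h s).2.2.2]
      refine ht ?_
      change i r + 1 ≤ q s
      rw [hrs]; exact hs.2
  · refine Lp.ext (h1.trans ?_)
    filter_upwards [Lp.coeFn_finsetSum (p := 2) (Fintype.piFinset fun r => Finset.Ico (p r) (q r))
      (fun i => gridKernel t i), ae_all_iff.2 fun i => gridKernel_ae_eq (T := T) t (n := n) i]
      with u h3 h4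
    rw [h3, indicator_univ_pi]
    simp_rw [Finset.sum_apply, h4, indicator_univ_pi, ← (h _).2.2.1, ← (h _).2.2.2,
      indicator_Ioc_eq_sum_cell ht (h _).1]
    rw [Finset.prod_univ_sum]
  · refine Lp.ext (h2.trans ?_)
    filter_upwards [Lp.coeFn_finsetSum (p := 2) (Fintype.piFinset fun r => Finset.Ico (p r) (q r))
      (fun i => gridValue B P t i), ae_all_iff.2 fun i => gridValue_ae_eq hB ht (n := n) i]
      with ω h3 h4
    rw [h3]
    simp_rw [Finset.sum_apply, h4, ← (h _).2.2.1, ← (h _).2.2.2,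
      sub_eq_sum_increment t (h _).1]
    rw [Finset.prod_univ_sum]

theorem exists_common_grid [IsProbabilityMeasure P] (hT : 0 < T) (hB : IsBrownianMotionOn B P)
    {n m : ℕ} {z : L2Cube T n × Lp ℝ 2 P} {z' : L2Cube T m × Lp ℝ 2 P}
    (hz : z ∈ elementaryPairs B P n) (hz' : z' ∈ elementaryPairs B P m) :
    ∃ t : ℕ → Set.Icc (0 : ℝ) T, Monotone t ∧
      (∃ S : Finset (Fin n → ℕ), (∀ i ∈ S, Function.Injective i) ∧
        z.1 = ∑ i ∈ S, gridKernel t i ∧ z.2 = ∑ i ∈ S, gridValue B P t i) ∧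
      (∃ S : Finset (Fin m → ℕ), (∀ i ∈ S, Function.Injective i) ∧
        z'.1 = ∑ i ∈ S, gridKernel t i ∧ z'.2 = ∑ i ∈ S, gridValue B P t i) := by
  obtain ⟨a, b, hab, hd, h1, h2⟩ := hz
  obtain ⟨a', b', hab', hd', h1', h2'⟩ := hz'
  obtain ⟨t, N, p, q, ht, htN, h⟩ := exists_grid hT (Sum.elim a a') (Sum.elim b b')
    (by rintro (i | i); exacts [hab i, hab' i])
  exact ⟨t, ht,
    elementaryPair_eq_sum hB ht htN (p := p ∘ Sum.inl) (q := q ∘ Sum.inl) (fun i => h (Sum.inl i))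
      hd h1 h2,
    elementaryPair_eq_sum hB ht htN (p := p ∘ Sum.inr) (q := q ∘ Sum.inr) (fun i => h (Sum.inr i))
      hd' h1' h2'⟩

theorem inner_elementary_of_ne [IsProbabilityMeasure P] (hT : 0 < T) (hB : IsBrownianMotionOn B P)
    {n m : ℕ} (hnm : n ≠ m) {z : L2Cube T n × Lp ℝ 2 P} {z' : L2Cube T m × Lp ℝ 2 P}
    (hz : z ∈ elementaryPairs B P n) (hz' : z' ∈ elementaryPairs B P m) :
    inner ℝ z.2 z'.2 = 0 := by
  obtain ⟨t, ht, ⟨S, hS, -, h2⟩, ⟨S', hS', -, h2'⟩⟩ := exists_common_grid hT hB hz hz'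
  rw [h2, h2', sum_inner]
  refine Finset.sum_eq_zero fun i hi => ?_
  rw [inner_sum]
  exact Finset.sum_eq_zero fun j hj => inner_gridValue_of_ne hB ht hnm (hS i hi) (hS' j hj)

theorem inner_elementary [IsProbabilityMeasure P] (hT : 0 < T) (hB : IsBrownianMotionOn B P)
    {n : ℕ} {z z' : L2Cube T n × Lp ℝ 2 P}
    (hz : z ∈ elementaryPairs B P n) (hz' : z' ∈ elementaryPairs B P n) :
    inner ℝ z.2 z'.2 = ∑ σ : Equiv.Perm (Fin n), inner ℝ z.1 (reindexL2 T σ z'.1) := by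
  obtain ⟨t, ht, ⟨S, hS, h1, h2⟩, ⟨S', hS', h1', h2'⟩⟩ := exists_common_grid hT hB hz hz'
  simp_rw [h1, h2, h1', h2', map_sum, sum_inner, inner_sum]
  rw [Finset.sum_comm (s := Finset.univ)]
  refine Finset.sum_congr rfl fun i hi => ?_
  rw [Finset.sum_comm (s := Finset.univ)]
  exact Finset.sum_congr rfl fun j hj => inner_gridValue_eq_sum hB ht (hS i hi) (hS' j hj)

/-- The kernel of a continuous functional is a closed subspace, so linear identities pass from
elementary pairs to the whole graph. Bilinear identities follow by using this once in each slot. -/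
theorem multipleItoGraph_le_ker {n : ℕ} (L : L2Cube T n × Lp ℝ 2 P →L[ℝ] ℝ)
    (h : ∀ z ∈ elementaryPairs B P n, L z = 0) {z : L2Cube T n × Lp ℝ 2 P}
    (hz : z ∈ multipleItoGraph B P n) : L z = 0 := by
  have : multipleItoGraph B P n ≤ L.ker :=
    Submodule.topologicalClosure_minimal _ (Submodule.span_le.2 h) L.isClosed_ker
  exact this hz

theorem inner_multipleItoGraph_of_ne [IsProbabilityMeasure P] (hT : 0 < T)
    (hB : IsBrownianMotionOn B P)
    {n m : ℕ} (hnm : n ≠ m) {z : L2Cube T n × Lp ℝ 2 P} {z' : L2Cube T m × Lp ℝ 2 P}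
    (hz : z ∈ multipleItoGraph B P n) (hz' : z' ∈ multipleItoGraph B P m) :
    inner ℝ z.2 z'.2 = 0 := by
  have h1 : ∀ y ∈ elementaryPairs B P n, inner ℝ y.2 z'.2 = 0 := fun y hy =>
    multipleItoGraph_le_ker ((innerSL ℝ y.2) ∘L ContinuousLinearMap.snd ℝ _ _)
      (fun y' hy' => inner_elementary_of_ne hT hB hnm hy hy') hz'
  have := multipleItoGraph_le_ker ((innerSL ℝ z'.2) ∘L ContinuousLinearMap.snd ℝ _ _)
      (fun y hy => (real_inner_comm _ _).trans (h1 y hy)) hz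
  exact (real_inner_comm _ _).trans this

theorem inner_multipleItoGraph [IsProbabilityMeasure P] (hT : 0 < T)
    (hB : IsBrownianMotionOn B P) {n : ℕ} {z z' : L2Cube T n × Lp ℝ 2 P}
    (hz : z ∈ multipleItoGraph B P n) (hz' : z' ∈ multipleItoGraph B P n) :
    inner ℝ z.2 z'.2 = ∑ σ : Equiv.Perm (Fin n), inner ℝ z.1 (reindexL2 T σ z'.1) := by
  have h1 : ∀ y ∈ elementaryPairs B P n,
      inner ℝ y.2 z'.2 = ∑ σ : Equiv.Perm (Fin n), inner ℝ y.1 (reindexL2 T σ z'.1) := by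
    intro y hy
    have := multipleItoGraph_le_ker ((innerSL ℝ y.2) ∘L ContinuousLinearMap.snd ℝ _ _ -
      ∑ σ : Equiv.Perm (Fin n), (innerSL ℝ y.1) ∘L (reindexL2 T σ).toContinuousLinearMap ∘L
        ContinuousLinearMap.fst ℝ _ _)
      (fun y' hy' => by simp [inner_elementary hT hB hy hy']) hz'
    simpa [sub_eq_zero] using this
  have := multipleItoGraph_le_ker ((innerSL ℝ z'.2) ∘L ContinuousLinearMap.snd ℝ _ _ -
      ∑ σ : Equiv.Perm (Fin n), (innerSL ℝ (reindexL2 T σ z'.1)) ∘L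
        ContinuousLinearMap.fst ℝ _ _)
      (fun y hy => by
        have := h1 y hy
        simp only [_root_.sub_apply, ContinuousLinearMap.comp_apply,
          _root_.sum_apply, innerSL_apply_apply, ContinuousLinearMap.coe_fst',
          ContinuousLinearMap.coe_snd']
        rw [real_inner_comm, this, sub_eq_zero]
        exact Finset.sum_congr rfl fun σ _ => real_inner_comm _ _) hz
  simp only [_root_.sub_apply, ContinuousLinearMap.comp_apply,
          _root_.sum_apply, innerSL_apply_apply, ContinuousLinearMap.coe_fst',
          ContinuousLinearMap.coe_snd'] at this
  rw [real_inner_comm, sub_eq_zero.1 this]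
  exact Finset.sum_congr rfl fun σ _ => real_inner_comm _ _

/-- Cauchy–Schwarz applied to the `n!` terms of the isometry. It makes the closed graph single
valued and its operator bounded. -/
theorem norm_sq_le_of_mem_multipleItoGraph [IsProbabilityMeasure P] (hT : 0 < T)
    (hB : IsBrownianMotionOn B P) {n : ℕ} {z : L2Cube T n × Lp ℝ 2 P}
    (hz : z ∈ multipleItoGraph B P n) : ‖z.2‖ ≤ Real.sqrt n.factorial * ‖z.1‖ := by
  have h : ‖z.2‖ ^ 2 ≤ (Real.sqrt n.factorial * ‖z.1‖) ^ 2 := by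
    rw [← real_inner_self_eq_norm_sq, inner_multipleItoGraph hT hB hz hz, mul_pow,
      Real.sq_sqrt (by positivity)]
    calc _ ≤ ∑ σ : Equiv.Perm (Fin n), ‖z.1‖ * ‖z.1‖ := by
            refine Finset.sum_le_sum fun σ _ => (real_inner_le_norm _ _).trans ?_
            rw [LinearIsometry.norm_map]
      _ = _ := by
            rw [Finset.sum_const, Finset.card_univ, Fintype.card_perm, Fintype.card_fin,
              nsmul_eq_mul, pow_two]
  exact le_of_sq_le_sq h (by positivity)

end Isometry

/-! ### Density of the off-diagonal step functions. -/

section Density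

theorem norm_toL2_sq {α : Type*} [MeasurableSpace α] {μ : Measure α} {f : α → ℝ}
    (hf : MemLp f 2 μ) : ‖toL2 μ f‖ ^ 2 = ∫ x, f x ^ 2 ∂μ := by
  rw [← real_inner_self_eq_norm_sq, L2.inner_def]
  refine integral_congr_ae ?_
  filter_upwards [toL2_ae_eq hf] with x hx
  rw [hx]; simp [pow_two]

theorem toL2_sub {α : Type*} [MeasurableSpace α] {μ : Measure α} {f g : α → ℝ}
    (hf : MemLp f 2 μ) (hg : MemLp g 2 μ) :
    toL2 μ f - toL2 μ g = toL2 μ (fun x => f x - g x) := by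
  refine (toL2_eq_of_ae_eq ?_).symm
  filter_upwards [toL2_ae_eq hf, toL2_ae_eq hg, Lp.coeFn_sub (toL2 μ f) (toL2 μ g)] with x h1 h2 h3
  rw [h3, Pi.sub_apply, h1, h2]

theorem tendsto_toL2_of_bounded {α : Type*} [MeasurableSpace α] {μ : Measure α}
    [IsFiniteMeasure μ] {f : ℕ → α → ℝ} {g : α → ℝ} {C : ℝ}
    (hf : ∀ j, AEStronglyMeasurable (f j) μ) (hC : ∀ j, ∀ᵐ x ∂μ, |f j x| ≤ C)
    (hlim : ∀ᵐ x ∂μ, Tendsto (fun j => f j x) atTop (𝓝 (g x))) :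
    Tendsto (fun j => toL2 μ (f j)) atTop (𝓝 (toL2 μ g)) := by
  have hgm : AEStronglyMeasurable g μ := aestronglyMeasurable_of_tendsto_ae atTop hf hlim
  have hgC : ∀ᵐ x ∂μ, |g x| ≤ C := by
    filter_upwards [hlim, ae_all_iff.2 hC] with x h1 h2
    exact le_of_tendsto h1.abs (Eventually.of_forall h2)
  have hfL : ∀ j, MemLp (f j) 2 μ := fun j => MemLp.of_bound (hf j) C (hC j)
  have hgL : MemLp g 2 μ := MemLp.of_bound hgm C hgC
  rw [tendsto_iff_norm_sub_tendsto_zero]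
  have h1 : Tendsto (fun j => ‖toL2 μ (f j) - toL2 μ g‖ ^ 2) atTop (𝓝 0) := by
    have h2 : ∀ j, ‖toL2 μ (f j) - toL2 μ g‖ ^ 2 = ∫ x, (f j x - g x) ^ 2 ∂μ := fun j => by
      rw [toL2_sub (hfL j) hgL, norm_toL2_sq (f := fun x => f j x - g x) ((hfL j).sub hgL)]
    simp_rw [h2]
    rw [show (0 : ℝ) = ∫ x, (0 : ℝ) ∂μ by simp]
    refine tendsto_integral_of_dominated_convergence (fun _ => (2 * C) ^ 2)
      (fun j => ((hf j).sub hgm).pow 2) (integrable_const _) (fun j => ?_) ?_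
    · filter_upwards [hC j, hgC] with x h1 h2
      rw [Real.norm_eq_abs, abs_pow]
      refine pow_le_pow_left₀ (abs_nonneg _) ?_ 2
      calc |f j x - g x| ≤ |f j x| + |g x| := abs_sub _ _
        _ ≤ 2 * C := by linarith
    · filter_upwards [hlim] with x hx
      have := (hx.sub_const (g x)).pow 2
      simpa using this
  have h3 := h1.sqrt
  simpa using h3

variable {T : ℝ}

/-- The grid of mesh `T / (j + 1)`. -/
def uniformGrid (hT : 0 < T) (j c : ℕ) : Set.Icc (0 : ℝ) T :=
  ⟨T * min c (j + 1) / (j + 1), by positivity, by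
    rw [div_le_iff₀ (by positivity)]
    exact mul_le_mul_of_nonneg_left (by exact_mod_cast min_le_right c (j + 1)) hT.le⟩

theorem monotone_uniformGrid (hT : 0 < T) (j : ℕ) : Monotone (uniformGrid hT j) := by
  intro c d h
  have : ((min c (j + 1) : ℕ) : ℝ) ≤ ((min d (j + 1) : ℕ) : ℝ) := by
    exact_mod_cast min_le_min_right _ h
  change T * ((min c (j + 1) : ℕ) : ℝ) / (j + 1) ≤ T * ((min d (j + 1) : ℕ) : ℝ) / (j + 1)
  gcongr

/-- The index of the cell of the uniform grid that contains a given point. -/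
def cellIndex (T : ℝ) (j : ℕ) (x : ℝ) : ℕ := ⌈x * (j + 1) / T⌉₊ - 1

theorem uniformGrid_of_le (hT : 0 < T) {j c : ℕ} (h : c ≤ j + 1) :
    (uniformGrid hT j c : ℝ) = T * c / (j + 1) := by
  have : (c : ℝ) ≤ j + 1 := by exact_mod_cast h
  simp [uniformGrid, min_eq_left this]

/-- Cells that are open on the left and closed on the right match the ceiling function. The point
`0` has to be excluded: there the truncated subtraction in `cellIndex` gives `0`, although `0` lies
in no cell. -/
theorem mem_cell_uniformGrid (hT : 0 < T) {j c : ℕ} (hc : c < j + 1) {x : ℝ}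
    (hx : x ∈ Set.Ioc 0 T) :
    x ∈ cell (uniformGrid hT j) c ↔ cellIndex T j x = c := by
  have hy : 0 < x * (j + 1) / T := by have := hx.1; positivity
  have h1 : 0 < ⌈x * (j + 1) / T⌉₊ := Nat.ceil_pos.2 hy
  have h2 : cellIndex T j x = c ↔ ⌈x * (j + 1) / T⌉₊ = c + 1 := by
    rw [cellIndex]; omega
  rw [h2, Nat.ceil_eq_iff (Nat.succ_ne_zero c), cell, Set.mem_Ioc, uniformGrid_of_le hT hc.le,
    uniformGrid_of_le hT hc, lt_div_iff₀ hT, div_le_iff₀ hT, div_lt_iff₀ (by positivity),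
    le_div_iff₀ (by positivity)]
  push_cast
  simp only [mul_comm T]

theorem cellIndex_lt (hT : 0 < T) (j : ℕ) {x : ℝ} (hx : x ∈ Set.Ioc 0 T) :
    cellIndex T j x < j + 1 := by
  have h1 : ⌈x * (j + 1) / T⌉₊ ≤ j + 1 := by
    rw [Nat.ceil_le, div_le_iff₀ hT]
    push_cast
    rw [mul_comm]
    have := hx.2
    gcongr
  rw [cellIndex]; omega

/-- The right end point of the cell of the uniform grid that contains a given point. -/
def roundUp (hT : 0 < T) (j : ℕ) (x : ℝ) : ℝ := uniformGrid hT j (cellIndex T j x + 1)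

theorem roundUp_mem (hT : 0 < T) (j : ℕ) {x : ℝ} (hx : x ∈ Set.Ioc 0 T) :
    x ≤ roundUp hT j x ∧ roundUp hT j x < x + T / (j + 1) := by
  have h := (mem_cell_uniformGrid hT (cellIndex_lt hT j hx) hx).2 rfl
  refine ⟨h.2, ?_⟩
  have h1 := h.1
  rw [uniformGrid_of_le hT (cellIndex_lt hT j hx).le] at h1
  rw [roundUp, uniformGrid_of_le hT (cellIndex_lt hT j hx)]
  push_cast
  rw [mul_add, mul_one, add_div]
  linarith

theorem tendsto_div_add_one (T : ℝ) : Tendsto (fun j : ℕ => T / ((j : ℝ) + 1)) atTop (𝓝 0) :=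
  tendsto_const_nhds.div_atTop (tendsto_natCast_atTop_atTop.atTop_add tendsto_const_nhds)

theorem tendsto_roundUp (hT : 0 < T) {x : ℝ} (hx : x ∈ Set.Ioc 0 T) :
    Tendsto (fun j => roundUp hT j x) atTop (𝓝 x) := by
  refine tendsto_of_tendsto_of_tendsto_of_le_of_le tendsto_const_nhds ?_
    (fun j => (roundUp_mem hT j hx).1) (fun j => (roundUp_mem hT j hx).2.le)
  simpa using (tendsto_div_add_one T).const_add x

theorem measurable_cellIndex (T : ℝ) (j : ℕ) : Measurable (cellIndex T j) := by
  unfold cellIndex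
  have : Measurable fun x : ℝ => ⌈x * (j + 1) / T⌉₊ := Nat.measurable_ceil.comp (by fun_prop)
  exact (measurable_from_top (f := fun k : ℕ => k - 1)).comp this

theorem measurable_roundUp (hT : 0 < T) (j : ℕ) : Measurable (roundUp hT j) := by
  unfold roundUp
  exact (measurable_from_top (f := fun c : ℕ => (uniformGrid hT j (c + 1) : ℝ))).comp
    (measurable_cellIndex T j)

theorem ae_mem_Ioc_cube (T : ℝ) (n : ℕ) : ∀ᵐ u ∂(cube T n), ∀ r, u r ∈ Set.Ioc 0 T := by
  rw [ae_all_iff]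
  intro r
  have : ∀ᵐ x ∂((volume : Measure ℝ).restrict (Set.Icc 0 T)), x ∈ Set.Ioc 0 T := by
    rw [← Measure.restrict_congr_set Ioc_ae_eq_Icc]
    exact ae_restrict_mem measurableSet_Ioc
  exact (Measure.quasiMeasurePreserving_eval _ r).ae this

theorem cube_absolutelyContinuous (T : ℝ) (n : ℕ) : cube T n ≪ volume := by
  rw [cube, ← Measure.restrict_pi_pi]
  exact Measure.restrict_le_self.absolutelyContinuous

/-- Each diagonal `u r = u s` is a proper linear subspace, hence null. This is why step functions
that vanish near the diagonals can still be dense. -/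
theorem ae_injective_cube (T : ℝ) (n : ℕ) : ∀ᵐ u ∂(cube T n), Function.Injective u := by
  have h : ∀ r s : Fin n, r ≠ s → ∀ᵐ u ∂(cube T n), u r ≠ u s := by
    intro r s hrs
    refine (cube_absolutelyContinuous T n).ae_le ?_
    let L : (Fin n → ℝ) →ₗ[ℝ] ℝ :=
      LinearMap.proj (R := ℝ) (φ := fun _ : Fin n => ℝ) r - LinearMap.proj s
    have h1 : L.ker ≠ ⊤ := by
      intro h2
      have h3 : L (Pi.single r 1) = 0 := by
        rw [← LinearMap.mem_ker, h2]; trivial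
      simp [L, hrs] at h3
    have := Measure.addHaar_submodule volume L.ker h1
    change volume {u : Fin n → ℝ | u r ≠ u s}ᶜ = 0
    refine measure_mono_null ?_ this
    intro u hu
    simp only [ne_eq, Set.mem_compl_iff, not_not, Set.mem_ofPred_eq] at hu
    simp [L, hu]
  have h' : ∀ᵐ u ∂(cube T n), ∀ r s : Fin n, r ≠ s → u r ≠ u s := by
    rw [ae_all_iff]; intro r
    rw [ae_all_iff]; intro s
    by_cases hrs : r = s
    · simp [hrs]
    · filter_upwards [h r s hrs] with u hu _ using hu
  filter_upwards [h'] with u hu r s hrs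
  by_contra hne
  exact hu r s hne hrs

/-- The injective index maps into the cells of the uniform grid. -/
def injectiveIndices (n j : ℕ) : Finset (Fin n → ℕ) :=
  (Fintype.piFinset fun _ => Finset.range (j + 1)).filter Function.Injective

theorem mem_injectiveIndices {n j : ℕ} {i : Fin n → ℕ} :
    i ∈ injectiveIndices n j ↔ (∀ r, i r < j + 1) ∧ Function.Injective i := by
  simp [injectiveIndices]

/-- The off-diagonal step function on the uniform grid that samples a given function. -/
def gridApprox (hT : 0 < T) {n : ℕ} (φ : (Fin n → ℝ) → ℝ) (j : ℕ) : L2Cube T n :=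
  ∑ i ∈ injectiveIndices n j,
    φ (fun r => uniformGrid hT j (i r + 1)) • gridKernel (uniformGrid hT j) i

theorem gridApprox_ae_eq (hT : 0 < T) {n : ℕ} (φ : (Fin n → ℝ) → ℝ) (j : ℕ) :
    gridApprox hT φ j =ᵐ[cube T n] fun u =>
      open scoped Classical in
      if Function.Injective (fun r => cellIndex T j (u r)) then φ (fun r => roundUp hT j (u r))
      else 0 := by
  have h1 := fun i : Fin n → ℕ => Lp.coeFn_smul (φ (fun r => uniformGrid hT j (i r + 1)))
      (gridKernel (uniformGrid hT j) i)
  filter_upwards [ae_mem_Ioc_cube T n, Lp.coeFn_finsetSum (p := 2) (injectiveIndices n j)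
      (fun i => φ (fun r => uniformGrid hT j (i r + 1)) • gridKernel (uniformGrid hT j) i),
    ae_all_iff.2 fun i => gridKernel_ae_eq (uniformGrid hT j) (n := n) i,
    ae_all_iff.2 h1] with u hu h2 h3 h4
  rw [gridApprox, h2]
  simp_rw [Finset.sum_apply, h4, Pi.smul_apply, h3, smul_eq_mul]
  have h5 : ∀ i ∈ injectiveIndices n j, (u ∈ Set.univ.pi fun r => cell (uniformGrid hT j) (i r)) ↔
      (fun r => cellIndex T j (u r)) = i := by
    intro i hi
    rw [mem_injectiveIndices] at hi
    rw [Set.mem_univ_pi, funext_iff]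
    exact forall_congr' fun r => mem_cell_uniformGrid hT (hi.1 r) (hu r)
  split_ifs with hinj
  · have hmem : (fun r => cellIndex T j (u r)) ∈ injectiveIndices n j :=
      mem_injectiveIndices.2 ⟨fun r => cellIndex_lt hT j (hu r), hinj⟩
    rw [Finset.sum_eq_single_of_mem _ hmem]
    · rw [Set.indicator_of_mem ((h5 _ hmem).2 rfl), mul_one]
      rfl
    · intro i hi hne
      rw [Set.indicator_of_notMem (fun h => hne ((h5 i hi).1 h).symm), mul_zero]
  · refine Finset.sum_eq_zero fun i hi => ?_
    rw [Set.indicator_of_notMem, mul_zero]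
    intro h
    apply hinj
    rw [(h5 i hi).1 h]
    exact (mem_injectiveIndices.1 hi).2

/-- The grid approximations of a bounded function converge to it in `L²` as soon as its samples
converge to it almost everywhere. -/
theorem tendsto_gridApprox (hT : 0 < T) {n : ℕ} {φ : (Fin n → ℝ) → ℝ} (hφ : Measurable φ) {C : ℝ}
    (hC : ∀ u, |φ u| ≤ C)
    (hlim : ∀ᵐ u ∂(cube T n), Tendsto (fun j => φ fun r => roundUp hT j (u r)) atTop (𝓝 (φ u))) :
    Tendsto (gridApprox hT φ) atTop (𝓝 (toL2 (cube T n) φ)) := by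
  classical
  have h0 : 0 ≤ C := (abs_nonneg _).trans (hC 0)
  have h1 : gridApprox hT φ = fun j => toL2 (cube T n) (fun u =>
      if Function.Injective (fun r => cellIndex T j (u r)) then φ (fun r => roundUp hT j (u r))
      else 0) := by
    funext j
    refine (toL2_eq_of_ae_eq ?_).symm
    refine (EventuallyEq.trans (gridApprox_ae_eq hT φ j) (Eventually.of_forall fun u => ?_)).symm
    congr
  rw [h1]
  refine tendsto_toL2_of_bounded (C := C) (fun j => ?_) (fun j => Eventually.of_forall fun u => ?_) ?_
  · refine (Measurable.ite ?_ ?_ measurable_const).aestronglyMeasurable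
    · have hm : Measurable fun (u : Fin n → ℝ) r => cellIndex T j (u r) :=
        measurable_pi_lambda _ fun r => (measurable_cellIndex T j).comp (measurable_pi_apply r)
      exact hm (MeasurableSet.of_discrete (s := {i : Fin n → ℕ | Function.Injective i}))
    · exact hφ.comp (measurable_pi_lambda _ fun r =>
        (measurable_roundUp hT j).comp (measurable_pi_apply r))
  · split_ifs
    · exact hC _
    · simpa using h0
  · filter_upwards [hlim, ae_mem_Ioc_cube T n, ae_injective_cube T n] with u h2 h3 h4
    refine h2.congr' ?_
    -- Off the diagonals, distinct coordinates are eventually rounded to distinct grid points. They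
    -- then lie in distinct cells, so the cut-off at the diagonal is eventually inactive.
    have h5 : ∀ r s : Fin n, ∀ᶠ j in atTop, r ≠ s → roundUp hT j (u r) ≠ roundUp hT j (u s) := by
      intro r s
      by_cases hrs : r = s
      · simp [hrs]
      · have hne : u r ≠ u s := fun h => hrs (h4 h)
        filter_upwards [((tendsto_roundUp hT (h3 r)).sub
          (tendsto_roundUp hT (h3 s))).eventually_ne (sub_ne_zero.2 hne)] with j hj _
        exact sub_ne_zero.1 hj
    have h6 : ∀ᶠ j in atTop, ∀ r s : Fin n, r ≠ s → roundUp hT j (u r) ≠ roundUp hT j (u s) :=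
      eventually_all.2 fun r => eventually_all.2 fun s => h5 r s
    filter_upwards [h6] with j hj
    rw [if_pos]
    intro r s hrs
    by_contra hne
    refine hj r s hne ?_
    simp only at hrs
    rw [roundUp, roundUp, hrs]

end Density

/-! ### The multiple integral as a bounded operator; uniqueness of the chaos decomposition; the
space `𝒢`. -/

section MultipleIto

variable {Ω : Type*} [MeasurableSpace Ω] {T : ℝ} {B : Set.Icc (0 : ℝ) T → Ω → ℝ} {P : Measure Ω}
  [IsProbabilityMeasure P]

theorem gridPair_mem_elementaryPairs (hB : IsBrownianMotionOn B P) {t : ℕ → Set.Icc (0 : ℝ) T}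
    (ht : Monotone t) {n : ℕ} {i : Fin n → ℕ} (hi : Function.Injective i) :
    (gridKernel t i, gridValue B P t i) ∈ elementaryPairs B P n :=
  ⟨fun r => t (i r), fun r => t (i r + 1), fun _ => ht (Nat.le_succ _),
    fun _ _ hrs => disjoint_cell ht (fun h => hrs (hi h)), gridKernel_ae_eq t i,
    gridValue_ae_eq hB ht i⟩

theorem gridPair_mem_multipleItoGraph (hB : IsBrownianMotionOn B P) {t : ℕ → Set.Icc (0 : ℝ) T}
    (ht : Monotone t) {n : ℕ} {i : Fin n → ℕ} (hi : Function.Injective i) :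
    (gridKernel t i, gridValue B P t i) ∈ multipleItoGraph B P n :=
  Submodule.le_topologicalClosure _ (Submodule.subset_span (gridPair_mem_elementaryPairs hB ht hi))

/-- The value of the multiple integral of `gridApprox`. -/
def gridApproxValue (B : Set.Icc (0 : ℝ) T → Ω → ℝ) (P : Measure Ω) (hT : 0 < T) {n : ℕ}
    (φ : (Fin n → ℝ) → ℝ) (j : ℕ) : Lp ℝ 2 P :=
  ∑ i ∈ injectiveIndices n j,
    φ (fun r => uniformGrid hT j (i r + 1)) • gridValue B P (uniformGrid hT j) i

theorem gridApprox_mem_multipleItoGraph (hT : 0 < T) (hB : IsBrownianMotionOn B P) {n : ℕ}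
    (φ : (Fin n → ℝ) → ℝ) (j : ℕ) :
    (gridApprox hT φ j, gridApproxValue B P hT φ j) ∈ multipleItoGraph B P n := by
  have : (gridApprox hT φ j, gridApproxValue B P hT φ j) = ∑ i ∈ injectiveIndices n j,
      φ (fun r => uniformGrid hT j (i r + 1)) •
        (gridKernel (uniformGrid hT j) i, gridValue B P (uniformGrid hT j) i) := by
    ext1
    · simp [gridApprox, Prod.fst_sum]
    · simp [gridApproxValue, Prod.snd_sum]
  rw [this]
  exact Submodule.sum_mem _ fun i hi => Submodule.smul_mem _ _
    (gridPair_mem_multipleItoGraph hB (monotone_uniformGrid hT j) (mem_injectiveIndices.1 hi).2)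

/-- The projection of the graph to the kernels is bounded below by the isometry estimate, and the
graph is complete, so the range is closed. It contains the grid approximations of bounded continuous
functions, hence it is dense, hence everything. -/
theorem exists_mem_multipleItoGraph (hT : 0 < T) (hB : IsBrownianMotionOn B P) {n : ℕ}
    (h : L2Cube T n) : ∃ Y, (h, Y) ∈ multipleItoGraph B P n := by
  let L : multipleItoGraph B P n →L[ℝ] L2Cube T n :=
    ContinuousLinearMap.fst ℝ _ _ ∘L (multipleItoGraph B P n).subtypeL
  have hcl : IsClosed (multipleItoGraph B P n : Set (L2Cube T n × Lp ℝ 2 P)) :=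
    Submodule.isClosed_topologicalClosure _
  have : CompleteSpace (multipleItoGraph B P n) := hcl.completeSpace_coe
  -- The norm of a pair is the larger of the two norms; the kernel accounts for `1` and the integral
  -- for `√n!`.
  have hL : AntilipschitzWith (Real.toNNReal (max 1 (Real.sqrt n.factorial))) L := by
    refine AddMonoidHomClass.antilipschitz_of_bound L fun z => ?_
    have h1 := norm_sq_le_of_mem_multipleItoGraph hT hB z.2
    rw [Real.coe_toNNReal _ (by positivity), show ‖z‖ = ‖z.1‖ from rfl, Prod.norm_def]
    have h2 : ‖L z‖ = ‖z.1.1‖ := rfl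
    rw [h2]
    refine max_le ?_ (h1.trans ?_)
    · exact le_mul_of_one_le_left (norm_nonneg _) (le_max_left _ _)
    · exact mul_le_mul_of_nonneg_right (le_max_right _ _) (norm_nonneg _)
  have hclosed : IsClosed (Set.range L) := hL.isClosed_range L.uniformContinuous
  have hdense : DenseRange L := by
    refine Dense.of_closure ?_
    refine (BoundedContinuousFunction.toLp_denseRange ℝ (cube T n) ℝ
      (p := 2) (by norm_num)).mono ?_
    rintro _ ⟨φ, rfl⟩
    have h1 : Tendsto (gridApprox hT φ) atTop (𝓝 (toL2 (cube T n) φ)) := by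
      refine tendsto_gridApprox hT φ.continuous.measurable (C := ‖φ‖)
        (fun u => φ.norm_coe_le_norm u) ?_
      filter_upwards [ae_mem_Ioc_cube T n] with u hu
      exact (φ.continuous.tendsto u).comp (tendsto_pi_nhds.2 fun r => tendsto_roundUp hT (hu r))
    have h2 : BoundedContinuousFunction.toLp 2 (cube T n) ℝ φ = toL2 (cube T n) φ :=
      (toL2_eq_of_ae_eq (BoundedContinuousFunction.coeFn_toLp 2 (cube T n) ℝ φ).symm).symm
    rw [h2]
    exact mem_closure_of_tendsto h1 (Eventually.of_forall fun j =>
      ⟨⟨_, gridApprox_mem_multipleItoGraph hT hB φ j⟩, rfl⟩)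
  have : h ∈ Set.range L := by
    rw [← hclosed.closure_eq]; exact hdense h
  obtain ⟨z, rfl⟩ := this
  exact ⟨z.1.2, z.2⟩

theorem mem_multipleItoGraph (hT : 0 < T) (hB : IsBrownianMotionOn B P) {n : ℕ}
    (h : L2Cube T n) : (h, multipleIto B P n h) ∈ multipleItoGraph B P n := by
  rw [multipleIto, dif_pos (exists_mem_multipleItoGraph hT hB h)]
  exact (exists_mem_multipleItoGraph hT hB h).choose_spec

theorem multipleIto_eq_of_mem (hT : 0 < T) (hB : IsBrownianMotionOn B P) {n : ℕ}
    {h : L2Cube T n} {Y : Lp ℝ 2 P} (hY : (h, Y) ∈ multipleItoGraph B P n) :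
    multipleIto B P n h = Y := by
  have h1 := norm_sq_le_of_mem_multipleItoGraph hT hB
    (Submodule.sub_mem _ (mem_multipleItoGraph hT hB h) hY)
  simp only [Prod.mk_sub_mk, sub_self, norm_zero, mul_zero] at h1
  exact sub_eq_zero.1 (norm_le_zero_iff.1 h1)

theorem multipleIto_add (hT : 0 < T) (hB : IsBrownianMotionOn B P) {n : ℕ} (f g : L2Cube T n) :
    multipleIto B P n (f + g) = multipleIto B P n f + multipleIto B P n g := by
  refine multipleIto_eq_of_mem hT hB ?_
  have := Submodule.add_mem _ (mem_multipleItoGraph hT hB f) (mem_multipleItoGraph hT hB g)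
  rwa [Prod.mk_add_mk] at this

theorem multipleIto_smul (hT : 0 < T) (hB : IsBrownianMotionOn B P) {n : ℕ} (c : ℝ)
    (f : L2Cube T n) : multipleIto B P n (c • f) = c • multipleIto B P n f := by
  refine multipleIto_eq_of_mem hT hB ?_
  have := Submodule.smul_mem _ c (mem_multipleItoGraph hT hB f)
  rwa [Prod.smul_mk] at this

theorem norm_multipleIto_le (hT : 0 < T) (hB : IsBrownianMotionOn B P) {n : ℕ} (h : L2Cube T n) :
    ‖multipleIto B P n h‖ ≤ Real.sqrt n.factorial * ‖h‖ := by
  have := norm_sq_le_of_mem_multipleItoGraph hT hB (mem_multipleItoGraph hT hB h)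
  dsimp only at this
  exact this

/-- The multiple Itô integral as a linear map. -/
def itoLM (hT : 0 < T) (hB : IsBrownianMotionOn B P) (n : ℕ) : L2Cube T n →ₗ[ℝ] Lp ℝ 2 P where
  toFun := multipleIto B P n
  map_add' := fun f g => multipleIto_add hT hB f g
  map_smul' := fun c f => multipleIto_smul hT hB c f

/-- The multiple Itô integral as a continuous linear map. -/
def itoCLM (hT : 0 < T) (hB : IsBrownianMotionOn B P) (n : ℕ) : L2Cube T n →L[ℝ] Lp ℝ 2 P :=
  (itoLM hT hB n).mkContinuous (Real.sqrt n.factorial) (norm_multipleIto_le hT hB)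

theorem itoCLM_apply (hT : 0 < T) (hB : IsBrownianMotionOn B P) {n : ℕ} (h : L2Cube T n) :
    itoCLM hT hB n h = multipleIto B P n h := rfl

theorem norm_itoCLM_le (hT : 0 < T) (hB : IsBrownianMotionOn B P) {n : ℕ} (h : L2Cube T n) :
    ‖itoCLM hT hB n h‖ ≤ Real.sqrt n.factorial * ‖h‖ := norm_multipleIto_le hT hB h

theorem inner_itoCLM (hT : 0 < T) (hB : IsBrownianMotionOn B P) {n : ℕ} (h g : L2Cube T n) :
    inner ℝ (itoCLM hT hB n h) (itoCLM hT hB n g) =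
      ∑ σ : Equiv.Perm (Fin n), inner ℝ h (reindexL2 T σ g) :=
  inner_multipleItoGraph hT hB (mem_multipleItoGraph hT hB h) (mem_multipleItoGraph hT hB g)

theorem inner_itoCLM_of_ne (hT : 0 < T) (hB : IsBrownianMotionOn B P) {n m : ℕ} (hnm : n ≠ m)
    (h : L2Cube T n) (g : L2Cube T m) :
    inner ℝ (itoCLM hT hB n h) (itoCLM hT hB m g) = 0 :=
  inner_multipleItoGraph_of_ne hT hB hnm (mem_multipleItoGraph hT hB h)
    (mem_multipleItoGraph hT hB g)

/-- By the isometry, the norm of `I_n(k)` involves `k` paired with the sum of its relabellings. For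
the difference of a kernel and its symmetrization that sum is zero. -/
theorem itoCLM_symL2 (hT : 0 < T) (hB : IsBrownianMotionOn B P) {n : ℕ} (h : L2Cube T n) :
    itoCLM hT hB n (symL2 T n h) = itoCLM hT hB n h := by
  rw [← sub_eq_zero, ← map_sub, ← norm_eq_zero, ← sq_eq_zero_iff, ← real_inner_self_eq_norm_sq,
    inner_itoCLM, ← inner_sum]
  have h1 : ∑ σ : Equiv.Perm (Fin n), reindexL2 T σ (symL2 T n h - h) = 0 := by
    have h2 := fun σ => (isSymmetric_iff _).1 (isSymmetric_symL2 T h) σ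
    simp_rw [map_sub, h2]
    rw [Finset.sum_sub_distrib, Finset.sum_const, Finset.card_univ, Fintype.card_perm,
      Fintype.card_fin, ← Nat.cast_smul_eq_nsmul ℝ, symL2_apply, smul_smul,
      mul_inv_cancel₀ (by positivity), one_smul, sub_self]
  rw [h1, inner_zero_right]

theorem norm_itoCLM_sq (hT : 0 < T) (hB : IsBrownianMotionOn B P) {n : ℕ} {h : L2Cube T n}
    (hh : IsSymmetric h) : ‖itoCLM hT hB n h‖ ^ 2 = n.factorial * ‖h‖ ^ 2 := by
  rw [isSymmetric_iff] at hh
  rw [← real_inner_self_eq_norm_sq, inner_itoCLM, Finset.sum_congr rfl fun σ _ => by rw [hh σ],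
    Finset.sum_const, Finset.card_univ, Fintype.card_perm, Fintype.card_fin, nsmul_eq_mul,
    real_inner_self_eq_norm_sq]

/-- Different chaoses are orthogonal, so pairing the difference of the two series with its own
`n`-th component isolates `n! |h_n - g_n|²`. -/
theorem isChaosExpansion_unique (hT : 0 < T) (hB : IsBrownianMotionOn B P) {X : Lp ℝ 2 P}
    {h g : ∀ n, L2Cube T n} (hh : IsChaosExpansion B P X h) (hg : IsChaosExpansion B P X g) :
    h = g := by
  funext n
  have h0 : HasSum (fun m => itoCLM hT hB m (h m - g m)) 0 := by
    have := hh.2.sub hg.2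
    simp only [sub_self] at this
    exact this.congr_fun fun m => by rw [map_sub]; rfl
  have h1 := h0.mapL (innerSL ℝ (itoCLM hT hB n (h n - g n)))
  have h2 := hasSum_single (f := fun m => innerSL ℝ (itoCLM hT hB n (h n - g n))
    (itoCLM hT hB m (h m - g m))) n (fun m hm => inner_itoCLM_of_ne hT hB hm.symm _ _)
  have h3 := h2.unique h1
  rw [map_zero, innerSL_apply_apply, real_inner_self_eq_norm_sq,
    norm_itoCLM_sq hT hB ((hh.1 n).sub (hg.1 n))] at h3
  have h4 : ‖h n - g n‖ = 0 := by
    have : (n.factorial : ℝ) ≠ 0 := by positivity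
    simpa [this] using h3
  exact sub_eq_zero.1 (norm_eq_zero.1 h4)

theorem chaosKernel_eq (hT : 0 < T) (hB : IsBrownianMotionOn B P) {X : Lp ℝ 2 P}
    {h : ∀ n, L2Cube T n} (hh : IsChaosExpansion B P X h) : chaosKernel B P X = h := by
  have ex : ∃ h : ∀ n, L2Cube T n, IsChaosExpansion B P X h := ⟨h, hh⟩
  rw [chaosKernel, dif_pos ex]
  exact isChaosExpansion_unique hT hB ex.choose_spec hh

/-- The norms of the chaos components `Iₙ(hₙ)` decay faster than every geometric sequence. -/
def RapidDecay (h : ∀ n, L2Cube T n) : Prop :=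
  ∀ r : ℕ, Summable fun n : ℕ => Real.sqrt n.factorial * (r : ℝ) ^ n * ‖h n‖

theorem isChaosExpansion_of_mem_G (hT : 0 < T) (hB : IsBrownianMotionOn B P) {X : Lp ℝ 2 P}
    (hX : X ∈ G B P) : IsChaosExpansion B P X (chaosKernel B P X) := by
  obtain ⟨h, hh, -⟩ := (Set.mem_iInter₂.1 hX) 1 le_rfl
  rw [chaosKernel_eq hT hB hh]; exact hh

theorem rapidDecay_of_mem_G (hT : 0 < T) (hB : IsBrownianMotionOn B P) {X : Lp ℝ 2 P}
    (hX : X ∈ G B P) : RapidDecay (chaosKernel B P X) := by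
  intro r
  -- The `1` makes the weight admissible in the definition of `𝒢`; the `2` leaves a spare factor
  -- `(1/2)^n`, which makes a merely bounded sequence summable.
  obtain ⟨h, hh, hs⟩ := (Set.mem_iInter₂.1 hX) (2 * r + 1) (by linarith [Nat.cast_nonneg (α := ℝ) r])
  rw [chaosKernel_eq hT hB hh]
  obtain ⟨C, hC⟩ := hs.tendsto_atTop_zero.bddAbove_range
  have hC' : ∀ n, (n.factorial : ℝ) * (2 * r + 1) ^ (2 * n) * ‖h n‖ ^ 2 ≤ C := fun n =>
    hC ⟨n, rfl⟩
  refine Summable.of_nonneg_of_le (fun n => by positivity) (fun n => ?_)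
    ((summable_geometric_two).mul_left (Real.sqrt C))
  have h1 : Real.sqrt n.factorial * (2 * r) ^ n * ‖h n‖ ≤ Real.sqrt C := by
    refine Real.le_sqrt_of_sq_le (le_trans ?_ (hC' n))
    rw [mul_pow, mul_pow, Real.sq_sqrt (by positivity), ← pow_mul, mul_comm n 2]
    gcongr
    linarith
  calc Real.sqrt n.factorial * (r : ℝ) ^ n * ‖h n‖
      = (Real.sqrt n.factorial * (2 * r) ^ n * ‖h n‖) * (1 / 2) ^ n := by
        have : ((2 : ℝ) * r) ^ n * (1 / 2) ^ n = r ^ n := by rw [← mul_pow]; congr 1; ring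
        rw [← this]; ring
    _ ≤ _ := by gcongr

/-- Conversely, a summable sequence is bounded, so its square is at most a constant multiple of it
and the weighted squares are summable. -/
theorem mem_G_of_rapidDecay (hT : 0 < T) (hB : IsBrownianMotionOn B P) {h : ∀ n, L2Cube T n}
    (hsym : ∀ n, IsSymmetric (h n)) (hh : RapidDecay h) :
    Summable (fun n => itoCLM hT hB n (h n)) ∧
    IsChaosExpansion B P (∑' n, itoCLM hT hB n (h n)) h ∧ (∑' n, itoCLM hT hB n (h n)) ∈ G B P := by
  have h1 : Summable (fun n => itoCLM hT hB n (h n)) := by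
    refine Summable.of_norm_bounded (hh 1) fun n => ?_
    simpa using norm_itoCLM_le hT hB (h n)
  have h2 : IsChaosExpansion B P (∑' n, itoCLM hT hB n (h n)) h := ⟨hsym, h1.hasSum⟩
  refine ⟨h1, h2, Set.mem_iInter₂.2 fun r hr => ⟨h, h2, ?_⟩⟩
  obtain ⟨k, hk⟩ := exists_nat_ge r
  have h3 := hh k
  obtain ⟨C, hC⟩ := h3.tendsto_atTop_zero.bddAbove_range
  have hC' : ∀ n, Real.sqrt n.factorial * (k : ℝ) ^ n * ‖h n‖ ≤ C := fun n => hC ⟨n, rfl⟩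
  refine Summable.of_nonneg_of_le (fun n => by positivity) (fun n => ?_) (h3.mul_left C)
  calc (n.factorial : ℝ) * r ^ (2 * n) * ‖h n‖ ^ 2
      ≤ (n.factorial : ℝ) * (k : ℝ) ^ (2 * n) * ‖h n‖ ^ 2 := by gcongr
    _ = (Real.sqrt n.factorial * (k : ℝ) ^ n * ‖h n‖) ^ 2 := by
        rw [mul_pow, mul_pow, Real.sq_sqrt (by positivity), ← pow_mul, mul_comm n 2]
    _ ≤ _ := by
        rw [pow_two]
        exact mul_le_mul_of_nonneg_right (hC' n) (by positivity)

end MultipleIto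

/-! ### Sections of kernels as square integrable functions with values in kernels. -/

section Sections

/-- By the Lindelöf property an open set is a countable union of balls, and the preimage of a ball
is a sublevel set of a distance function. -/
theorem stronglyMeasurable_of_measurable_edist {β E : Type*} [MeasurableSpace β]
    [PseudoMetricSpace E] [SecondCountableTopology E] {f : β → E}
    (hf : ∀ g : E, Measurable fun t => edist (f t) g) : StronglyMeasurable f := by
  borelize E
  refine Measurable.stronglyMeasurable (measurable_of_isOpen fun U hU => ?_)
  have h1 : ∀ x : U, ∃ r : ℝ≥0∞, 0 < r ∧ Metric.eball (x : E) r ⊆ U := fun x =>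
    EMetric.isOpen_iff.1 hU x x.2
  choose r hr hrU using h1
  obtain ⟨S, hS, hSU⟩ := TopologicalSpace.isOpen_iUnion_countable
    (fun x : U => Metric.eball (x : E) (r x)) fun x => Metric.isOpen_eball
  have h2 : U = ⋃ x ∈ S, Metric.eball (x : E) (r x) := by
    rw [hSU]
    refine Set.Subset.antisymm (fun x hx => Set.mem_iUnion.2 ⟨⟨x, hx⟩, ?_⟩) (Set.iUnion_subset hrU)
    exact Metric.mem_eball_self (hr _)
  rw [h2, Set.preimage_iUnion₂]
  refine MeasurableSet.biUnion hS fun x _ => ?_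
  exact measurableSet_lt (hf x) measurable_const

/-- The distance from a section to a fixed `g` is an integral of a jointly measurable function,
hence measurable in the parameter. Where the section is not square integrable, which happens on a
measurable set, the default value `0` makes that distance constant. -/
theorem stronglyMeasurable_toL2_section {α β : Type*} [MeasurableSpace α] [MeasurableSpace β]
    {μ : Measure α} [SFinite μ] [SecondCountableTopology (Lp ℝ 2 μ)] {F : α → β → ℝ}
    (hF : Measurable fun p : α × β => F p.1 p.2) :
    StronglyMeasurable fun t => toL2 μ fun s => F s t := by
  refine stronglyMeasurable_of_measurable_edist fun g => ?_
  have hsec : ∀ t, Measurable fun s => F s t := fun t =>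
    hF.comp (measurable_id.prodMk measurable_const)
  have hA : MeasurableSet {t | MemLp (fun s => F s t) 2 μ} := by
    have : {t | MemLp (fun s => F s t) 2 μ} = {t | ∫⁻ s, ‖F s t‖ₑ ^ (2 : ℝ) ∂μ < ∞} := by
      ext t
      simp only [Set.mem_ofPred_eq]
      rw [MemLp, and_iff_right (hsec t).aestronglyMeasurable,
        eLpNorm_lt_top_iff_lintegral_rpow_enorm_lt_top (by norm_num) (by norm_num)]
      simp
    rw [this]
    refine measurableSet_lt ?_ measurable_const
    exact Measurable.lintegral_prod_left' (f := fun p : α × β => ‖F p.1 p.2‖ₑ ^ (2 : ℝ))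
      (by fun_prop)
  have h1 : (fun t => edist (toL2 μ fun s => F s t) g) = fun t =>
      open scoped Classical in
      if t ∈ {t | MemLp (fun s => F s t) 2 μ} then
        (∫⁻ s, ‖F s t - g s‖ₑ ^ (2 : ℝ) ∂μ) ^ (1 / (2 : ℝ)) else edist 0 g := by
    funext t
    split_ifs with ht
    · rw [Lp.edist_def, eLpNorm_congr_ae ((toL2_ae_eq ht).sub (EventuallyEq.refl _ g)),
        eLpNorm_eq_lintegral_rpow_enorm_toReal (by norm_num) (by norm_num)]
      simp
    · rw [toL2, dif_neg (show ¬ MemLp (fun s => F s t) 2 μ from ht)]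
  rw [h1]
  refine Measurable.ite hA ?_ measurable_const
  refine Measurable.pow_const ?_ _
  have hg : Measurable fun p : α × β => g p.1 :=
    (Lp.stronglyMeasurable g).measurable.comp measurable_fst
  exact Measurable.lintegral_prod_left' (f := fun p : α × β => ‖F p.1 p.2 - g p.1‖ₑ ^ (2 : ℝ))
      (by fun_prop)

variable {T : ℝ}

theorem measurePreserving_append_swap (T : ℝ) (m n : ℕ) :
    MeasurePreserving (fun p : (Fin n → ℝ) × (Fin m → ℝ) => Fin.append p.2 p.1)
      ((cube T n).prod (cube T m)) (cube T (m + n)) :=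
  (measurePreserving_append T m n).comp Measure.measurePreserving_swap

theorem ae_ae_append {m n : ℕ} {p : (Fin (m + n) → ℝ) → Prop} (h : ∀ᵐ u ∂(cube T (m + n)), p u) :
    ∀ᵐ t ∂(cube T n), ∀ᵐ s ∂(cube T m), p (Fin.append s t) :=
  Measure.ae_ae_of_ae_prod
    ((measurePreserving_append_swap T m n).quasiMeasurePreserving.ae h)

theorem measurable_append (m n : ℕ) :
    Measurable fun p : (Fin m → ℝ) × (Fin n → ℝ) => Fin.append p.1 p.2 :=
  (measurePreserving_append 0 m n).measurable

theorem measurable_append_left {m n : ℕ} (t : Fin n → ℝ) :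
    Measurable fun s : Fin m → ℝ => Fin.append s t :=
  (measurable_append m n).comp (measurable_id.prodMk measurable_const)

theorem lintegral_append {m n : ℕ} {f : (Fin (m + n) → ℝ) → ℝ≥0∞} (hf : Measurable f) :
    ∫⁻ t, ∫⁻ s, f (Fin.append s t) ∂(cube T m) ∂(cube T n) = ∫⁻ u, f u ∂(cube T (m + n)) := by
  rw [← (measurePreserving_append_swap T m n).lintegral_comp hf,
    lintegral_prod (fun p : (Fin n → ℝ) × (Fin m → ℝ) => f (Fin.append p.2 p.1))
      (hf.comp (measurePreserving_append_swap T m n).measurable).aemeasurable]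

instance : Fact ((2 : ℝ≥0∞) ≠ ∞) := ⟨ENNReal.ofNat_ne_top⟩

/-- The section of a kernel at `t`. -/
def sectionL2 {m n : ℕ} (h : L2Cube T (m + n)) (t : Fin n → ℝ) : L2Cube T m :=
  toL2 (cube T m) fun s => h (Fin.append s t)

theorem stronglyMeasurable_sectionL2 {m n : ℕ} (h : L2Cube T (m + n)) :
    StronglyMeasurable (sectionL2 h : (Fin n → ℝ) → L2Cube T m) :=
  stronglyMeasurable_toL2_section (F := fun s t => h (Fin.append s t))
    ((Lp.stronglyMeasurable h).measurable.comp (measurable_append m n))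

theorem measurable_section {m n : ℕ} (h : L2Cube T (m + n)) (t : Fin n → ℝ) :
    Measurable fun s : Fin m → ℝ => h (Fin.append s t) :=
  (Lp.stronglyMeasurable h).measurable.comp (measurable_append_left t)

theorem ae_memLp_section {m n : ℕ} (h : L2Cube T (m + n)) :
    ∀ᵐ t ∂(cube T n), MemLp (fun s => h (Fin.append s t)) 2 (cube T m) := by
  have hm : Measurable fun u => ‖h u‖ₑ ^ (2 : ℝ) :=
    (Lp.stronglyMeasurable h).measurable.enorm.pow_const _
  have h1 : ∫⁻ u, ‖h u‖ₑ ^ (2 : ℝ) ∂(cube T (m + n)) ≠ ∞ := by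
    have := (eLpNorm_lt_top_iff_lintegral_rpow_enorm_lt_top (p := 2) (by norm_num)
      (by norm_num)).1 (Lp.eLpNorm_lt_top h)
    simpa using this.ne
  rw [← lintegral_append hm] at h1
  have h2 := ae_lt_top (Measurable.lintegral_prod_left'
    (f := fun p : (Fin m → ℝ) × (Fin n → ℝ) => ‖h (Fin.append p.1 p.2)‖ₑ ^ (2 : ℝ))
    (hm.comp (measurable_append m n))) h1
  filter_upwards [h2] with t ht
  refine ⟨(measurable_section h t).aestronglyMeasurable, ?_⟩
  rw [eLpNorm_lt_top_iff_lintegral_rpow_enorm_lt_top (by norm_num) (by norm_num)]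
  simpa using ht

theorem sectionL2_ae_eq {m n : ℕ} (h : L2Cube T (m + n)) :
    ∀ᵐ t ∂(cube T n), sectionL2 h t =ᵐ[cube T m] fun s => h (Fin.append s t) := by
  filter_upwards [ae_memLp_section h] with t ht using toL2_ae_eq ht

theorem sectionL2_ae_eq_of {m n : ℕ} {h : L2Cube T (m + n)} {f : (Fin (m + n) → ℝ) → ℝ}
    (hf : h =ᵐ[cube T (m + n)] f) :
    ∀ᵐ t ∂(cube T n), sectionL2 h t =ᵐ[cube T m] fun s => f (Fin.append s t) := by
  filter_upwards [sectionL2_ae_eq h, ae_ae_append hf] with t h1 h2 using h1.trans h2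

theorem eLpNorm_sectionL2 {m n : ℕ} (h : L2Cube T (m + n)) :
    eLpNorm (sectionL2 h : (Fin n → ℝ) → L2Cube T m) 2 (cube T n) = eLpNorm h 2 (cube T (m + n)) := by
  rw [eLpNorm_eq_lintegral_rpow_enorm_toReal (by norm_num) (by norm_num),
    eLpNorm_eq_lintegral_rpow_enorm_toReal (by norm_num) (by norm_num)]
  congr 1
  rw [← lintegral_append ((Lp.stronglyMeasurable h).measurable.enorm.pow_const _)]
  refine lintegral_congr_ae ?_
  filter_upwards [sectionL2_ae_eq h] with t ht
  rw [Lp.enorm_def, eLpNorm_congr_ae ht,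
    eLpNorm_eq_lintegral_rpow_enorm_toReal (by norm_num) (by norm_num), ← ENNReal.rpow_mul]
  simp

theorem memLp_sectionL2 {m n : ℕ} (h : L2Cube T (m + n)) :
    MemLp (sectionL2 h : (Fin n → ℝ) → L2Cube T m) 2 (cube T n) :=
  ⟨(stronglyMeasurable_sectionL2 h).aestronglyMeasurable, by
    rw [eLpNorm_sectionL2]; exact Lp.eLpNorm_lt_top h⟩

/-- A kernel of `m + n` variables as a square integrable function of the last `n` variables whose
values are kernels of the first `m` variables. -/
def curryL2 (T : ℝ) (m n : ℕ) : L2Cube T (m + n) →ₗᵢ[ℝ] Lp (L2Cube T m) 2 (cube T n) where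
  toFun h := (memLp_sectionL2 h).toLp _
  map_add' f g := by
    refine Lp.ext ?_
    filter_upwards [(memLp_sectionL2 (m := m) (f + g)).coeFn_toLp,
      (memLp_sectionL2 (m := m) f).coeFn_toLp, (memLp_sectionL2 (m := m) g).coeFn_toLp,
      Lp.coeFn_add ((memLp_sectionL2 (m := m) f).toLp _) ((memLp_sectionL2 (m := m) g).toLp _),
      sectionL2_ae_eq_of (Lp.coeFn_add f g), sectionL2_ae_eq f, sectionL2_ae_eq g]
      with t h1 h2 h3 h4 h5 h6 h7
    rw [h1, h4, Pi.add_apply, h2, h3]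
    refine Lp.ext ?_
    filter_upwards [h5, h6, h7, Lp.coeFn_add (sectionL2 f t) (sectionL2 g t)] with s k1 k2 k3 k4
    rw [k1, k4, Pi.add_apply, Pi.add_apply, k2, k3]
  map_smul' c f := by
    refine Lp.ext ?_
    filter_upwards [(memLp_sectionL2 (m := m) (c • f)).coeFn_toLp,
      (memLp_sectionL2 (m := m) f).coeFn_toLp,
      Lp.coeFn_smul c ((memLp_sectionL2 (m := m) f).toLp _),
      sectionL2_ae_eq_of (Lp.coeFn_smul c f), sectionL2_ae_eq f] with t h1 h2 h4 h5 h6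
    rw [h1, RingHom.id_apply, h4, Pi.smul_apply, h2]
    refine Lp.ext ?_
    filter_upwards [h5, h6, Lp.coeFn_smul c (sectionL2 f t)] with s k1 k2 k4
    rw [k1, k4, Pi.smul_apply, Pi.smul_apply, k2]
  norm_map' h := by
    change ‖(memLp_sectionL2 h).toLp _‖ = ‖h‖
    rw [Lp.norm_toLp, eLpNorm_sectionL2, Lp.norm_def]

theorem curryL2_ae_eq {m n : ℕ} (h : L2Cube T (m + n)) :
    curryL2 T m n h =ᵐ[cube T n] sectionL2 h := (memLp_sectionL2 h).coeFn_toLp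

/-- A permutation of the free variables extends by the identity to all variables. Only finitely many
permutations are involved, so their exceptional null sets can be united. -/
theorem ae_isSymmetric_sectionL2 {m n : ℕ} {h : L2Cube T (m + n)} (hh : IsSymmetric h) :
    ∀ᵐ t ∂(cube T n), IsSymmetric (sectionL2 h t : L2Cube T m) := by
  have h1 : ∀ σ : Equiv.Perm (Fin m), ∀ᵐ t ∂(cube T n), ∀ᵐ s ∂(cube T m),
      h (Fin.append (s ∘ σ) t) = h (Fin.append s t) := by
    intro σ
    let τ : Equiv.Perm (Fin (m + n)) :=
      finSumFinEquiv.permCongr (Equiv.sumCongr σ (Equiv.refl (Fin n)))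
    have h2 : ∀ (s : Fin m → ℝ) (t : Fin n → ℝ), Fin.append s t ∘ τ = Fin.append (s ∘ σ) t := by
      intro s t
      funext i
      refine Fin.addCases (fun j => ?_) (fun j => ?_) i
      · simp [τ, Equiv.permCongr_apply]
      · simp [τ, Equiv.permCongr_apply]
    filter_upwards [ae_ae_append (hh τ)] with t ht
    filter_upwards [ht] with s hs
    rw [← h2]; exact hs
  filter_upwards [ae_all_iff.2 h1, sectionL2_ae_eq h] with t h2 h3
  rw [isSymmetric_iff]
  intro σ
  refine Lp.ext ((reindexL2_ae_eq_of T σ h3).trans (EventuallyEq.trans (h2 σ) h3.symm))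

end Sections

/-! ### Existence, smoothness and iteration of the Hida–Malliavin derivatives. -/

section Derivatives

variable {Ω : Type*} [MeasurableSpace Ω] {T : ℝ} {B : Set.Icc (0 : ℝ) T → Ω → ℝ} {P : Measure Ω}
  [IsProbabilityMeasure P]

/-- The cost of differentiating `n` times: as `(m+n)! / m!` is `n!` times a binomial coefficient,
which is at most `2 ^ (m + n)`, only a geometric factor and the constant `√n!` are lost. Rapid decay
absorbs both. -/
theorem descFactorial_mul_sqrt_factorial_le (m n : ℕ) :
    ((m + n).descFactorial n : ℝ) * Real.sqrt m.factorial ≤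
      Real.sqrt n.factorial * (Real.sqrt (m + n).factorial * 2 ^ (m + n)) := by
  have h1 : ((m + n).descFactorial n : ℝ) * m.factorial = (m + n).factorial := by
    have := Nat.factorial_mul_descFactorial (Nat.le_add_left n m)
    rw [Nat.add_sub_cancel] at this
    rw [mul_comm]; exact_mod_cast this
  have h2 : ((m + n).descFactorial n : ℝ) ≤ n.factorial * 2 ^ (m + n) := by
    rw [Nat.descFactorial_eq_factorial_mul_choose]
    push_cast
    gcongr
    exact_mod_cast Nat.choose_le_two_pow (m + n) n
  refine le_of_sq_le_sq ?_ (by positivity)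
  rw [mul_pow, mul_pow, mul_pow, Real.sq_sqrt (by positivity), Real.sq_sqrt (by positivity),
    Real.sq_sqrt (by positivity), pow_two, mul_assoc, h1]
  calc ((m + n).descFactorial n : ℝ) * (m + n).factorial
      ≤ (n.factorial * 2 ^ (m + n)) * (m + n).factorial := by gcongr
    _ = n.factorial * ((m + n).factorial * 2 ^ (m + n)) := by ring
    _ ≤ n.factorial * ((m + n).factorial * (2 ^ (m + n)) ^ 2) := by
        gcongr
        exact le_self_pow₀ (one_le_pow₀ (by norm_num)) (by norm_num)

theorem RapidDecay.summable_deriv {h : ∀ n, L2Cube T n} (hh : RapidDecay h) (n r : ℕ) :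
    Summable fun m : ℕ => Real.sqrt m.factorial * (r : ℝ) ^ m *
      (((m + n).descFactorial n : ℝ) * ‖h (m + n)‖) := by
  have h1 := (summable_nat_add_iff n).2 (hh (2 * (r + 1)))
  refine Summable.of_nonneg_of_le (fun m => by positivity) (fun m => ?_)
    (h1.mul_left (Real.sqrt n.factorial))
  calc Real.sqrt m.factorial * (r : ℝ) ^ m * (((m + n).descFactorial n : ℝ) * ‖h (m + n)‖)
      = (((m + n).descFactorial n : ℝ) * Real.sqrt m.factorial) * (r : ℝ) ^ m * ‖h (m + n)‖ := by
        ring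
    _ ≤ (Real.sqrt n.factorial * (Real.sqrt (m + n).factorial * 2 ^ (m + n))) *
          ((r : ℝ) + 1) ^ (m + n) * ‖h (m + n)‖ := by
        have h2 : (r : ℝ) ^ m ≤ ((r : ℝ) + 1) ^ (m + n) :=
          (pow_le_pow_left₀ (by positivity) (by linarith) m).trans
            (pow_le_pow_right₀ (by linarith [Nat.cast_nonneg (α := ℝ) r]) (Nat.le_add_right m n))
        exact mul_le_mul_of_nonneg_right (mul_le_mul (descFactorial_mul_sqrt_factorial_le m n) h2
          (by positivity) (by positivity)) (norm_nonneg _)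
    _ = _ := by push_cast; rw [mul_pow]; ring

/-- For fixed `r`, the `L²` norms in `t` of the terms are summable, so by Minkowski's inequality the
series of norms converges for almost every `t`. As `RapidDecay` tests integers `r` only, countably
many null sets arise. -/
theorem ae_rapidDecay_section {h : ∀ n, L2Cube T n} (hh : RapidDecay h) (n : ℕ) :
    ∀ᵐ t ∂(cube T n), RapidDecay fun m =>
      ((m + n).descFactorial n : ℝ) • (sectionL2 (h (m + n)) t : L2Cube T m) := by
  unfold RapidDecay
  rw [ae_all_iff]
  intro r
  let f : ℕ → (Fin n → ℝ) → ℝ := fun m t => (Real.sqrt m.factorial * (r : ℝ) ^ m *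
      ((m + n).descFactorial n : ℝ)) • ‖(sectionL2 (h (m + n)) t : L2Cube T m)‖
  have hf : ∀ m, eLpNorm (f m) 2 (cube T n) = ENNReal.ofReal (Real.sqrt m.factorial * (r : ℝ) ^ m *
      (((m + n).descFactorial n : ℝ) * ‖h (m + n)‖)) := by
    intro m
    have h1 : eLpNorm (f m) 2 (cube T n) = ‖Real.sqrt m.factorial * (r : ℝ) ^ m *
        ((m + n).descFactorial n : ℝ)‖ₑ *
        eLpNorm (fun t => ‖(sectionL2 (h (m + n)) t : L2Cube T m)‖) 2 (cube T n) :=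
      eLpNorm_const_smul (Real.sqrt m.factorial * (r : ℝ) ^ m * ((m + n).descFactorial n : ℝ))
        (fun t => ‖(sectionL2 (h (m + n)) t : L2Cube T m)‖) 2 (cube T n)
    rw [h1, eLpNorm_norm, eLpNorm_sectionL2, ← mul_assoc, ENNReal.ofReal_mul (by positivity),
      Real.enorm_of_nonneg (by positivity), Lp.norm_def,
      ENNReal.ofReal_toReal (Lp.eLpNorm_lt_top _).ne]
  have h2 := summable_norm_of_tsum_eLpNorm_ne_top (μ := cube T n) (p := 2) (by norm_num) (f := f)
    (fun m => ((stronglyMeasurable_sectionL2 (h (m + n))).norm.const_smul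
      (Real.sqrt m.factorial * (r : ℝ) ^ m *
        ((m + n).descFactorial n : ℝ))).aestronglyMeasurable)
    (by
      simp_rw [hf]
      exact (hh.summable_deriv n r).tsum_ofReal_ne_top)
  filter_upwards [h2] with t ht
  refine ht.congr fun m => ?_
  simp only [f, norm_smul, Real.norm_eq_abs, abs_norm, smul_eq_mul, abs_mul, Nat.abs_cast]
  rw [abs_of_nonneg (by positivity), abs_of_nonneg (by positivity), mul_assoc]

/-- The chaos component of order `m` of the `n`-th derivative of `I_{m+n}(h)`, as a square
integrable function of the last `n` variables. -/
def derivTerm (hT : 0 < T) (hB : IsBrownianMotionOn B P) (m n : ℕ) :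
    L2Cube T (m + n) →L[ℝ] Lp (Lp ℝ 2 P) 2 (cube T n) :=
  ((m + n).descFactorial n : ℝ) •
    ((itoCLM hT hB m).compLpL 2 (cube T n) ∘L (curryL2 T m n).toContinuousLinearMap)

theorem norm_derivTerm_le (hT : 0 < T) (hB : IsBrownianMotionOn B P) {m n : ℕ}
    (h : L2Cube T (m + n)) : ‖derivTerm hT hB m n h‖ ≤
      Real.sqrt m.factorial * (((m + n).descFactorial n : ℝ) * ‖h‖) := by
  have h1 : ‖(itoCLM hT hB m).compLpL 2 (cube T n)‖ ≤ Real.sqrt m.factorial :=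
    (ContinuousLinearMap.norm_compLpL_le _).trans
      (ContinuousLinearMap.opNorm_le_bound _ (by positivity) (norm_itoCLM_le hT hB))
  have h2 : ‖(itoCLM hT hB m).compLpL 2 (cube T n) (curryL2 T m n h)‖ ≤
      Real.sqrt m.factorial * ‖h‖ := by
    refine (ContinuousLinearMap.le_of_opNorm_le _ h1 _).trans ?_
    rw [LinearIsometry.norm_map]
  have h3 : derivTerm hT hB m n h = ((m + n).descFactorial n : ℝ) •
    ((itoCLM hT hB m).compLpL 2 (cube T n) (curryL2 T m n h)) := rfl
  rw [h3, norm_smul, Real.norm_natCast]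
  calc _ ≤ ((m + n).descFactorial n : ℝ) * (Real.sqrt m.factorial * ‖h‖) := by gcongr
    _ = _ := by ring

theorem derivTerm_ae_eq (hT : 0 < T) (hB : IsBrownianMotionOn B P) {m n : ℕ}
    (h : L2Cube T (m + n)) : derivTerm hT hB m n h =ᵐ[cube T n] fun t =>
      itoCLM hT hB m (((m + n).descFactorial n : ℝ) • sectionL2 h t) := by
  have h3 : derivTerm hT hB m n h = ((m + n).descFactorial n : ℝ) •
    ((itoCLM hT hB m).compLpL 2 (cube T n) (curryL2 T m n h)) := rfl
  rw [h3]
  filter_upwards [Lp.coeFn_smul ((m + n).descFactorial n : ℝ)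
      ((itoCLM hT hB m).compLpL 2 (cube T n) (curryL2 T m n h)),
    ContinuousLinearMap.coeFn_compLpL (itoCLM hT hB m) (curryL2 T m n h),
    curryL2_ae_eq h] with t h4 h5 h6
  rw [h4, Pi.smul_apply, h5, h6, map_smul]

/-- The `n`-th derivative of `∑ₖ Iₖ(hₖ)` as a square integrable function on the cube. -/
def derivL2 (hT : 0 < T) (hB : IsBrownianMotionOn B P) (h : ∀ n, L2Cube T n) (n : ℕ) :
    Lp (Lp ℝ 2 P) 2 (cube T n) :=
  ∑' m, derivTerm hT hB m n (h (m + n))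

theorem RapidDecay.summable_norm_derivTerm (hT : 0 < T) (hB : IsBrownianMotionOn B P)
    {h : ∀ n, L2Cube T n} (hh : RapidDecay h) (n : ℕ) :
    Summable fun m => ‖derivTerm hT hB m n (h (m + n))‖ := by
  refine Summable.of_nonneg_of_le (fun m => norm_nonneg _) (fun m => ?_) (hh.summable_deriv n 1)
  simpa using norm_derivTerm_le hT hB (h (m + n))

/-- The series for the derivative converges both pointwise in `t` and in `L²` over the cube, and the
limits agree almost everywhere. Uniqueness of the chaos decomposition identifies the kernels of the
derivative, which makes it possible to differentiate again. -/
theorem ae_hidaDeriv (hT : 0 < T) (hB : IsBrownianMotionOn B P) {X : Lp ℝ 2 P} (hX : X ∈ G B P)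
    (n : ℕ) : ∀ᵐ t ∂(cube T n), HidaDerivExists B P n X t ∧ hidaDeriv B P n X t ∈ G B P ∧
      (chaosKernel B P (hidaDeriv B P n X t) = fun m =>
        ((m + n).descFactorial n : ℝ) • sectionL2 (chaosKernel B P X (m + n)) t) ∧
      hidaDeriv B P n X t = derivL2 hT hB (chaosKernel B P X) n t := by
  have hdec := rapidDecay_of_mem_G hT hB hX
  have hsym := (isChaosExpansion_of_mem_G hT hB hX).1
  have h1 := Lp.hasSum_coeFn_tsum (μ := cube T n) (p := 2)
    (f := fun m => derivTerm hT hB m n (chaosKernel B P X (m + n)))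
    (tsum_enorm_ne_top_iff_summable_norm.2 (hdec.summable_norm_derivTerm hT hB n))
  filter_upwards [ae_rapidDecay_section hdec n,
    ae_all_iff.2 fun m => ae_isSymmetric_sectionL2 (m := m) (hsym (m + n)),
    ae_all_iff.2 fun m => ae_memLp_section (m := m) (chaosKernel B P X (m + n)),
    ae_all_iff.2 fun m => derivTerm_ae_eq hT hB (m := m) (chaosKernel B P X (m + n)), h1]
    with t ht1 ht2 ht3 ht4 ht5
  have hterm : hidaTerm B P n X t = fun m => itoCLM hT hB m
      (((m + n).descFactorial n : ℝ) • sectionL2 (chaosKernel B P X (m + n)) t) := by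
    funext m
    rw [map_smul]
    rfl
  obtain ⟨k1, k2, k3⟩ := mem_G_of_rapidDecay hT hB (fun m => (ht2 m).smul _) ht1
  have hderiv : hidaDeriv B P n X t = ∑' m, itoCLM hT hB m
      (((m + n).descFactorial n : ℝ) • sectionL2 (chaosKernel B P X (m + n)) t) := by
    rw [hidaDeriv, hterm]
  refine ⟨⟨ht3, by rw [hterm]; exact k1⟩, by rw [hderiv]; exact k3, ?_, ?_⟩
  · rw [hderiv]; exact chaosKernel_eq hT hB k2
  · rw [hderiv]
    simp_rw [ht4] at ht5
    exact ht5.tsum_eq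

theorem kernel_comp_cast (h : ∀ n, L2Cube T n) {k k' : ℕ} (e : k = k') (x : Fin k' → ℝ) :
    h k (x ∘ Fin.cast e) = h k' x := by
  subst e; rfl

/-- `D^m D^n = D^(m+n)`: a section of a section is a section in the joined variables, and the
falling factorials multiply accordingly. The kernels of the inner derivative are classes that depend
on `t`, hence the iterated quantifiers over `t` and then `s`. -/
theorem ae_hidaDeriv_hidaDeriv (hT : 0 < T) (hB : IsBrownianMotionOn B P) {X : Lp ℝ 2 P}
    (hX : X ∈ G B P) (m n : ℕ) : ∀ᵐ t ∂(cube T n), ∀ᵐ s ∂(cube T m),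
      hidaDeriv B P m (hidaDeriv B P n X t) s = hidaDeriv B P (m + n) X (Fin.append s t) := by
  set h := chaosKernel B P X with hh
  filter_upwards [ae_hidaDeriv hT hB hX n, ae_ae_append (ae_hidaDeriv hT hB hX (m + n)),
    ae_all_iff.2 fun q => sectionL2_ae_eq (m := q) (chaosKernel B P X (q + n))]
    with t ht1 ht2 ht3
  have h1 : ∀ p : ℕ, ∀ᵐ s ∂(cube T m), ∀ᵐ u ∂(cube T p),
      chaosKernel B P (hidaDeriv B P n X t) (p + m) (Fin.append u s) =
        ((p + m + n).descFactorial n : ℝ) * h (p + (m + n)) (Fin.append u (Fin.append s t)) := by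
    intro p
    rw [ht1.2.2.1]
    filter_upwards [ae_ae_append ((ht3 (p + m))), ae_ae_append (Lp.coeFn_smul
      ((p + m + n).descFactorial n : ℝ) (sectionL2 (chaosKernel B P X (p + m + n)) t))] with s hs hs'
    filter_upwards [hs, hs'] with u hu hu'
    rw [hu', Pi.smul_apply, hu, Fin.append_assoc, smul_eq_mul, ← hh, kernel_comp_cast]
  filter_upwards [ht2, ae_all_iff.2 h1] with s hs hs1
  unfold hidaDeriv
  congr 1
  funext p
  have hL : MemLp (kernelSection B P (m + n) X (Fin.append s t) p) 2 (cube T p) := hs.1.1 p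
  have h2 : toL2 (cube T p) (kernelSection B P m (hidaDeriv B P n X t) s p) =
      ((p + m + n).descFactorial n : ℝ) •
        toL2 (cube T p) (kernelSection B P (m + n) X (Fin.append s t) p) := by
    rw [← toL2_const_smul _ hL]
    exact toL2_congr (hs1 p)
  have h3 : ((p + m).descFactorial m : ℝ) * ((p + m + n).descFactorial n : ℝ)
      = ((p + (m + n)).descFactorial (m + n) : ℝ) := by
    have := Nat.descFactorial_mul_descFactorial (n := p + m + n) (k := n) (m := m + n)
      (Nat.le_add_left n m)
    rw [Nat.add_sub_cancel, Nat.add_sub_cancel] at this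
    rw [← add_assoc p m n]
    exact_mod_cast this
  change hidaTerm B P m (hidaDeriv B P n X t) s p = _
  rw [hidaTerm, hidaTerm, h2, ← itoCLM_apply hT hB, ← itoCLM_apply hT hB, map_smul, smul_smul, h3]

end Derivatives

/-! ### Elementary symmetric functions and Newton's identities. -/

section SymmetricFunctions

theorem card_injective_piFinset {n : ℕ} (t : Finset ℕ) (ht : t.card = n) :
    ((Fintype.piFinset fun _ : Fin n => t).filter Function.Injective).card = n.factorial := by
  classical
  have h1 : Fintype.card (Fin n ↪ t) = n.factorial := by
    rw [Fintype.card_embedding_eq, Fintype.card_coe, Fintype.card_fin, ht, Nat.descFactorial_self]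
  rw [← h1, ← Finset.card_univ]
  refine (Finset.card_bij (fun (e : Fin n ↪ t) _ => fun r => (e r : ℕ)) ?_ ?_ ?_).symm
  · intro e _
    simp only [Finset.mem_filter, Fintype.mem_piFinset]
    exact ⟨fun r => (e r).2, fun a b h => e.injective (Subtype.ext h)⟩
  · intro e _ e' _ h
    ext r
    exact congrFun h r
  · intro i hi
    simp only [Finset.mem_filter, Fintype.mem_piFinset] at hi
    exact ⟨⟨fun r => ⟨i r, hi.1 r⟩, fun a b h => hi.2 (congrArg Subtype.val h)⟩,
      Finset.mem_univ _, rfl⟩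

/-- Fibering over the image: each `n`-element set is the image of exactly `n!` injective maps. -/
theorem sum_injective_prod_eq (s : Finset ℕ) (n : ℕ) (x : ℕ → ℝ) :
    ∑ i ∈ (Fintype.piFinset fun _ : Fin n => s).filter Function.Injective, ∏ r, x (i r) =
      n.factorial * ∑ t ∈ s.powersetCard n, ∏ c ∈ t, x c := by
  classical
  have hmaps : ∀ i ∈ (Fintype.piFinset fun _ : Fin n => s).filter Function.Injective,
      Finset.univ.image i ∈ s.powersetCard n := by
    intro i hi
    simp only [Finset.mem_filter, Fintype.mem_piFinset] at hi
    rw [Finset.mem_powersetCard, Finset.card_image_of_injective _ hi.2]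
    refine ⟨fun c hc => ?_, by simp⟩
    obtain ⟨r, -, rfl⟩ := Finset.mem_image.1 hc
    exact hi.1 r
  rw [← Finset.sum_fiberwise_of_maps_to hmaps, Finset.mul_sum]
  refine Finset.sum_congr rfl fun t ht => ?_
  rw [Finset.mem_powersetCard] at ht
  have h1 : ((Fintype.piFinset fun _ : Fin n => s).filter Function.Injective).filter
      (fun i => Finset.univ.image i = t)
      = (Fintype.piFinset fun _ : Fin n => t).filter Function.Injective := by
    ext i
    simp only [Finset.mem_filter, Fintype.mem_piFinset]
    constructor
    · rintro ⟨⟨-, hi⟩, rfl⟩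
      exact ⟨fun r => Finset.mem_image_of_mem _ (Finset.mem_univ r), hi⟩
    · rintro ⟨hi, hinj⟩
      refine ⟨⟨fun r => ht.1 (hi r), hinj⟩, Finset.eq_of_subset_of_card_le ?_ ?_⟩
      · intro c hc
        obtain ⟨r, -, rfl⟩ := Finset.mem_image.1 hc
        exact hi r
      · rw [Finset.card_image_of_injective _ hinj]; simp [ht.2]
  rw [h1, ← card_injective_piFinset t ht.2, ← nsmul_eq_mul, ← Finset.sum_const]
  refine Finset.sum_congr rfl fun i hi => ?_
  rw [← h1] at hi
  simp only [Finset.mem_filter, Fintype.mem_piFinset] at hi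
  rw [← hi.2, Finset.prod_image fun a _ b _ h => hi.1.2 h]

theorem newton_identity (x : ℕ → ℝ) (M n : ℕ) :
    (n : ℝ) * ∑ t ∈ (Finset.range M).powersetCard n, ∏ c ∈ t, x c = (-1) ^ (n + 1) *
      ∑ a ∈ Finset.HasAntidiagonal.antidiagonal n with a.1 < n, (-1) ^ a.1 *
        (∑ t ∈ (Finset.range M).powersetCard a.1, ∏ c ∈ t, x c) *
          ∑ c ∈ Finset.range M, x c ^ a.2 := by
  have h := congrArg (MvPolynomial.aeval fun c : Fin M => x c)
    (MvPolynomial.mul_esymm_eq_sum (Fin M) ℝ n)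
  have h1 : ∀ k, MvPolynomial.aeval (fun c : Fin M => x c) (MvPolynomial.esymm (Fin M) ℝ k) =
      ∑ t ∈ (Finset.range M).powersetCard k, ∏ c ∈ t, x c := by
    intro k
    rw [MvPolynomial.aeval_esymm_eq_multiset_esymm, ← Finset.esymm_map_val]
    congr 1
    have : (Finset.range M).val = (Finset.univ : Finset (Fin M)).val.map Fin.val := by
      have h : Finset.range M = Finset.univ.map (Fin.valEmbedding (n := M)) := by
        ext c
        simp only [Finset.mem_range, Finset.mem_map, Finset.mem_univ, true_and]
        exact ⟨fun h => ⟨⟨c, h⟩, rfl⟩, fun ⟨d, h⟩ => h ▸ d.2⟩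
      rw [h, Finset.map_val]
      rfl
    rw [this, Multiset.map_map]
    rfl
  have h2 : ∀ k, MvPolynomial.aeval (fun c : Fin M => x c) (MvPolynomial.psum (Fin M) ℝ k) =
      ∑ c ∈ Finset.range M, x c ^ k := by
    intro k
    simp [MvPolynomial.psum, Finset.sum_range]
  simpa [h1, h2, map_sum, map_mul] using h

end SymmetricFunctions

/-! ### Product kernels and tensor powers of functions of one variable. -/

section PowerKernels

variable {T : ℝ}

/-- Bounded measurable functions that are approximated by their samples on the uniform grids. -/
structure GridRegular (hT : 0 < T) (w : ℝ → ℝ) : Prop where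
  measurable : Measurable w
  bounded : ∃ C, ∀ x, |w x| ≤ C
  tendsto : ∀ᵐ x ∂((volume : Measure ℝ).restrict (Set.Icc 0 T)),
    Tendsto (fun j => w (roundUp hT j x)) atTop (𝓝 (w x))

theorem GridRegular.add {hT : 0 < T} {u v : ℝ → ℝ} (hu : GridRegular hT u)
    (hv : GridRegular hT v) : GridRegular hT fun x => u x + v x := by
  obtain ⟨C, hC⟩ := hu.bounded
  obtain ⟨D, hD⟩ := hv.bounded
  refine ⟨hu.measurable.add hv.measurable,
    ⟨C + D, fun x => (abs_add_le _ _).trans (add_le_add (hC x) (hD x))⟩, ?_⟩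
  filter_upwards [hu.tendsto, hv.tendsto] with x h1 h2 using h1.add h2

theorem GridRegular.const_mul {hT : 0 < T} {u : ℝ → ℝ} (hu : GridRegular hT u) (a : ℝ) :
    GridRegular hT fun x => a * u x := by
  obtain ⟨C, hC⟩ := hu.bounded
  refine ⟨hu.measurable.const_mul a,
    ⟨|a| * C, fun x => by rw [abs_mul]; exact mul_le_mul_of_nonneg_left (hC x) (abs_nonneg a)⟩, ?_⟩
  filter_upwards [hu.tendsto] with x h1 using h1.const_mul a

theorem GridRegular.sum {hT : 0 < T} {ι : Type*} (s : Finset ι) {u : ι → ℝ → ℝ}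
    (hu : ∀ i ∈ s, GridRegular hT (u i)) : GridRegular hT fun x => ∑ i ∈ s, u i x := by
  classical
  induction s using Finset.induction_on with
  | empty => exact ⟨by simp, ⟨0, by simp⟩, by simp⟩
  | insert a s ha ih =>
    simp_rw [Finset.sum_insert ha]
    exact (hu a (Finset.mem_insert_self a s)).add
      (ih fun i hi => hu i (Finset.mem_insert_of_mem hi))

/-- Away from its two end points the indicator is locally constant, and rounded points converge.
Thus step functions can be sampled on grids without being continuous. -/
theorem gridRegular_indicator_Ioc (hT : 0 < T) (a b : ℝ) :
    GridRegular hT (Set.indicator (Set.Ioc a b) fun _ => (1 : ℝ)) := by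
  refine ⟨measurable_const.indicator measurableSet_Ioc, ⟨1, fun x => ?_⟩, ?_⟩
  · by_cases h : x ∈ Set.Ioc a b <;> simp [h]
  · have h1 : ∀ᵐ x ∂((volume : Measure ℝ).restrict (Set.Icc 0 T)), x ∈ Set.Ioc 0 T := by
      rw [← Measure.restrict_congr_set Ioc_ae_eq_Icc]
      exact ae_restrict_mem measurableSet_Ioc
    have h2 : ∀ y : ℝ, ∀ᵐ x ∂((volume : Measure ℝ).restrict (Set.Icc 0 T)), x ≠ y := fun y =>
      ae_restrict_of_ae (Measure.ae_ne volume y)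
    filter_upwards [h1, h2 a, h2 b] with x hx ha hb
    have h3 := tendsto_roundUp hT hx
    refine tendsto_const_nhds.congr' ?_
    rcases lt_or_gt_of_ne ha with ha | ha
    · filter_upwards [h3.eventually (gt_mem_nhds ha)] with j hj
      rw [Set.indicator_of_notMem (fun h => absurd h.1 (not_lt.2 ha.le)),
        Set.indicator_of_notMem (fun h => absurd h.1 (not_lt.2 hj.le))]
    rcases lt_or_gt_of_ne hb with hb | hb
    · filter_upwards [h3.eventually (lt_mem_nhds ha), h3.eventually (gt_mem_nhds hb)] with j hj hj'
      rw [Set.indicator_of_mem (show x ∈ Set.Ioc a b from ⟨ha, hb.le⟩),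
        Set.indicator_of_mem (show roundUp hT j x ∈ Set.Ioc a b from ⟨hj, hj'.le⟩)]
    · filter_upwards [h3.eventually (lt_mem_nhds hb)] with j hj
      rw [Set.indicator_of_notMem (fun h => absurd h.2 (not_le.2 hb)),
        Set.indicator_of_notMem (fun h => absurd h.2 (not_le.2 hj))]

/-- The kernel `(u₁, …, uₙ) ↦ ∏ wᵣ(uᵣ)`. -/
def prodKernel (T : ℝ) {n : ℕ} (w : Fin n → ℝ → ℝ) : L2Cube T n :=
  toL2 (cube T n) fun u => ∏ r, w r (u r)

/-- The kernel `w^{⊗n}`. -/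
def powKernel (T : ℝ) (w : ℝ → ℝ) (n : ℕ) : L2Cube T n := prodKernel T fun _ : Fin n => w

theorem measurable_prod_eval {n : ℕ} {w : Fin n → ℝ → ℝ} (hw : ∀ r, Measurable (w r)) :
    Measurable fun u : Fin n → ℝ => ∏ r, w r (u r) :=
  Finset.measurable_fun_prod _ fun r _ => (hw r).comp (measurable_pi_apply r)

theorem exists_bound_prod {n : ℕ} {w : Fin n → ℝ → ℝ} (hw : ∀ r, ∃ C, ∀ x, |w r x| ≤ C) :
    ∃ C, ∀ u : Fin n → ℝ, |∏ r, w r (u r)| ≤ C := by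
  choose C hC using hw
  refine ⟨∏ r, C r, fun u => ?_⟩
  rw [Finset.abs_prod]
  exact Finset.prod_le_prod (fun r _ => abs_nonneg _) fun r _ => hC r _

theorem memLp_prod_eval {n : ℕ} {w : Fin n → ℝ → ℝ} (hw : ∀ r, Measurable (w r))
    (hb : ∀ r, ∃ C, ∀ x, |w r x| ≤ C) : MemLp (fun u => ∏ r, w r (u r)) 2 (cube T n) := by
  obtain ⟨C, hC⟩ := exists_bound_prod hb
  exact MemLp.of_bound (measurable_prod_eval hw).aestronglyMeasurable C (Eventually.of_forall hC)

theorem prodKernel_ae_eq {hT : 0 < T} {n : ℕ} {w : Fin n → ℝ → ℝ}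
    (hw : ∀ r, GridRegular hT (w r)) :
    prodKernel T w =ᵐ[cube T n] fun u => ∏ r, w r (u r) :=
  toL2_ae_eq (memLp_prod_eval (fun r => (hw r).measurable) fun r => (hw r).bounded)

theorem powKernel_ae_eq {hT : 0 < T} {w : ℝ → ℝ} (hw : GridRegular hT w) (n : ℕ) :
    powKernel T w n =ᵐ[cube T n] fun u => ∏ r, w (u r) := prodKernel_ae_eq fun _ => hw

theorem tendsto_gridApprox_pow {hT : 0 < T} {w : ℝ → ℝ} (hw : GridRegular hT w) (n : ℕ) :
    Tendsto (gridApprox hT fun u : Fin n → ℝ => ∏ r, w (u r)) atTop (𝓝 (powKernel T w n)) := by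
  obtain ⟨C, hC⟩ := exists_bound_prod (n := n) (w := fun _ => w) fun _ => hw.bounded
  refine tendsto_gridApprox hT (measurable_prod_eval fun _ => hw.measurable) hC ?_
  have h1 : ∀ᵐ u ∂(cube T n), ∀ r, Tendsto (fun j => w (roundUp hT j (u r))) atTop (𝓝 (w (u r))) :=
    ae_all_iff.2 fun r => (Measure.quasiMeasurePreserving_eval
      (fun _ : Fin n => (volume : Measure ℝ).restrict (Set.Icc 0 T)) r).ae hw.tendsto
  filter_upwards [h1] with u hu
  exact tendsto_finsetProd _ fun r _ => hu r

end PowerKernels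

/-! ### Limits of the power sums of weighted increments. -/

section Hermite

variable {Ω : Type*} [MeasurableSpace Ω] {T : ℝ} {B : Set.Icc (0 : ℝ) T → Ω → ℝ} {P : Measure Ω}
  [IsProbabilityMeasure P]

/-- The increments over the cells of the uniform grid, weighted by the samples of `w`. -/
def weightedIncrement (B : Set.Icc (0 : ℝ) T → Ω → ℝ) (hT : 0 < T) (w : ℝ → ℝ) (j c : ℕ) (ω : Ω) :
    ℝ := w (uniformGrid hT j (c + 1)) * increment B (uniformGrid hT j) c ω

/-- The power sums of the weighted increments. -/
def powerSum (B : Set.Icc (0 : ℝ) T → Ω → ℝ) (P : Measure Ω) (hT : 0 < T) (w : ℝ → ℝ) (r j : ℕ) :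
    Lp ℝ 2 P :=
  toL2 P fun ω => ∑ c ∈ Finset.range (j + 1), weightedIncrement B hT w j c ω ^ r

theorem memLp_weightedIncrement_pow (hT : 0 < T) (hB : IsBrownianMotionOn B P) (w : ℝ → ℝ)
    (j c r : ℕ) (p : NNReal) : MemLp (fun ω => weightedIncrement B hT w j c ω ^ r) p P := by
  have := memLp_finset_prod (P := P) (Finset.range r) (fun _ => weightedIncrement B hT w j c)
    (fun _ _ p => (memLp_increment hB (monotone_uniformGrid hT j) c p).const_mul _) p
  simpa using this

theorem powerSum_ae_eq (hT : 0 < T) (hB : IsBrownianMotionOn B P) (w : ℝ → ℝ) (r j : ℕ) :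
    powerSum B P hT w r j =ᵐ[P] fun ω =>
      ∑ c ∈ Finset.range (j + 1), weightedIncrement B hT w j c ω ^ r :=
  toL2_ae_eq (memLp_finsetSum _ fun c _ => memLp_weightedIncrement_pow hT hB w j c r 2)

theorem gridApproxValue_ae_eq (hT : 0 < T) (hB : IsBrownianMotionOn B P) (w : ℝ → ℝ) (n j : ℕ) :
    gridApproxValue B P hT (fun u : Fin n → ℝ => ∏ r, w (u r)) j =ᵐ[P] fun ω =>
      n.factorial * ∑ t ∈ (Finset.range (j + 1)).powersetCard n,
        ∏ c ∈ t, weightedIncrement B hT w j c ω := by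
  have h1 : ∀ i : Fin n → ℕ, ∀ᵐ ω ∂P,
      ((∏ r, w (uniformGrid hT j (i r + 1))) • gridValue B P (uniformGrid hT j) i :
        Lp ℝ 2 P) ω = ∏ r, weightedIncrement B hT w j (i r) ω := by
    intro i
    filter_upwards [Lp.coeFn_smul (∏ r, w (uniformGrid hT j (i r + 1)))
      (gridValue B P (uniformGrid hT j) i), gridValue_ae_eq hB (monotone_uniformGrid hT j) i]
      with ω h2 h3
    rw [h2, Pi.smul_apply, h3, smul_eq_mul, ← Finset.prod_mul_distrib]
    rfl
  filter_upwards [ae_all_iff.2 h1, Lp.coeFn_finsetSum (p := 2) (injectiveIndices n j) fun i =>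
    (∏ r, w (uniformGrid hT j (i r + 1))) • gridValue B P (uniformGrid hT j) i] with ω h2 h3
  rw [gridApproxValue, h3, Finset.sum_apply, ← sum_injective_prod_eq]
  exact Finset.sum_congr rfl fun i _ => h2 i

theorem tendsto_gridApproxValue_pow (hT : 0 < T) (hB : IsBrownianMotionOn B P) {w : ℝ → ℝ}
    (hw : GridRegular hT w) (n : ℕ) :
    Tendsto (gridApproxValue B P hT fun u : Fin n → ℝ => ∏ r, w (u r)) atTop
      (𝓝 (itoCLM hT hB n (powKernel T w n))) := by
  have h := ((itoCLM hT hB n).continuous.tendsto _).comp (tendsto_gridApprox_pow hw n)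
  refine h.congr fun j => ?_
  exact multipleIto_eq_of_mem hT hB (gridApprox_mem_multipleItoGraph hT hB _ j)

theorem powerSum_one_eq (hT : 0 < T) (hB : IsBrownianMotionOn B P) (w : ℝ → ℝ) (j : ℕ) :
    powerSum B P hT w 1 j = gridApproxValue B P hT (fun u : Fin 1 → ℝ => ∏ r, w (u r)) j := by
  refine Lp.ext ((powerSum_ae_eq hT hB w 1 j).trans (EventuallyEq.trans ?_
    (gridApproxValue_ae_eq hT hB w 1 j).symm))
  refine Eventually.of_forall fun ω => ?_
  simp [Finset.powersetCard_one]

theorem tendsto_powerSum_one (hT : 0 < T) (hB : IsBrownianMotionOn B P) {w : ℝ → ℝ}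
    (hw : GridRegular hT w) :
    Tendsto (powerSum B P hT w 1) atTop (𝓝 (itoCLM hT hB 1 (powKernel T w 1))) := by
  refine (tendsto_gridApproxValue_pow hT hB hw 1).congr fun j => ?_
  rw [powerSum_one_eq hT hB]

theorem meshSize_uniformGrid (hT : 0 < T) {j c : ℕ} (hc : c < j + 1) :
    meshSize (uniformGrid hT j) c = T / (j + 1) := by
  rw [meshSize, uniformGrid_of_le hT hc, uniformGrid_of_le hT hc.le]
  push_cast
  ring

theorem integral_weightedIncrement_pow (hT : 0 < T) (hB : IsBrownianMotionOn B P) (w : ℝ → ℝ)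
    {j c : ℕ} (hc : c < j + 1) (r : ℕ) :
    ∫ ω, weightedIncrement B hT w j c ω ^ r ∂P =
      w (uniformGrid hT j (c + 1)) ^ r * (Real.sqrt (T / (j + 1)) ^ r * gaussMoment r) := by
  simp_rw [weightedIncrement, mul_pow]
  rw [integral_const_mul, integral_increment_pow hB (monotone_uniformGrid hT j),
    meshSize_uniformGrid hT hc]

/-- Each of the `j + 1` terms has `L²` norm of order `mesh^(r/2)`, and the number of cells is `T /
mesh`. The sum is of order `mesh^(r/2 - 1)`, which vanishes in the limit once `r ≥ 3`. -/
theorem tendsto_powerSum_of_three_le (hT : 0 < T) (hB : IsBrownianMotionOn B P) {w : ℝ → ℝ}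
    (hw : GridRegular hT w) {r : ℕ} (hr : 3 ≤ r) :
    Tendsto (powerSum B P hT w r) atTop (𝓝 0) := by
  obtain ⟨C, hC⟩ := hw.bounded
  have hC0 : 0 ≤ C := (abs_nonneg _).trans (hC 0)
  rw [tendsto_zero_iff_norm_tendsto_zero]
  have hM : 0 ≤ gaussMoment (2 * r) :=
    integral_nonneg fun x => (by rw [pow_mul]; positivity)
  have hterm : ∀ j c, c < j + 1 → ‖toL2 P fun ω => weightedIncrement B hT w j c ω ^ r‖ ≤
      C ^ r * Real.sqrt (T / (j + 1)) ^ r * Real.sqrt (gaussMoment (2 * r)) := by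
    intro j c hc
    refine le_of_sq_le_sq ?_ (by positivity)
    rw [norm_toL2_sq (memLp_weightedIncrement_pow hT hB w j c r 2)]
    simp_rw [← pow_mul, mul_comm r 2]
    rw [integral_weightedIncrement_pow hT hB w hc, mul_pow, mul_pow, Real.sq_sqrt hM, ← pow_mul,
      ← pow_mul, mul_comm r 2, mul_assoc]
    refine mul_le_mul_of_nonneg_right ?_ (by positivity)
    rw [pow_mul, pow_mul]
    exact pow_le_pow_left₀ (sq_nonneg _) (by rw [← sq_abs]; exact pow_le_pow_left₀ (abs_nonneg _) (hC _) 2) r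
  have hbound : ∀ j, ‖powerSum B P hT w r j‖ ≤
      (T * C ^ r * Real.sqrt (gaussMoment (2 * r))) * Real.sqrt (T / (j + 1)) ^ (r - 2) := by
    intro j
    have h1 : powerSum B P hT w r j =
        ∑ c ∈ Finset.range (j + 1), toL2 P fun ω => weightedIncrement B hT w j c ω ^ r := by
      refine Lp.ext ((powerSum_ae_eq hT hB w r j).trans ?_)
      filter_upwards [Lp.coeFn_finsetSum (p := 2) (Finset.range (j + 1)) fun c =>
        toL2 P fun ω => weightedIncrement B hT w j c ω ^ r, ae_all_iff.2 fun c =>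
        toL2_ae_eq (memLp_weightedIncrement_pow hT hB w j c r 2)] with ω h2 h3
      rw [h2, Finset.sum_apply]
      exact Finset.sum_congr rfl fun c _ => (h3 c).symm
    rw [h1]
    refine (norm_sum_le_of_le _ fun c hc => hterm j c (Finset.mem_range.1 hc)).trans ?_
    rw [Finset.sum_const, Finset.card_range, nsmul_eq_mul]
    have h2 : Real.sqrt (T / (j + 1)) ^ r = T / (j + 1) * Real.sqrt (T / (j + 1)) ^ (r - 2) := by
      calc Real.sqrt (T / (j + 1)) ^ r
          = Real.sqrt (T / (j + 1)) ^ 2 * Real.sqrt (T / (j + 1)) ^ (r - 2) := by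
            rw [← pow_add]; congr 1; omega
        _ = _ := by rw [Real.sq_sqrt (by positivity)]
    rw [h2]
    have h3 : ((j : ℝ) + 1) ≠ 0 := by positivity
    apply le_of_eq
    push_cast
    field_simp
  refine squeeze_zero (fun j => norm_nonneg _) hbound ?_
  have h4 := (((tendsto_div_add_one T).sqrt).pow (r - 2)).const_mul
    (T * C ^ r * Real.sqrt (gaussMoment (2 * r)))
  rw [Real.sqrt_zero, zero_pow (by omega), mul_zero] at h4
  exact h4

theorem iIndepFun_weightedIncrement (hT : 0 < T) (hB : IsBrownianMotionOn B P) (w : ℝ → ℝ)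
    (j r : ℕ) : iIndepFun (fun c ω => weightedIncrement B hT w j c ω ^ r) P :=
  (iIndepFun_increment hB (monotone_uniformGrid hT j)).comp
    (fun c x => (w (uniformGrid hT j (c + 1)) * x) ^ r) fun c => by fun_prop

theorem variance_powerSum (hT : 0 < T) (hB : IsBrownianMotionOn B P) (w : ℝ → ℝ) (j r : ℕ) :
    Var[fun ω => ∑ c ∈ Finset.range (j + 1), weightedIncrement B hT w j c ω ^ r; P] =
      ∑ c ∈ Finset.range (j + 1), Var[fun ω => weightedIncrement B hT w j c ω ^ r; P] := by
  rw [← IndepFun.variance_sum (X := fun c ω => weightedIncrement B hT w j c ω ^ r)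
    (fun c _ => memLp_weightedIncrement_pow hT hB w j c r 2)
    (fun c _ d _ hcd => (iIndepFun_weightedIncrement hT hB w j r).indepFun hcd)]
  congr 1
  ext ω
  simp

theorem integral_sum_weightedIncrement_pow (hT : 0 < T) (hB : IsBrownianMotionOn B P)
    (w : ℝ → ℝ) (j r : ℕ) :
    ∫ ω, ∑ c ∈ Finset.range (j + 1), weightedIncrement B hT w j c ω ^ r ∂P =
      ∑ c ∈ Finset.range (j + 1), ∫ ω, weightedIncrement B hT w j c ω ^ r ∂P :=
  integral_finsetSum _ fun c _ =>
    (memLp_weightedIncrement_pow hT hB w j c r 1).integrable le_rfl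

/-- By independence and centring, the mean of the second power sum is the variance of the first. Its
limit therefore follows from the isometry for `I_1`, without evaluating a Riemann sum of `w²`. -/
theorem integral_powerSum_two (hT : 0 < T) (hB : IsBrownianMotionOn B P) (w : ℝ → ℝ) (j : ℕ) :
    ∫ ω, ∑ c ∈ Finset.range (j + 1), weightedIncrement B hT w j c ω ^ 2 ∂P =
      ‖powerSum B P hT w 1 j‖ ^ 2 := by
  have h1 : ∀ c < j + 1, ∫ ω, weightedIncrement B hT w j c ω ^ 1 ∂P = 0 := fun c hc => by
    rw [integral_weightedIncrement_pow hT hB w hc, gaussMoment_one]; simp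
  have hL : MemLp (fun ω => ∑ c ∈ Finset.range (j + 1), weightedIncrement B hT w j c ω ^ 1) 2 P :=
    memLp_finsetSum _ fun c _ => memLp_weightedIncrement_pow hT hB w j c 1 2
  rw [powerSum, norm_toL2_sq hL, ← variance_of_integral_eq_zero hL.aestronglyMeasurable.aemeasurable
    (by rw [integral_sum_weightedIncrement_pow hT hB]
        exact Finset.sum_eq_zero fun c hc => h1 c (Finset.mem_range.1 hc)),
    variance_powerSum hT hB, integral_sum_weightedIncrement_pow hT hB]
  refine Finset.sum_congr rfl fun c hc => ?_
  rw [variance_of_integral_eq_zero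
    (memLp_weightedIncrement_pow hT hB w j c 1 2).aestronglyMeasurable.aemeasurable
    (h1 c (Finset.mem_range.1 hc))]
  simp

/-- The quadratic variation. The means converge to `|w|²`, and the variance is bounded by a sum of
fourth moments: `j + 1` terms of order `mesh²`, together of order `mesh`. -/
theorem tendsto_powerSum_two (hT : 0 < T) (hB : IsBrownianMotionOn B P) {w : ℝ → ℝ}
    (hw : GridRegular hT w) :
    Tendsto (powerSum B P hT w 2) atTop (𝓝 (toL2 P fun _ => ‖powKernel T w 1‖ ^ 2)) := by
  obtain ⟨C, hC⟩ := hw.bounded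
  have hsymm : IsSymmetric (powKernel T w 1) := by
    rw [isSymmetric_iff]; intro σ
    rw [Subsingleton.elim σ (Equiv.refl _), reindexL2_refl]
  have hmean : Tendsto (fun j => ‖powerSum B P hT w 1 j‖ ^ 2) atTop (𝓝 (‖powKernel T w 1‖ ^ 2)) := by
    have := (tendsto_powerSum_one hT hB hw).norm.pow 2
    rwa [norm_itoCLM_sq hT hB hsymm, Nat.factorial_one, Nat.cast_one, one_mul] at this
  have hconst : Tendsto (fun j => toL2 P fun _ : Ω => ‖powerSum B P hT w 1 j‖ ^ 2) atTop
      (𝓝 (toL2 P fun _ => ‖powKernel T w 1‖ ^ 2)) := by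
    obtain ⟨D, hD⟩ := hmean.bddAbove_range
    refine tendsto_toL2_of_bounded (C := D) (fun j => aestronglyMeasurable_const)
      (fun j => Eventually.of_forall fun ω => ?_) (Eventually.of_forall fun ω => hmean)
    rw [abs_of_nonneg (by positivity)]
    exact hD ⟨j, rfl⟩
  have hdiff : Tendsto (fun j => powerSum B P hT w 2 j -
      toL2 P fun _ : Ω => ‖powerSum B P hT w 1 j‖ ^ 2) atTop (𝓝 0) := by
    rw [tendsto_zero_iff_norm_tendsto_zero]
    have hbound : ∀ j, ‖powerSum B P hT w 2 j - toL2 P fun _ : Ω => ‖powerSum B P hT w 1 j‖ ^ 2‖ ^ 2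
        ≤ (T * C ^ 4 * gaussMoment 4) * (T / (j + 1)) := by
      intro j
      have hL : MemLp (fun ω => ∑ c ∈ Finset.range (j + 1), weightedIncrement B hT w j c ω ^ 2) 2 P :=
        memLp_finsetSum _ fun c _ => memLp_weightedIncrement_pow hT hB w j c 2 2
      have hL' : MemLp (fun ω => (∑ c ∈ Finset.range (j + 1), weightedIncrement B hT w j c ω ^ 2) -
          ‖powerSum B P hT w 1 j‖ ^ 2) 2 P := hL.sub (memLp_const _)
      rw [powerSum, toL2_sub hL (memLp_const _), norm_toL2_sq hL', ← integral_powerSum_two hT hB,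
        ← variance_eq_integral hL.aestronglyMeasurable.aemeasurable, variance_powerSum hT hB]
      calc ∑ c ∈ Finset.range (j + 1), Var[fun ω => weightedIncrement B hT w j c ω ^ 2; P]
          ≤ ∑ c ∈ Finset.range (j + 1), C ^ 4 * ((T / (j + 1)) ^ 2 * gaussMoment 4) := by
            refine Finset.sum_le_sum fun c hc => ?_
            refine (variance_le_expectation_sq
              (memLp_weightedIncrement_pow hT hB w j c 2 2).aestronglyMeasurable).trans ?_
            simp only [Pi.pow_apply, ← pow_mul]
            rw [integral_weightedIncrement_pow hT hB w (Finset.mem_range.1 hc)]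
            have h1 : Real.sqrt (T / ((j : ℝ) + 1)) ^ (2 * 2) = (T / (j + 1)) ^ 2 := by
              rw [pow_mul, Real.sq_sqrt (by positivity)]
            have hM : 0 ≤ gaussMoment 4 :=
              integral_nonneg fun x => (by positivity)
            rw [h1]
            refine mul_le_mul_of_nonneg_right ?_ (by positivity)
            have h2 := pow_le_pow_left₀ (abs_nonneg _) (hC (uniformGrid hT j (c + 1))) 4
            rwa [Even.pow_abs (by decide)] at h2
        _ = _ := by
            rw [Finset.sum_const, Finset.card_range, nsmul_eq_mul]
            have h3 : ((j : ℝ) + 1) ≠ 0 := by positivity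
            push_cast
            field_simp
    have h4 : Tendsto (fun j => ‖powerSum B P hT w 2 j -
        toL2 P fun _ : Ω => ‖powerSum B P hT w 1 j‖ ^ 2‖ ^ 2) atTop (𝓝 0) := by
      refine squeeze_zero (fun j => by positivity) hbound ?_
      simpa using (tendsto_div_add_one T).const_mul (T * C ^ 4 * gaussMoment 4)
    simpa using h4.sqrt
  simpa using hdiff.add hconst

end Hermite

/-! ### Hermite polynomials through their formal generating function. -/

section HermiteSeries

open PowerSeries

/-- The Hermite polynomials `Hₙ(x, α) / n!` with variance parameter `α`. -/
def hermiteDiv (x α : ℝ) : ℕ → ℝ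
  | 0 => 1
  | 1 => x
  | n + 2 => (x * hermiteDiv x α (n + 1) - α * hermiteDiv x α n) / (n + 2)

/-- The generating function is `exp(x s - α s² / 2)`. It is handled through its differential
equation `F' = (x - α s) F`, which with `F(0) = 1` determines a formal power series. -/
theorem derivative_mk_hermiteDiv (x α : ℝ) :
    derivative ℝ (mk (hermiteDiv x α)) = (C x - C α * X) * mk (hermiteDiv x α) := by
  ext n
  rw [coeff_derivative, sub_mul, mul_assoc, map_sub, coeff_C_mul, coeff_C_mul]
  cases n with
  | zero => simp [hermiteDiv]
  | succ n =>
    rw [coeff_succ_X_mul, coeff_mk, coeff_mk, coeff_mk, hermiteDiv]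
    have : (n : ℝ) + 2 ≠ 0 := by positivity
    push_cast
    field_simp
    ring

theorem eq_mk_hermiteDiv {x α : ℝ} {f : PowerSeries ℝ}
    (hf : derivative ℝ f = (C x - C α * X) * f) (h0 : coeff 0 f = 1) :
    f = mk (hermiteDiv x α) := by
  have hrec : ∀ n, coeff (n + 1) f * ((n : ℝ) + 1) = x * coeff n f - α * coeff n (X * f) := by
    intro n
    rw [← coeff_derivative, hf, sub_mul, mul_assoc, map_sub, coeff_C_mul, coeff_C_mul]
  have h1 : coeff 1 f = x := by
    have := hrec 0
    rw [coeff_zero_X_mul, h0] at this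
    simpa using this
  have key : ∀ n, coeff n f = hermiteDiv x α n ∧ coeff (n + 1) f = hermiteDiv x α (n + 1) := by
    intro n
    induction n with
    | zero => exact ⟨h0, h1⟩
    | succ n ih =>
      refine ⟨ih.2, ?_⟩
      have := hrec (n + 1)
      rw [coeff_succ_X_mul, ih.1, ih.2] at this
      rw [hermiteDiv, eq_div_iff (by positivity), ← this]
      push_cast
      ring
  ext n
  rw [coeff_mk, (key n).1]

theorem hermiteDiv_scale (a x α : ℝ) (n : ℕ) :
    hermiteDiv (a * x) (a ^ 2 * α) n = a ^ n * hermiteDiv x α n := by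
  have key : ∀ n, hermiteDiv (a * x) (a ^ 2 * α) n = a ^ n * hermiteDiv x α n ∧
      hermiteDiv (a * x) (a ^ 2 * α) (n + 1) = a ^ (n + 1) * hermiteDiv x α (n + 1) := by
    intro n
    induction n with
    | zero => simp [hermiteDiv]
    | succ n ih =>
      refine ⟨ih.2, ?_⟩
      rw [hermiteDiv, ih.1, ih.2, hermiteDiv]
      ring
  exact (key n).1

/-- With `x = 0` and variance `2 c` the generating function is `exp(-c s²)`. -/
theorem hermiteDiv_zero_left (c : ℝ) (r : ℕ) :
    hermiteDiv 0 (2 * c) (2 * r) = (-c) ^ r / r.factorial ∧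
      hermiteDiv 0 (2 * c) (2 * r + 1) = 0 := by
  induction r with
  | zero => simp [hermiteDiv]
  | succ r ih =>
    have h1 : hermiteDiv 0 (2 * c) (2 * (r + 1) + 1) = 0 := by
      rw [show 2 * (r + 1) + 1 = (2 * r + 1) + 2 by ring, hermiteDiv, ih.2]; simp
    refine ⟨?_, h1⟩
    rw [show 2 * (r + 1) = 2 * r + 2 by ring, hermiteDiv, ih.1, Nat.factorial_succ]
    have : (r.factorial : ℝ) ≠ 0 := by positivity
    have : (r : ℝ) + 1 ≠ 0 := by positivity
    push_cast
    field_simp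
    ring

/-- The exponents add: `exp((a x + y) s - (a² α + 2 a γ + β) s² / 2)` is the product of the
generating functions for `(a x, a² α)`, `(y, β)` and `(0, 2 a γ)`. In terms of the differential
equation, the coefficients of the three factors sum to the required one. -/
theorem hermiteDiv_add (a x y α β γ : ℝ) (n : ℕ) :
    hermiteDiv (a * x + y) (a ^ 2 * α + 2 * a * γ + β) n =
      ∑ p ∈ Finset.HasAntidiagonal.antidiagonal n,
        (∑ q ∈ Finset.HasAntidiagonal.antidiagonal p.1,
          a ^ q.1 * hermiteDiv x α q.1 * hermiteDiv y β q.2) *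
        hermiteDiv 0 (2 * (a * γ)) p.2 := by
  have h := eq_mk_hermiteDiv (x := a * x + y) (α := a ^ 2 * α + 2 * a * γ + β)
    (f := mk (hermiteDiv (a * x) (a ^ 2 * α)) * mk (hermiteDiv y β) *
      mk (hermiteDiv 0 (2 * (a * γ)))) ?_ ?_
  · have h2 := congrArg (coeff n) h
    rw [coeff_mk, coeff_mul] at h2
    simp_rw [coeff_mul, coeff_mk, hermiteDiv_scale] at h2
    exact h2.symm
  · rw [Derivation.leibniz, Derivation.leibniz, derivative_mk_hermiteDiv,
      derivative_mk_hermiteDiv, derivative_mk_hermiteDiv]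
    simp only [smul_eq_mul, map_add, map_mul, map_zero, map_pow, map_ofNat]
    ring
  · simp [coeff_mul, hermiteDiv]

/-- The Wick product of two Hermite polynomials in variables of covariance `γ`, as a linear
combination of ordinary products. -/
def hermiteMixed (x y α β γ : ℝ) (k l : ℕ) : ℝ :=
  ∑ r ∈ Finset.range (min k l + 1),
    hermiteDiv x α (k - r) * hermiteDiv y β (l - r) * ((-γ) ^ r / r.factorial)

theorem hermiteDiv_add_eq_sum (a x y α β γ : ℝ) (n : ℕ) :
    hermiteDiv (a * x + y) (a ^ 2 * α + 2 * a * γ + β) n =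
      ∑ k ∈ Finset.range (n + 1), hermiteMixed x y α β γ k (n - k) * a ^ k := by
  rw [hermiteDiv_add]
  simp_rw [hermiteMixed, Finset.sum_mul]
  rw [Finset.sum_sigma', Finset.sum_sigma']
  -- The power `a^k` arises from order `k - r` in the first factor, `n - k - r` in the second and `2
  -- r` in the third, which contributes `a^r`. Odd orders of the third factor vanish, so nothing
  -- else remains.
  refine (Finset.sum_of_injOn (fun z : (_ : ℕ) × ℕ =>
    (⟨(n - 2 * z.2, 2 * z.2), (z.1 - z.2, n - z.1 - z.2)⟩ : (_ : ℕ × ℕ) × (ℕ × ℕ)))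
    ?_ ?_ ?_ ?_).symm
  · rintro ⟨k, r⟩ h ⟨k', r'⟩ h' heq
    simp only [Finset.coe_sigma, Set.mem_sigma_iff, Finset.coe_range, Set.mem_Iio] at h h'
    simp only [Sigma.mk.injEq, Prod.mk.injEq, heq_eq_eq] at heq
    have : r = r' := by omega
    subst this
    have : k = k' := by omega
    subst this
    rfl
  · rintro ⟨k, r⟩ h
    simp only [Finset.coe_sigma, Set.mem_sigma_iff, Finset.coe_range, Set.mem_Iio] at h
    simp only [Finset.coe_sigma, Set.mem_sigma_iff, Finset.mem_coe,
      Finset.HasAntidiagonal.mem_antidiagonal]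
    omega
  · rintro ⟨⟨p, q⟩, ⟨i, j⟩⟩ h hn
    simp only [Finset.mem_sigma, Finset.HasAntidiagonal.mem_antidiagonal] at h
    rcases Nat.even_or_odd' q with ⟨r, rfl | rfl⟩
    · exfalso
      refine hn ⟨⟨i + r, r⟩, ?_, ?_⟩
      · simp only [Finset.coe_sigma, Set.mem_sigma_iff, Finset.coe_range, Set.mem_Iio]
        omega
      · simp only [Sigma.mk.injEq, Prod.mk.injEq, heq_eq_eq]
        exact ⟨⟨by omega, trivial⟩, by omega, by omega⟩
    · dsimp only
      rw [(hermiteDiv_zero_left _ r).2, mul_zero]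
  · rintro ⟨k, r⟩ h
    simp only [Finset.mem_sigma, Finset.mem_range] at h
    dsimp only
    rw [(hermiteDiv_zero_left _ r).1]
    have : a ^ k = a ^ (k - r) * a ^ r := by rw [← pow_add]; congr 1; omega
    rw [this, show -(a * γ) = a * (-γ) by ring, mul_pow]
    ring

/-- Testing natural numbers `a` is enough for polynomials and involves countably many values, so
identities that hold almost surely for each `a` can be compared at one common `ω`. -/
theorem coeff_eq_of_sum_eq {n : ℕ} {p q : ℕ → ℝ}
    (h : ∀ a : ℕ, ∑ k ∈ Finset.range (n + 1), p k * (a : ℝ) ^ k =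
      ∑ k ∈ Finset.range (n + 1), q k * (a : ℝ) ^ k) {k : ℕ} (hk : k ≤ n) : p k = q k := by
  have h1 : ∑ k ∈ Finset.range (n + 1), Polynomial.monomial k (p k) =
      ∑ k ∈ Finset.range (n + 1), Polynomial.monomial k (q k) := by
    refine Polynomial.eq_of_infinite_eval_eq _ _
      ((Set.infinite_range_of_injective (Nat.cast_injective (R := ℝ))).mono ?_)
    rintro _ ⟨a, rfl⟩
    simp only [Set.mem_ofPred_eq, Polynomial.eval_finsetSum, Polynomial.eval_monomial]
    exact h a
  have h2 := congrArg (fun f => Polynomial.coeff f k) h1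
  simpa [Polynomial.finsetSum_coeff, Polynomial.coeff_monomial, Finset.sum_ite_eq',
    Nat.lt_succ_of_le hk] using h2

end HermiteSeries

/-! ### The product of two square integrable variables as a bilinear map into `L¹(Ω)`. -/

section Product

variable {Ω : Type*} [MeasurableSpace Ω] {P : Measure Ω}

/-- The pointwise product `L²(Ω) × L²(Ω) → L¹(Ω)` as a continuous bilinear map. -/
def mulCLM (P : Measure Ω) : Lp ℝ 2 P →L[ℝ] Lp ℝ 2 P →L[ℝ] Lp ℝ 1 P :=
  (ContinuousLinearMap.mul ℝ ℝ).holderL P 2 2 1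

theorem mulCLM_ae_eq (U V : Lp ℝ 2 P) : mulCLM P U V =ᵐ[P] fun ω => U ω * V ω :=
  (ContinuousLinearMap.mul ℝ ℝ).coeFn_holder U V

theorem mulCLM_eq_mulL1 (U V : Lp ℝ 2 P) : mulCLM P U V = mulL1 U V :=
  Lp.ext ((mulCLM_ae_eq U V).trans (MemLp.coeFn_toLp _).symm)

end Product

/-! ### Multiple integrals of tensor powers are Hermite polynomials. -/

section Recursion

variable {Ω : Type*} [MeasurableSpace Ω] {T : ℝ} {B : Set.Icc (0 : ℝ) T → Ω → ℝ} {P : Measure Ω}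
  [IsProbabilityMeasure P]

/-- The elementary symmetric functions of the weighted increments. -/
def esymmValue (B : Set.Icc (0 : ℝ) T → Ω → ℝ) (P : Measure Ω) (hT : 0 < T) (w : ℝ → ℝ) (n j : ℕ) :
    Lp ℝ 2 P :=
  (n.factorial : ℝ)⁻¹ • gridApproxValue B P hT (fun u : Fin n → ℝ => ∏ r, w (u r)) j

theorem esymmValue_ae_eq (hT : 0 < T) (hB : IsBrownianMotionOn B P) (w : ℝ → ℝ) (n j : ℕ) :
    esymmValue B P hT w n j =ᵐ[P] fun ω =>
      ∑ t ∈ (Finset.range (j + 1)).powersetCard n, ∏ c ∈ t, weightedIncrement B hT w j c ω := by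
  filter_upwards [Lp.coeFn_smul (n.factorial : ℝ)⁻¹
    (gridApproxValue B P hT (fun u : Fin n → ℝ => ∏ r, w (u r)) j),
    gridApproxValue_ae_eq hT hB w n j] with ω h1 h2
  rw [esymmValue, h1, Pi.smul_apply, h2, smul_eq_mul, inv_mul_cancel_left₀ (by positivity)]

/-- `Iₙ(w^{⊗n}) / n!`. -/
def itoPow (hT : 0 < T) (hB : IsBrownianMotionOn B P) (w : ℝ → ℝ) (n : ℕ) : Lp ℝ 2 P :=
  (n.factorial : ℝ)⁻¹ • itoCLM hT hB n (powKernel T w n)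

theorem tendsto_esymmValue (hT : 0 < T) (hB : IsBrownianMotionOn B P) {w : ℝ → ℝ}
    (hw : GridRegular hT w) (n : ℕ) :
    Tendsto (esymmValue B P hT w n) atTop (𝓝 (itoPow hT hB w n)) :=
  (tendsto_gridApproxValue_pow hT hB hw n).const_smul _

/-- The products on the right belong to `L¹(Ω)` only; multiplying the left side by the constant `1`
serves as the inclusion of `L²(Ω)` in `L¹(Ω)`. In this form each product is continuous in its two
factors, so the identity passes to the limit. -/
theorem newton_identity_esymmValue (hT : 0 < T) (hB : IsBrownianMotionOn B P) (w : ℝ → ℝ)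
    (n j : ℕ) :
    mulCLM P ((n : ℝ) • esymmValue B P hT w n j) (toL2 P fun _ => 1) = (-1 : ℝ) ^ (n + 1) •
      ∑ a ∈ Finset.HasAntidiagonal.antidiagonal n with a.1 < n, (-1 : ℝ) ^ a.1 •
        mulCLM P (esymmValue B P hT w a.1 j) (powerSum B P hT w a.2 j) := by
  set S := Finset.filter (fun a : ℕ × ℕ => a.1 < n) (Finset.HasAntidiagonal.antidiagonal n) with hS
  refine Lp.ext ?_
  have h1 : ∀ a : ℕ × ℕ, ∀ᵐ ω ∂P, ((-1 : ℝ) ^ a.1 •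
      mulCLM P (esymmValue B P hT w a.1 j) (powerSum B P hT w a.2 j) : Lp ℝ 1 P) ω =
      (-1) ^ a.1 * (∑ t ∈ (Finset.range (j + 1)).powersetCard a.1,
        ∏ c ∈ t, weightedIncrement B hT w j c ω) *
          ∑ c ∈ Finset.range (j + 1), weightedIncrement B hT w j c ω ^ a.2 := by
    intro a
    filter_upwards [Lp.coeFn_smul ((-1 : ℝ) ^ a.1)
      (mulCLM P (esymmValue B P hT w a.1 j) (powerSum B P hT w a.2 j)),
      mulCLM_ae_eq (esymmValue B P hT w a.1 j) (powerSum B P hT w a.2 j),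
      esymmValue_ae_eq hT hB w a.1 j, powerSum_ae_eq hT hB w a.2 j] with ω h1 h2 h3 h4
    rw [h1, Pi.smul_apply, h2, h3, h4, smul_eq_mul, mul_assoc]
  filter_upwards [mulCLM_ae_eq ((n : ℝ) • esymmValue B P hT w n j) (toL2 P fun _ => 1),
    Lp.coeFn_smul (n : ℝ) (esymmValue B P hT w n j), esymmValue_ae_eq hT hB w n j,
    toL2_ae_eq (memLp_const (μ := P) (1 : ℝ) (p := 2)), ae_all_iff.2 h1,
    Lp.coeFn_smul ((-1 : ℝ) ^ (n + 1)) (∑ a ∈ S, (-1 : ℝ) ^ a.1 •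
        mulCLM P (esymmValue B P hT w a.1 j) (powerSum B P hT w a.2 j)),
    Lp.coeFn_finsetSum (p := 1) (μ := P) S fun a => (-1 : ℝ) ^ a.1 •
        mulCLM P (esymmValue B P hT w a.1 j) (powerSum B P hT w a.2 j)]
    with ω h2 h3 h4 h5 h6 h7 h8
  rw [h2, h3, h5, h7, Pi.smul_apply, Pi.smul_apply, h8, Finset.sum_apply, h4, smul_eq_mul,
    smul_eq_mul, mul_one, newton_identity, Finset.sum_congr rfl fun a _ => h6 a]

/-- The limits of the power sums of the weighted increments. -/
def powerSumLimit (hT : 0 < T) (hB : IsBrownianMotionOn B P) (w : ℝ → ℝ) (r : ℕ) : Lp ℝ 2 P :=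
  if r = 1 then itoCLM hT hB 1 (powKernel T w 1)
  else if r = 2 then toL2 P fun _ => ‖powKernel T w 1‖ ^ 2 else 0

theorem tendsto_powerSum (hT : 0 < T) (hB : IsBrownianMotionOn B P) {w : ℝ → ℝ}
    (hw : GridRegular hT w) {r : ℕ} (hr : 0 < r) :
    Tendsto (powerSum B P hT w r) atTop (𝓝 (powerSumLimit hT hB w r)) := by
  unfold powerSumLimit
  split_ifs with h1 h2
  · subst h1; exact tendsto_powerSum_one hT hB hw
  · subst h2; exact tendsto_powerSum_two hT hB hw
  · exact tendsto_powerSum_of_three_le hT hB hw (by omega)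

theorem itoPow_newton (hT : 0 < T) (hB : IsBrownianMotionOn B P) {w : ℝ → ℝ}
    (hw : GridRegular hT w) (n : ℕ) :
    mulCLM P ((n : ℝ) • itoPow hT hB w n) (toL2 P fun _ => 1) = (-1 : ℝ) ^ (n + 1) •
      ∑ a ∈ Finset.HasAntidiagonal.antidiagonal n with a.1 < n, (-1 : ℝ) ^ a.1 •
        mulCLM P (itoPow hT hB w a.1) (powerSumLimit hT hB w a.2) := by
  have h1 : Tendsto (fun j => mulCLM P ((n : ℝ) • esymmValue B P hT w n j) (toL2 P fun _ => 1))
      atTop (𝓝 (mulCLM P ((n : ℝ) • itoPow hT hB w n) (toL2 P fun _ => 1))) :=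
    (((mulCLM P).flip (toL2 P fun _ => 1)).continuous.tendsto _).comp
      ((tendsto_esymmValue hT hB hw n).const_smul (n : ℝ))
  refine tendsto_nhds_unique h1 ?_
  simp_rw [newton_identity_esymmValue hT hB w n]
  refine (tendsto_finsetSum _ fun a ha => ?_).const_smul _
  rw [Finset.mem_filter, Finset.HasAntidiagonal.mem_antidiagonal] at ha
  exact (((mulCLM P).continuous₂.tendsto (itoPow hT hB w a.1, powerSumLimit hT hB w a.2)).comp
    ((tendsto_esymmValue hT hB hw a.1).prodMk_nhds
      (tendsto_powerSum hT hB hw (by omega)))).const_smul _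

theorem itoPow_zero_ae_eq (hT : 0 < T) (hB : IsBrownianMotionOn B P) {w : ℝ → ℝ}
    (hw : GridRegular hT w) : itoPow hT hB w 0 =ᵐ[P] fun _ => 1 := by
  have h1 : ∀ j, esymmValue B P hT w 0 j = toL2 P fun _ => 1 := by
    intro j
    refine Lp.ext ((esymmValue_ae_eq hT hB w 0 j).trans (EventuallyEq.trans ?_
      (toL2_ae_eq (memLp_const (μ := P) (1 : ℝ) (p := 2))).symm))
    exact Eventually.of_forall fun ω => by simp
  have h2 : itoPow hT hB w 0 = toL2 P fun _ => 1 := by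
    refine tendsto_nhds_unique (tendsto_esymmValue hT hB hw 0) ?_
    simp_rw [show esymmValue B P hT w 0 = fun _ => toL2 P fun _ => 1 from funext h1]
    exact tendsto_const_nhds
  rw [h2]
  exact toL2_ae_eq (memLp_const (μ := P) (1 : ℝ) (p := 2))

theorem filter_antidiagonal_lt (n : ℕ) :
    {a ∈ Finset.HasAntidiagonal.antidiagonal (n + 2) | a.1 < n + 2 ∧ a.2 ≤ 2} =
      ({(n + 1, 1), (n, 2)} : Finset (ℕ × ℕ)) := by
  ext ⟨p, q⟩
  simp only [Finset.mem_filter, Finset.HasAntidiagonal.mem_antidiagonal, Finset.mem_insert,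
    Finset.mem_singleton, Prod.mk.injEq]
  omega

/-- In the limit of Newton's identities only the terms with `p_1` and `p_2` survive. -/
theorem itoPow_recursion (hT : 0 < T) (hB : IsBrownianMotionOn B P) {w : ℝ → ℝ}
    (hw : GridRegular hT w) (n : ℕ) : ∀ᵐ ω ∂P,
    ((n : ℝ) + 2) * itoPow hT hB w (n + 2) ω =
      itoCLM hT hB 1 (powKernel T w 1) ω * itoPow hT hB w (n + 1) ω -
        ‖powKernel T w 1‖ ^ 2 * itoPow hT hB w n ω := by
  have h1 := itoPow_newton hT hB hw (n + 2)
  have h2 : ∑ a ∈ Finset.HasAntidiagonal.antidiagonal (n + 2) with a.1 < n + 2, (-1 : ℝ) ^ a.1 •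
        mulCLM P (itoPow hT hB w a.1) (powerSumLimit hT hB w a.2) =
      ∑ a ∈ ({(n + 1, 1), (n, 2)} : Finset (ℕ × ℕ)), (-1 : ℝ) ^ a.1 •
        mulCLM P (itoPow hT hB w a.1) (powerSumLimit hT hB w a.2) := by
    rw [← filter_antidiagonal_lt]
    refine (Finset.sum_subset ?_ ?_).symm
    · intro a ha
      rw [Finset.mem_filter] at ha ⊢
      exact ⟨ha.1, ha.2.1⟩
    · intro a ha ha'
      have h3 : ¬ a.2 ≤ 2 := fun h => ha' (by
        rw [Finset.mem_filter] at ha ⊢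
        exact ⟨ha.1, ha.2, h⟩)
      rw [powerSumLimit, if_neg (by omega), if_neg (by omega), map_zero, smul_zero]
  rw [h2, Finset.sum_pair (by simp)] at h1
  have h3 : powerSumLimit hT hB w 1 = itoCLM hT hB 1 (powKernel T w 1) := by simp [powerSumLimit]
  have h4 : powerSumLimit hT hB w 2 = toL2 P fun _ => ‖powKernel T w 1‖ ^ 2 := by
    simp [powerSumLimit]
  -- The signs in Newton's identities: plus for the term with `p_1`, minus for the one with `p_2`.
  have hs : (-1 : ℝ) ^ (n + 2 + 1) * (-1) ^ (n + 1) = 1 := by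
    rw [← pow_add]; exact Even.neg_one_pow ⟨n + 2, by ring⟩
  have hs' : (-1 : ℝ) ^ (n + 2 + 1) * (-1) ^ n = -1 := by
    rw [← pow_add]; exact Odd.neg_one_pow ⟨n + 1, by ring⟩
  dsimp only at h1
  rw [smul_add, smul_smul, smul_smul, hs, hs', one_smul, neg_one_smul, ← sub_eq_add_neg, h3,
    h4] at h1
  have h5 := mulCLM_ae_eq (((n + 2 : ℕ) : ℝ) • itoPow hT hB w (n + 2)) (toL2 P fun _ => 1)
  rw [h1] at h5
  filter_upwards [h5, Lp.coeFn_smul ((n + 2 : ℕ) : ℝ) (itoPow hT hB w (n + 2)),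
    toL2_ae_eq (memLp_const (μ := P) (1 : ℝ) (p := 2)),
    toL2_ae_eq (memLp_const (μ := P) (‖powKernel T w 1‖ ^ 2) (p := 2)),
    Lp.coeFn_sub (mulCLM P (itoPow hT hB w (n + 1)) (itoCLM hT hB 1 (powKernel T w 1)))
      (mulCLM P (itoPow hT hB w n) (toL2 P fun _ => ‖powKernel T w 1‖ ^ 2)),
    mulCLM_ae_eq (itoPow hT hB w (n + 1)) (itoCLM hT hB 1 (powKernel T w 1)),
    mulCLM_ae_eq (itoPow hT hB w n) (toL2 P fun _ => ‖powKernel T w 1‖ ^ 2)]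
    with ω g1 g2 g3 g4 g5 g6 g7
  rw [g5, Pi.sub_apply, g6, g7, g2, Pi.smul_apply, g3, g4, smul_eq_mul, mul_one] at g1
  push_cast at g1
  linarith

theorem itoPow_ae_eq (hT : 0 < T) (hB : IsBrownianMotionOn B P) {w : ℝ → ℝ}
    (hw : GridRegular hT w) : ∀ᵐ ω ∂P, ∀ n, itoPow hT hB w n ω =
      hermiteDiv (itoCLM hT hB 1 (powKernel T w 1) ω) (‖powKernel T w 1‖ ^ 2) n := by
  have h1 : itoPow hT hB w 1 = itoCLM hT hB 1 (powKernel T w 1) := by simp [itoPow]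
  filter_upwards [itoPow_zero_ae_eq hT hB hw, ae_all_iff.2 (itoPow_recursion hT hB hw)]
    with ω g0 g
  have key : ∀ n, itoPow hT hB w n ω =
      hermiteDiv (itoCLM hT hB 1 (powKernel T w 1) ω) (‖powKernel T w 1‖ ^ 2) n ∧
      itoPow hT hB w (n + 1) ω =
      hermiteDiv (itoCLM hT hB 1 (powKernel T w 1) ω) (‖powKernel T w 1‖ ^ 2) (n + 1) := by
    intro n
    induction n with
    | zero => exact ⟨g0, by rw [zero_add, h1]; rfl⟩
    | succ n ih =>
      refine ⟨ih.2, ?_⟩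
      rw [hermiteDiv, eq_div_iff (by positivity), ← ih.1, ← ih.2, ← g n, mul_comm]
  exact fun n => (key n).1

end Recursion

/-! ### Integrals of mixed powers of two functions. -/

section MixedPowers

variable {T : ℝ}

open scoped Classical in
/-- The kernel that is `u` in the variables of `S` and `v` in the other variables. -/
def mixedKernel (T : ℝ) (u v : ℝ → ℝ) {n : ℕ} (S : Finset (Fin n)) : L2Cube T n :=
  prodKernel T fun r => if r ∈ S then u else v

theorem gridRegular_ite {hT : 0 < T} {u v : ℝ → ℝ} (hu : GridRegular hT u) (hv : GridRegular hT v)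
    (p : Prop) [Decidable p] : GridRegular hT (if p then u else v) := by
  split_ifs <;> assumption

open scoped Classical in
theorem mixedKernel_ae_eq {hT : 0 < T} {u v : ℝ → ℝ} (hu : GridRegular hT u)
    (hv : GridRegular hT v) {n : ℕ} (S : Finset (Fin n)) :
    mixedKernel T u v S =ᵐ[cube T n] fun x => ∏ r, if r ∈ S then u (x r) else v (x r) := by
  refine (prodKernel_ae_eq fun r => gridRegular_ite hu hv (r ∈ S)).trans
    (Eventually.of_forall fun x => Finset.prod_congr rfl fun r _ => ?_)
  split_ifs <;> rfl

theorem powKernel_mul_add {hT : 0 < T} {u v : ℝ → ℝ} (hu : GridRegular hT u)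
    (hv : GridRegular hT v) (a : ℝ) (n : ℕ) :
    powKernel T (fun x => a * u x + v x) n =
      ∑ S ∈ (Finset.univ : Finset (Fin n)).powerset, a ^ S.card • mixedKernel T u v S := by
  classical
  refine Lp.ext ?_
  filter_upwards [powKernel_ae_eq ((hu.const_mul a).add hv) n,
    Lp.coeFn_finsetSum (p := 2) (μ := cube T n) (Finset.univ : Finset (Fin n)).powerset
      fun S => a ^ S.card • mixedKernel T u v S,
    ae_all_iff.2 fun S : Finset (Fin n) => mixedKernel_ae_eq hu hv S,
    ae_all_iff.2 fun S : Finset (Fin n) => Lp.coeFn_smul (a ^ S.card) (mixedKernel T u v S)]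
    with x h1 h2 h3 h4
  rw [h1, h2, Finset.sum_apply, Finset.prod_add]
  refine Finset.sum_congr rfl fun S _ => ?_
  rw [h4, Pi.smul_apply, h3, smul_eq_mul, Finset.prod_ite, Finset.prod_mul_distrib,
    Finset.prod_const, mul_assoc]
  congr 3
  · ext r; simp
  · ext r; simp

theorem reindexL2_mixedKernel {hT : 0 < T} {u v : ℝ → ℝ} (hu : GridRegular hT u)
    (hv : GridRegular hT v) {n : ℕ} (S : Finset (Fin n)) (σ : Equiv.Perm (Fin n)) :
    reindexL2 T σ (mixedKernel T u v S) = mixedKernel T u v (S.map σ.toEmbedding) := by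
  classical
  refine Lp.ext ((reindexL2_ae_eq_of T σ (mixedKernel_ae_eq hu hv S)).trans
    (EventuallyEq.trans ?_ (mixedKernel_ae_eq hu hv _).symm))
  refine Eventually.of_forall fun x => ?_
  refine Fintype.prod_equiv σ _ _ fun r => ?_
  simp

theorem exists_perm_map_eq {n : ℕ} {S S' : Finset (Fin n)} (h : S.card = S'.card) :
    ∃ σ : Equiv.Perm (Fin n), S.map σ.toEmbedding = S' := by
  classical
  let e : {x // x ∈ S} ≃ {x // x ∈ S'} := Finset.equivOfCardEq h
  refine ⟨e.extendSubtype, Finset.eq_of_subset_of_card_le ?_ (by simp [h])⟩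
  intro x hx
  obtain ⟨y, hy, rfl⟩ := Finset.mem_map.1 hx
  exact e.extendSubtype_mem y hy

theorem tensorL2_powKernel {hT : 0 < T} {u v : ℝ → ℝ} (hu : GridRegular hT u)
    (hv : GridRegular hT v) (k l : ℕ) :
    tensorL2 (powKernel T u k) (powKernel T v l) =
      mixedKernel T u v (Finset.univ.map (Fin.castAddEmb l : Fin k ↪ Fin (k + l))) := by
  classical
  refine Lp.ext ((tensorL2_ae_eq_of (powKernel_ae_eq hu k) (powKernel_ae_eq hv l)).trans
    (EventuallyEq.trans ?_ (mixedKernel_ae_eq hu hv _).symm))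
  refine Eventually.of_forall fun x => ?_
  dsimp only
  rw [Fin.prod_univ_add]
  congr 1
  · refine Finset.prod_congr rfl fun r _ => ?_
    exact (if_pos (Finset.mem_map.2 ⟨r, Finset.mem_univ _, rfl⟩)).symm
  · refine Finset.prod_congr rfl fun r _ => ?_
    refine (if_neg fun h => ?_).symm
    obtain ⟨i, -, hi⟩ := Finset.mem_map.1 h
    have := congrArg Fin.val hi
    simp at this
    omega

theorem powKernel_one_mul_add {hT : 0 < T} {u v : ℝ → ℝ} (hu : GridRegular hT u)
    (hv : GridRegular hT v) (a : ℝ) :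
    powKernel T (fun x => a * u x + v x) 1 = a • powKernel T u 1 + powKernel T v 1 := by
  refine Lp.ext ?_
  filter_upwards [powKernel_ae_eq ((hu.const_mul a).add hv) 1, powKernel_ae_eq hu 1,
    powKernel_ae_eq hv 1, Lp.coeFn_add (a • powKernel T u 1) (powKernel T v 1),
    Lp.coeFn_smul a (powKernel T u 1)] with x h1 h2 h3 h4 h5
  rw [h1, h4, Pi.add_apply, h5, Pi.smul_apply, h2, h3]
  simp

variable {Ω : Type*} [MeasurableSpace Ω] {B : Set.Icc (0 : ℝ) T → Ω → ℝ} {P : Measure Ω}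
  [IsProbabilityMeasure P]

theorem itoCLM_reindexL2 (hT : 0 < T) (hB : IsBrownianMotionOn B P) {n : ℕ}
    (σ : Equiv.Perm (Fin n)) (h : L2Cube T n) :
    itoCLM hT hB n (reindexL2 T σ h) = itoCLM hT hB n h := by
  rw [← itoCLM_symL2 hT hB h, ← itoCLM_symL2 hT hB (reindexL2 T σ h)]
  congr 1
  rw [symL2_apply, symL2_apply]
  congr 1
  simp_rw [reindexL2_trans]
  exact Fintype.sum_equiv (Equiv.mulRight σ) _ _ fun τ => rfl

/-- Permutations act transitively on subsets of a given size, and the integral is invariant under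
relabelling, so only the number of factors `u` matters. -/
theorem itoCLM_mixedKernel (hT : 0 < T) (hB : IsBrownianMotionOn B P) {u v : ℝ → ℝ}
    (hu : GridRegular hT u) (hv : GridRegular hT v) {n : ℕ} {S S' : Finset (Fin n)}
    (h : S.card = S'.card) :
    itoCLM hT hB n (mixedKernel T u v S) = itoCLM hT hB n (mixedKernel T u v S') := by
  obtain ⟨σ, rfl⟩ := exists_perm_map_eq h
  rw [← reindexL2_mixedKernel hu hv, itoCLM_reindexL2]

theorem itoCLM_powKernel_mul_add (hT : 0 < T) (hB : IsBrownianMotionOn B P) {u v : ℝ → ℝ}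
    (hu : GridRegular hT u) (hv : GridRegular hT v) {n : ℕ} {E : ℕ → Lp ℝ 2 P}
    (hE : ∀ S : Finset (Fin n), itoCLM hT hB n (mixedKernel T u v S) = E S.card) (a : ℝ) :
    itoCLM hT hB n (powKernel T (fun x => a * u x + v x) n) =
      ∑ k ∈ Finset.range (n + 1), (n.choose k : ℝ) • a ^ k • E k := by
  rw [powKernel_mul_add hu hv, map_sum]
  simp_rw [map_smul, hE]
  have := Finset.sum_powerset_apply_card (fun k => a ^ k • E k)
    (x := (Finset.univ : Finset (Fin n)))
  rw [this, Finset.card_univ, Fintype.card_fin]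
  simp_rw [← Nat.cast_smul_eq_nsmul ℝ]

/-- Both expansions of `I_n((a u + v)^{⊗n})`, with `n = k + l`, are polynomials in `a`. The binomial
expansion has `C(n,k) I_n(u^{⊗k} ⊗ v^{⊗l})` at `a^k`; the Hermite formula has `n!` times
`hermiteMixed`. Comparing coefficients gives the claim. -/
theorem itoCLM_tensorL2_powKernel (hT : 0 < T) (hB : IsBrownianMotionOn B P) {u v : ℝ → ℝ}
    (hu : GridRegular hT u) (hv : GridRegular hT v) (k l : ℕ) : ∀ᵐ ω ∂P,
    itoCLM hT hB (k + l) (tensorL2 (powKernel T u k) (powKernel T v l)) ω =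
      k.factorial * l.factorial * hermiteMixed (itoCLM hT hB 1 (powKernel T u 1) ω)
        (itoCLM hT hB 1 (powKernel T v 1) ω) (‖powKernel T u 1‖ ^ 2) (‖powKernel T v 1‖ ^ 2)
        (inner ℝ (powKernel T u 1) (powKernel T v 1)) k l := by
  set n := k + l with hn
  -- One value for each number of factors `u`; for sizes that no subset has, the condition is empty
  -- and `0` will do.
  have hex : ∀ j, ∃ Y, ∀ S : Finset (Fin n), S.card = j →
      itoCLM hT hB n (mixedKernel T u v S) = Y := by
    intro j
    by_cases h : ∃ S : Finset (Fin n), S.card = j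
    · obtain ⟨S, hS⟩ := h
      exact ⟨_, fun S' hS' => itoCLM_mixedKernel hT hB hu hv (hS'.trans hS.symm)⟩
    · exact ⟨0, fun S' hS' => absurd ⟨S', hS'⟩ h⟩
  choose E hE using hex
  have hEk : itoCLM hT hB n (tensorL2 (powKernel T u k) (powKernel T v l)) = E k := by
    rw [tensorL2_powKernel hu hv]
    exact hE _ _ (by simp)
  rw [hEk]
  have hsum := fun a : ℕ => itoCLM_powKernel_mul_add hT hB hu hv (fun S => hE _ S rfl) (a : ℝ)
  have h1 : ∀ a : ℕ, ∀ᵐ ω ∂P, itoCLM hT hB n (powKernel T (fun x => (a : ℝ) * u x + v x) n) ω =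
      ∑ j ∈ Finset.range (n + 1), (n.choose j : ℝ) * ((a : ℝ) ^ j * E j ω) := by
    intro a
    rw [hsum a]
    filter_upwards [Lp.coeFn_finsetSum (p := 2) (μ := P) (Finset.range (n + 1))
      fun j => (n.choose j : ℝ) • (a : ℝ) ^ j • E j,
      ae_all_iff.2 fun j : ℕ => Lp.coeFn_smul (n.choose j : ℝ) ((a : ℝ) ^ j • E j),
      ae_all_iff.2 fun j : ℕ => Lp.coeFn_smul ((a : ℝ) ^ j) (E j)] with ω g1 g2 g3
    rw [g1, Finset.sum_apply]
    refine Finset.sum_congr rfl fun j _ => ?_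
    rw [g2, Pi.smul_apply, g3, Pi.smul_apply, smul_eq_mul, smul_eq_mul]
  have h2 := fun a : ℕ => itoPow_ae_eq hT hB ((hu.const_mul (a : ℝ)).add hv)
  have h3 : ∀ a : ℕ, ∀ᵐ ω ∂P, itoCLM hT hB 1 (powKernel T (fun x => (a : ℝ) * u x + v x) 1) ω =
      a * itoCLM hT hB 1 (powKernel T u 1) ω + itoCLM hT hB 1 (powKernel T v 1) ω := by
    intro a
    rw [powKernel_one_mul_add hu hv, map_add, map_smul]
    filter_upwards [Lp.coeFn_add ((a : ℝ) • itoCLM hT hB 1 (powKernel T u 1))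
      (itoCLM hT hB 1 (powKernel T v 1)),
      Lp.coeFn_smul (a : ℝ) (itoCLM hT hB 1 (powKernel T u 1))] with ω g1 g2
    rw [g1, Pi.add_apply, g2, Pi.smul_apply, smul_eq_mul]
  have h4 : ∀ a : ℕ, ‖powKernel T (fun x => (a : ℝ) * u x + v x) 1‖ ^ 2 =
      (a : ℝ) ^ 2 * ‖powKernel T u 1‖ ^ 2 +
        2 * a * inner ℝ (powKernel T u 1) (powKernel T v 1) + ‖powKernel T v 1‖ ^ 2 := by
    intro a
    rw [powKernel_one_mul_add hu hv, norm_add_sq_real, norm_smul, real_inner_smul_left, mul_pow,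
      Real.norm_eq_abs, sq_abs]
    ring
  have h5 : ∀ a : ℕ, ∀ᵐ ω ∂P, itoPow hT hB (fun x => (a : ℝ) * u x + v x) n ω =
      (n.factorial : ℝ)⁻¹ * itoCLM hT hB n (powKernel T (fun x => (a : ℝ) * u x + v x) n) ω :=
    fun a => Lp.coeFn_smul _ _
  filter_upwards [ae_all_iff.2 h1, ae_all_iff.2 h2, ae_all_iff.2 h3, ae_all_iff.2 h5]
    with ω g1 g2 g3 g5
  have h6 := coeff_eq_of_sum_eq (n := n) (p := fun j => (n.factorial : ℝ)⁻¹ * (n.choose j * E j ω))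
    (q := fun j => hermiteMixed (itoCLM hT hB 1 (powKernel T u 1) ω)
        (itoCLM hT hB 1 (powKernel T v 1) ω) (‖powKernel T u 1‖ ^ 2) (‖powKernel T v 1‖ ^ 2)
        (inner ℝ (powKernel T u 1) (powKernel T v 1)) j (n - j)) (fun a => by
      rw [← hermiteDiv_add_eq_sum, ← g3, ← h4, ← g2 a n, g5, g1, Finset.mul_sum]
      exact Finset.sum_congr rfl fun j _ => by ring) (show k ≤ n by omega)
  rw [hn, Nat.add_sub_cancel_left] at h6
  rw [← h6, ← mul_assoc, ← mul_assoc]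
  have h7 : ((k + l).choose k : ℝ) * k.factorial * l.factorial = (k + l).factorial := by
    rw [Nat.choose_symm_add]
    exact_mod_cast Nat.add_choose_mul_factorial_mul_factorial k l
  have h8 : ((k + l).factorial : ℝ) ≠ 0 := by positivity
  calc E k ω = ((k + l).factorial * ((k + l).factorial : ℝ)⁻¹) * E k ω := by
        rw [mul_inv_cancel₀ h8, one_mul]
    _ = _ := by nth_rewrite 1 [← h7]; ring

theorem mulCLM_itoCLM_tensorL2_powKernel (hT : 0 < T) (hB : IsBrownianMotionOn B P) {u v : ℝ → ℝ}
    (hu : GridRegular hT u) (hv : GridRegular hT v) (k l : ℕ) :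
    mulCLM P (itoCLM hT hB (k + l) (tensorL2 (powKernel T u k) (powKernel T v l)))
        (toL2 P fun _ => 1) =
      ∑ r ∈ Finset.range (min k l + 1),
        ((-inner ℝ (powKernel T u 1) (powKernel T v 1)) ^ r / r.factorial *
          (k.descFactorial r * l.descFactorial r)) •
        mulCLM P (itoCLM hT hB (k - r) (powKernel T u (k - r)))
          (itoCLM hT hB (l - r) (powKernel T v (l - r))) := by
  set c := inner ℝ (powKernel T u 1) (powKernel T v 1) with hc
  refine Lp.ext ?_
  filter_upwards [mulCLM_ae_eq
      (itoCLM hT hB (k + l) (tensorL2 (powKernel T u k) (powKernel T v l))) (toL2 P fun _ => 1),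
    toL2_ae_eq (memLp_const (μ := P) (1 : ℝ) (p := 2)),
    itoCLM_tensorL2_powKernel hT hB hu hv k l, itoPow_ae_eq hT hB hu, itoPow_ae_eq hT hB hv,
    ae_all_iff.2 fun n : ℕ => Lp.coeFn_smul (n.factorial : ℝ)⁻¹ (itoCLM hT hB n (powKernel T u n)),
    ae_all_iff.2 fun n : ℕ => Lp.coeFn_smul (n.factorial : ℝ)⁻¹ (itoCLM hT hB n (powKernel T v n)),
    Lp.coeFn_finsetSum (p := 1) (μ := P) (Finset.range (min k l + 1)) fun r =>
      ((-c) ^ r / r.factorial * (k.descFactorial r * l.descFactorial r) : ℝ) •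
        mulCLM P (itoCLM hT hB (k - r) (powKernel T u (k - r)))
          (itoCLM hT hB (l - r) (powKernel T v (l - r))),
    ae_all_iff.2 fun r : ℕ => Lp.coeFn_smul
      ((-c) ^ r / r.factorial * (k.descFactorial r * l.descFactorial r) : ℝ)
      (mulCLM P (itoCLM hT hB (k - r) (powKernel T u (k - r)))
          (itoCLM hT hB (l - r) (powKernel T v (l - r)))),
    ae_all_iff.2 fun r : ℕ => mulCLM_ae_eq (itoCLM hT hB (k - r) (powKernel T u (k - r)))
          (itoCLM hT hB (l - r) (powKernel T v (l - r)))] with ω g1 g2 g3 g4 g5 g6 g7 g8 g9 g10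
  rw [g1, g2, g3, g8, mul_one, Finset.sum_apply, hermiteMixed, Finset.mul_sum]
  refine Finset.sum_congr rfl fun r hr => ?_
  rw [Finset.mem_range] at hr
  rw [g9, Pi.smul_apply, g10, ← g4, ← g5, itoPow, itoPow, g6, g7, Pi.smul_apply, Pi.smul_apply,
    smul_eq_mul, smul_eq_mul, smul_eq_mul]
  have hk : (k.factorial : ℝ) = (k - r).factorial * k.descFactorial r := by
    exact_mod_cast (Nat.factorial_mul_descFactorial (show r ≤ k by omega)).symm
  have hl : (l.factorial : ℝ) = (l - r).factorial * l.descFactorial r := by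
    exact_mod_cast (Nat.factorial_mul_descFactorial (show r ≤ l by omega)).symm
  rw [hk, hl, ← hc]
  have h1 : ((k - r).factorial : ℝ) ≠ 0 := by positivity
  have h2 : ((l - r).factorial : ℝ) ≠ 0 := by positivity
  field_simp

end MixedPowers

/-! ### Polarization and the density of tensor powers among symmetric kernels. -/

section Polarization

open scoped Classical in
-- Inclusion–exclusion. Expand each product over all maps `φ`; the signed count of the sets `S` that
-- contain the image of `φ` is zero unless `φ` is surjective, that is, a permutation.
theorem sum_powerset_neg_one_pow_prod_sum {n : ℕ} (w : Fin n → Fin n → ℝ) :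
    ∑ S ∈ (Finset.univ : Finset (Fin n)).powerset, (-1 : ℝ) ^ (Finset.univ \ S).card *
      ∏ r, ∑ i ∈ S, w i r = ∑ σ : Equiv.Perm (Fin n), ∏ r, w (σ r) r := by
  have h1 : ∀ S : Finset (Fin n), ∏ r, ∑ i ∈ S, w i r =
      ∑ φ : Fin n → Fin n, (∏ i ∈ Finset.univ.image φ, if i ∈ S then (1 : ℝ) else 0) *
        ∏ r, w (φ r) r := by
    intro S
    have h2 : ∀ r, ∑ i ∈ S, w i r = ∑ i, (if i ∈ S then (1 : ℝ) else 0) * w i r := fun r => by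
      simp
    simp_rw [h2, Finset.prod_univ_sum, Fintype.piFinset_univ]
    refine Finset.sum_congr rfl fun φ _ => ?_
    rw [Finset.prod_mul_distrib]
    congr 1
    by_cases h : ∀ r, φ r ∈ S
    · rw [Finset.prod_eq_one fun r _ => if_pos (h r), Finset.prod_eq_one fun i hi => ?_]
      obtain ⟨r, -, rfl⟩ := Finset.mem_image.1 hi
      exact if_pos (h r)
    · push Not at h
      obtain ⟨r, hr⟩ := h
      rw [Finset.prod_eq_zero (Finset.mem_univ r) (if_neg hr),
        Finset.prod_eq_zero (Finset.mem_image_of_mem φ (Finset.mem_univ r)) (if_neg hr)]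
  have h3 : ∀ φ : Fin n → Fin n, ∑ S ∈ (Finset.univ : Finset (Fin n)).powerset,
      (-1 : ℝ) ^ (Finset.univ \ S).card *
        (∏ i ∈ Finset.univ.image φ, if i ∈ S then (1 : ℝ) else 0) =
      if Function.Bijective φ then 1 else 0 := by
    intro φ
    -- Each summand becomes a product over `S` times a product over its complement, so the sum over
    -- `S` factors over the points: a point in the image contributes `1 + 0`, any other `1 - 1`.
    have h4 : ∀ S : Finset (Fin n), (-1 : ℝ) ^ (Finset.univ \ S).card *
        (∏ i ∈ Finset.univ.image φ, if i ∈ S then (1 : ℝ) else 0) =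
        (∏ _i ∈ S, (1 : ℝ)) * ∏ i ∈ Finset.univ \ S,
          (if i ∈ Finset.univ.image φ then (0 : ℝ) else -1) := by
      intro S
      rw [Finset.prod_const_one, one_mul]
      by_cases h : Finset.univ.image φ ⊆ S
      · rw [Finset.prod_eq_one fun i hi => if_pos (h hi), mul_one, ← Finset.prod_const]
        refine Finset.prod_congr rfl fun i hi => (if_neg fun h' => ?_).symm
        exact (Finset.mem_sdiff.1 hi).2 (h h')
      · obtain ⟨i, hi, hi'⟩ := Finset.not_subset.1 h
        rw [Finset.prod_eq_zero hi (if_neg hi'), mul_zero]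
        have hi'' : i ∈ Finset.univ \ S := Finset.mem_sdiff.2 ⟨Finset.mem_univ i, hi'⟩
        symm
        refine Finset.prod_eq_zero hi'' ?_
        exact if_pos hi
    rw [Finset.sum_congr rfl fun S _ => h4 S, ← Finset.prod_add]
    split_ifs with hφ
    · refine Finset.prod_eq_one fun i _ => ?_
      obtain ⟨r, rfl⟩ := hφ.2 i
      rw [if_pos (Finset.mem_image_of_mem φ (Finset.mem_univ r)), add_zero]
    · have : ¬ Function.Surjective φ := fun h => hφ (Finite.surjective_iff_bijective.1 h)
      simp only [Function.Surjective, not_forall] at this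
      obtain ⟨i, hi⟩ := this
      refine Finset.prod_eq_zero (Finset.mem_univ i) ?_
      rw [if_neg, add_neg_cancel]
      intro h
      obtain ⟨r, -, hr⟩ := Finset.mem_image.1 h
      exact hi ⟨r, hr⟩
  simp_rw [h1, Finset.mul_sum, ← mul_assoc]
  rw [Finset.sum_comm]
  simp_rw [← Finset.sum_mul, h3, ite_mul, one_mul, zero_mul]
  rw [← Finset.sum_filter]
  refine (Finset.sum_bij (fun (σ : Equiv.Perm (Fin n)) _ => (σ : Fin n → Fin n)) ?_ ?_ ?_ ?_).symm
  · intro σ _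
    exact Finset.mem_filter.2 ⟨Finset.mem_univ _, σ.bijective⟩
  · intro σ _ τ _ h
    exact Equiv.ext (congrFun h)
  · intro φ hφ
    exact ⟨Equiv.ofBijective φ (Finset.mem_filter.1 hφ).2, Finset.mem_univ _, rfl⟩
  · intro σ _
    rfl

variable {T : ℝ}

theorem symL2_prodKernel {hT : 0 < T} {n : ℕ} {w : Fin n → ℝ → ℝ}
    (hw : ∀ r, GridRegular hT (w r)) :
    symL2 T n (prodKernel T w) = (n.factorial : ℝ)⁻¹ •
      ∑ S ∈ (Finset.univ : Finset (Fin n)).powerset,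
        (-1 : ℝ) ^ (Finset.univ \ S).card • powKernel T (fun x => ∑ i ∈ S, w i x) n := by
  rw [symL2_apply]
  congr 1
  refine Lp.ext ?_
  filter_upwards [
    Lp.coeFn_finsetSum (p := 2) (μ := cube T n) (Finset.univ : Finset (Equiv.Perm (Fin n)))
      fun σ => reindexL2 T σ (prodKernel T w),
    Lp.coeFn_finsetSum (p := 2) (μ := cube T n) (Finset.univ : Finset (Fin n)).powerset
      fun S => (-1 : ℝ) ^ (Finset.univ \ S).card • powKernel T (fun x => ∑ i ∈ S, w i x) n,
    ae_all_iff.2 fun S : Finset (Fin n) => Lp.coeFn_smul ((-1 : ℝ) ^ (Finset.univ \ S).card)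
      (powKernel T (fun x => ∑ i ∈ S, w i x) n),
    ae_all_iff.2 fun S : Finset (Fin n) => powKernel_ae_eq
      (GridRegular.sum S (u := w) fun i _ => hw i) n,
    ae_all_iff.2 fun σ : Equiv.Perm (Fin n) => reindexL2_ae_eq_of T σ (prodKernel_ae_eq hw)]
    with x h1 h2 h3 h4 h5
  rw [h1, h2, Finset.sum_apply, Finset.sum_apply, Finset.sum_congr rfl fun σ _ => h5 σ,
    Finset.sum_congr rfl fun S _ => (h3 S).trans (by rw [Pi.smul_apply, h4, smul_eq_mul]),
    sum_powerset_neg_one_pow_prod_sum fun i r => w i (x r)]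
  refine Fintype.sum_equiv (Equiv.inv (Equiv.Perm (Fin n))) _ _ fun σ => ?_
  refine Fintype.prod_equiv σ _ _ fun r => ?_
  simp

variable {Ω : Type*} [MeasurableSpace Ω] {B : Set.Icc (0 : ℝ) T → Ω → ℝ} {P : Measure Ω}
  [IsProbabilityMeasure P]

/-- Every kernel is the first component of a point of the graph, hence a limit of combinations of
indicators of boxes. Symmetrization is continuous, fixes `h`, and by polarization sends such an
indicator to a combination of powers. -/
theorem mem_closure_span_powKernel (hT : 0 < T) (hB : IsBrownianMotionOn B P) {n : ℕ}
    {h : L2Cube T n} (hh : IsSymmetric h) :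
    h ∈ closure (Submodule.span ℝ {f | ∃ w, GridRegular hT w ∧ f = powKernel T w n} :
      Set (L2Cube T n)) := by
  set W := Submodule.span ℝ {f | ∃ w, GridRegular hT w ∧ f = powKernel T w n} with hW
  rw [← Submodule.topologicalClosure_coe]
  let L : (L2Cube T n × Lp ℝ 2 P) →L[ℝ] L2Cube T n :=
    (symL2 T n) ∘L ContinuousLinearMap.fst ℝ _ _
  have h1 : multipleItoGraph B P n ≤ W.topologicalClosure.comap L.toLinearMap := by
    refine Submodule.topologicalClosure_minimal _ (Submodule.span_le.2 ?_)
      (W.isClosed_topologicalClosure.preimage L.continuous)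
    rintro ⟨f, Y⟩ ⟨a, b, -, -, hf, -⟩
    refine Submodule.le_topologicalClosure _ ?_
    have hreg : ∀ r, GridRegular hT (Set.indicator (Set.Ioc (a r : ℝ) (b r)) fun _ => (1 : ℝ)) :=
      fun r => gridRegular_indicator_Ioc hT _ _
    have h2 : f = prodKernel T fun r => Set.indicator (Set.Ioc (a r : ℝ) (b r)) fun _ => (1 : ℝ) := by
      refine Lp.ext (hf.trans (EventuallyEq.trans ?_ (prodKernel_ae_eq hreg).symm))
      refine Eventually.of_forall fun x => ?_
      exact indicator_univ_pi _ _
    change symL2 T n f ∈ W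
    rw [h2, symL2_prodKernel hreg]
    refine Submodule.smul_mem _ _ (Submodule.sum_mem _ fun S _ => Submodule.smul_mem _ _
      (Submodule.subset_span ⟨_, GridRegular.sum S fun i _ => hreg i, rfl⟩))
  have h3 := h1 (mem_multipleItoGraph hT hB h)
  have h4 : L (h, multipleIto B P n h) = h := symL2_of_isSymmetric T hh
  rw [Submodule.mem_comap] at h3
  change L (h, multipleIto B P n h) ∈ _ at h3
  rwa [h4] at h3

end Polarization

/-! ### The Wick product of two chaoses through pairings of their derivatives. -/

section ProductFormula

variable {T : ℝ} {Ω : Type*} [MeasurableSpace Ω] {B : Set.Icc (0 : ℝ) T → Ω → ℝ} {P : Measure Ω}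
  [IsProbabilityMeasure P]

/-- The pairing `∫ U(t) V(t) dt` of square integrable families of square integrable random
variables. -/
def pairing (P : Measure Ω) (T : ℝ) (r : ℕ) :
    Lp (Lp ℝ 2 P) 2 (cube T r) →L[ℝ] Lp (Lp ℝ 2 P) 2 (cube T r) →L[ℝ] Lp ℝ 1 P :=
  (mulCLM P).lpPairing (cube T r) 2 2

/-- The `r`-th derivative on the `k`-th chaos. -/
def derivChaos (hT : 0 < T) (hB : IsBrownianMotionOn B P) (k r : ℕ) :
    L2Cube T k →L[ℝ] Lp (Lp ℝ 2 P) 2 (cube T r) :=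
  if h : r ≤ k then (derivTerm hT hB (k - r) r) ∘L
    (reindexL2 T (finCongr (Nat.sub_add_cancel h).symm)).toContinuousLinearMap else 0

theorem derivChaos_eq (hT : 0 < T) (hB : IsBrownianMotionOn B P) {k m r : ℕ} (e : k = m + r)
    (h : L2Cube T k) : derivChaos hT hB k r h = derivTerm hT hB m r (reindexL2 T (finCongr e) h) := by
  obtain rfl : m = k - r := by omega
  rw [derivChaos, dif_pos (by omega)]
  rfl

theorem derivChaos_family (hT : 0 < T) (hB : IsBrownianMotionOn B P) (h : ∀ n, L2Cube T n)
    (m r : ℕ) : derivChaos hT hB (m + r) r (h (m + r)) = derivTerm hT hB m r (h (m + r)) := by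
  rw [derivChaos_eq hT hB rfl, finCongr_refl, reindexL2_refl]

theorem sectionL2_powKernel {hT : 0 < T} {w : ℝ → ℝ} (hw : GridRegular hT w) (m r : ℕ) :
    ∀ᵐ t ∂(cube T r), sectionL2 (powKernel T w (m + r)) t = (∏ i, w (t i)) • powKernel T w m := by
  filter_upwards [sectionL2_ae_eq_of (powKernel_ae_eq hw (m + r))] with t ht
  refine Lp.ext ?_
  filter_upwards [ht, powKernel_ae_eq hw m, Lp.coeFn_smul (∏ i, w (t i)) (powKernel T w m)]
    with s h1 h2 h3
  rw [h1, h3, Pi.smul_apply, h2, smul_eq_mul, Fin.prod_univ_add, mul_comm]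
  simp

theorem derivTerm_powKernel (hT : 0 < T) (hB : IsBrownianMotionOn B P) {w : ℝ → ℝ}
    (hw : GridRegular hT w) (m r : ℕ) :
    derivTerm hT hB m r (powKernel T w (m + r)) =ᵐ[cube T r] fun t =>
      (((m + r).descFactorial r : ℝ) * ∏ i, w (t i)) • itoCLM hT hB m (powKernel T w m) := by
  filter_upwards [derivTerm_ae_eq hT hB (powKernel T w (m + r)), sectionL2_powKernel hw m r]
    with t h1 h2
  rw [h1, h2, smul_smul, map_smul]

theorem integral_prod_mul_prod {hT : 0 < T} {u v : ℝ → ℝ} (hu : GridRegular hT u)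
    (hv : GridRegular hT v) (r : ℕ) :
    ∫ t, (∏ i, u (t i)) * ∏ i, v (t i) ∂(cube T r) =
      (inner ℝ (powKernel T u 1) (powKernel T v 1) : ℝ) ^ r := by
  have h1 : ∀ r, ∫ t, (∏ i, u (t i)) * ∏ i, v (t i) ∂(cube T r) =
      (∫ x, u x * v x ∂((volume : Measure ℝ).restrict (Set.Icc 0 T))) ^ r := by
    intro r
    simp_rw [← Finset.prod_mul_distrib]
    rw [integral_fintype_prod_eq_pow (ι := Fin r) fun x => u x * v x, Fintype.card_fin]
  rw [h1, L2.inner_def]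
  congr 1
  rw [← pow_one (∫ x, u x * v x ∂_), ← h1]
  refine integral_congr_ae ?_
  filter_upwards [powKernel_ae_eq hu 1, powKernel_ae_eq hv 1] with x h2 h3
  rw [h2, h3]
  simp [mul_comm]

theorem pairing_derivTerm_powKernel (hT : 0 < T) (hB : IsBrownianMotionOn B P) {u v : ℝ → ℝ}
    (hu : GridRegular hT u) (hv : GridRegular hT v) (m p r : ℕ) :
    pairing P T r (derivTerm hT hB m r (powKernel T u (m + r)))
      (derivTerm hT hB p r (powKernel T v (p + r))) =
      (((m + r).descFactorial r : ℝ) * (p + r).descFactorial r *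
        (inner ℝ (powKernel T u 1) (powKernel T v 1)) ^ r) •
        mulCLM P (itoCLM hT hB m (powKernel T u m)) (itoCLM hT hB p (powKernel T v p)) := by
  rw [pairing, ContinuousLinearMap.lpPairing_eq_integral, ← integral_prod_mul_prod hu hv,
    ← integral_const_mul, ← integral_smul_const]
  refine integral_congr_ae ?_
  filter_upwards [derivTerm_powKernel hT hB hu m r, derivTerm_powKernel hT hB hv p r] with t h1 h2
  rw [h1, h2, map_smul, map_smul, smul_apply, smul_smul]
  congr 1
  ring

theorem reindexL2_powKernel (w : ℝ → ℝ) {k k' : ℕ} (e : k = k') :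
    reindexL2 T (finCongr e) (powKernel T w k) = powKernel T w k' := by
  subst e
  rw [finCongr_refl, reindexL2_refl]

theorem pairing_derivChaos_powKernel (hT : 0 < T) (hB : IsBrownianMotionOn B P) {u v : ℝ → ℝ}
    (hu : GridRegular hT u) (hv : GridRegular hT v) {k l r : ℕ} (hk : r ≤ k) (hl : r ≤ l) :
    pairing P T r (derivChaos hT hB k r (powKernel T u k))
      (derivChaos hT hB l r (powKernel T v l)) =
      ((k.descFactorial r : ℝ) * l.descFactorial r *
        (inner ℝ (powKernel T u 1) (powKernel T v 1)) ^ r) •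
        mulCLM P (itoCLM hT hB (k - r) (powKernel T u (k - r)))
          (itoCLM hT hB (l - r) (powKernel T v (l - r))) := by
  have ek : k = (k - r) + r := by omega
  have el : l = (l - r) + r := by omega
  rw [derivChaos_eq hT hB ek, derivChaos_eq hT hB el, reindexL2_powKernel, reindexL2_powKernel,
    pairing_derivTerm_powKernel hT hB hu hv, ← ek, ← el]

/-- The Wick product of a `k`-th and an `l`-th chaos in terms of pairings of derivatives. -/
theorem mulCLM_itoCLM_tensorL2 (hT : 0 < T) (hB : IsBrownianMotionOn B P) {k l : ℕ}
    {f : L2Cube T k} {g : L2Cube T l} (hf : IsSymmetric f) (hg : IsSymmetric g) :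
    mulCLM P (itoCLM hT hB (k + l) (tensorL2 f g)) (toL2 P fun _ => 1) =
      ∑ r ∈ Finset.range (min k l + 1), ((-1 : ℝ) ^ r / r.factorial) •
        pairing P T r (derivChaos hT hB k r f) (derivChaos hT hB l r g) := by
  let one : Lp ℝ 2 P := toL2 P fun _ => 1
  let lhs : L2Cube T (k + l) →L[ℝ] Lp ℝ 1 P := (mulCLM P).flip one ∘L itoCLM hT hB (k + l)
  have hpow : ∀ u v, GridRegular hT u → GridRegular hT v →
      lhs (tensorL2 (powKernel T u k) (powKernel T v l)) =
      ∑ r ∈ Finset.range (min k l + 1), ((-1 : ℝ) ^ r / r.factorial) •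
        pairing P T r (derivChaos hT hB k r (powKernel T u k))
          (derivChaos hT hB l r (powKernel T v l)) := by
    intro u v hu hv
    refine (mulCLM_itoCLM_tensorL2_powKernel hT hB hu hv k l).trans
      (Finset.sum_congr rfl fun r hr => ?_)
    rw [Finset.mem_range] at hr
    rw [pairing_derivChaos_powKernel hT hB hu hv (by omega) (by omega), smul_smul,
      neg_pow (inner ℝ _ _)]
    congr 1
    ring
  -- The identity is extended one argument at a time: to symmetric `f` against a fixed power of `v`,
  -- and then to symmetric `g` against a fixed `f`.
  have hleft : ∀ v, GridRegular hT v → ∀ f : L2Cube T k, IsSymmetric f →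
      lhs (tensorL2 f (powKernel T v l)) =
      ∑ r ∈ Finset.range (min k l + 1), ((-1 : ℝ) ^ r / r.factorial) •
        pairing P T r (derivChaos hT hB k r f) (derivChaos hT hB l r (powKernel T v l)) := by
    intro v hv f hf
    let R : L2Cube T k →L[ℝ] Lp ℝ 1 P :=
      ∑ r ∈ Finset.range (min k l + 1), ((-1 : ℝ) ^ r / r.factorial) •
        ((pairing P T r).flip (derivChaos hT hB l r (powKernel T v l)) ∘L derivChaos hT hB k r)
    have h := ContinuousLinearMap.eqOn_closure_span
      (s := {f | ∃ w, GridRegular hT w ∧ f = powKernel T w k})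
      (f := lhs ∘L (tensorCLM T k l).flip (powKernel T v l)) (g := R) (by
        rintro _ ⟨u, hu, rfl⟩
        simp only [R, sum_apply, smul_apply,
          ContinuousLinearMap.comp_apply, ContinuousLinearMap.flip_apply, tensorCLM_apply]
        exact hpow u v hu hv) (mem_closure_span_powKernel hT hB hf)
    simpa only [R, sum_apply, smul_apply,
          ContinuousLinearMap.comp_apply, ContinuousLinearMap.flip_apply, tensorCLM_apply] using h
  let R : L2Cube T l →L[ℝ] Lp ℝ 1 P :=
    ∑ r ∈ Finset.range (min k l + 1), ((-1 : ℝ) ^ r / r.factorial) •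
      (pairing P T r (derivChaos hT hB k r f) ∘L derivChaos hT hB l r)
  have h := ContinuousLinearMap.eqOn_closure_span
    (s := {f | ∃ w, GridRegular hT w ∧ f = powKernel T w l})
    (f := lhs ∘L tensorCLM T k l f) (g := R) (by
      rintro _ ⟨v, hv, rfl⟩
      simp only [R, sum_apply, smul_apply,
        ContinuousLinearMap.comp_apply, tensorCLM_apply]
      exact hleft v hv f hf) (mem_closure_span_powKernel hT hB hg)
  simp only [R, sum_apply, smul_apply, ContinuousLinearMap.comp_apply, tensorCLM_apply] at h
  exact h

theorem toL1_eq_mulCLM (U : Lp ℝ 2 P) : toL1 U = mulCLM P U (toL2 P fun _ => 1) := by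
  refine Lp.ext ?_
  filter_upwards [mulCLM_ae_eq U (toL2 P fun _ => 1),
    toL2_ae_eq (memLp_const (μ := P) (1 : ℝ) (p := 2)),
    MemLp.coeFn_toLp ((Lp.memLp U).mono_exponent one_le_two)] with ω h1 h2 h3
  rw [toL1, h1, h2, mul_one, h3]

theorem toL1_multipleIto_symTensor (hT : 0 < T) (hB : IsBrownianMotionOn B P) {k l : ℕ}
    {f : L2Cube T k} {g : L2Cube T l} (hf : IsSymmetric f) (hg : IsSymmetric g) :
    toL1 (multipleIto B P (k + l) (symTensor f g)) =
      ∑ r ∈ Finset.range (min k l + 1), ((-1 : ℝ) ^ r / r.factorial) •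
        pairing P T r (derivChaos hT hB k r f) (derivChaos hT hB l r g) := by
  rw [toL1_eq_mulCLM, ← itoCLM_apply hT hB, symTensor_eq, itoCLM_symL2,
    mulCLM_itoCLM_tensorL2 hT hB hf hg]

end ProductFormula

/-! ### Regrouping of double and triple series. -/

section Series

theorem hasSum_antidiagonal {E : Type*} [NormedAddCommGroup E] {F : ℕ × ℕ → E} {S : E}
    (h : HasSum F S) :
    HasSum (fun n => ∑ p ∈ Finset.HasAntidiagonal.antidiagonal n, F p) S := by
  have h1 := (Finset.HasAntidiagonal.sigmaAntidiagonalEquivProd.hasSum_iff.2 h).sigma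
    fun n => hasSum_fintype _
  refine h1.congr_fun fun n => ?_
  exact (Finset.sum_coe_sort (Finset.HasAntidiagonal.antidiagonal n) F).symm

/-- Triples `(r, m, p)` as pairs `(k, l) = (m + r, p + r)` with an index `r ≤ min k l`. -/
def tripleEquiv : (Σ q : ℕ × ℕ, Finset.range (min q.1 q.2 + 1)) ≃ ℕ × ℕ × ℕ where
  toFun z := (z.2, z.1.1 - z.2, z.1.2 - z.2)
  invFun z := ⟨(z.2.1 + z.1, z.2.2 + z.1), ⟨z.1, by simp only [Finset.mem_range]; omega⟩⟩
  left_inv := by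
    rintro ⟨⟨k, l⟩, ⟨r, hr⟩⟩
    rw [Finset.mem_range] at hr
    refine Sigma.subtype_ext (Prod.ext ?_ ?_) rfl <;> dsimp only at hr ⊢ <;> omega
  right_inv := by
    rintro ⟨r, m, p⟩
    simp

theorem hasSum_triple {E : Type*} [NormedAddCommGroup E] {F : ℕ × ℕ × ℕ → E} {S : E}
    (h : HasSum F S) :
    HasSum (fun q : ℕ × ℕ => ∑ r ∈ Finset.range (min q.1 q.2 + 1), F (r, q.1 - r, q.2 - r)) S := by
  have h1 := (tripleEquiv.hasSum_iff.2 h).sigma fun n => hasSum_fintype _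
  refine h1.congr_fun fun q => ?_
  exact (Finset.sum_coe_sort (Finset.range (min q.1 q.2 + 1)) fun r => F (r, q.1 - r, q.2 - r)).symm

/-- The binomial theorem for `(-2 + 1) ^ N`; this is where the coefficient `-2` of the final formula
comes from. -/
theorem sum_antidiagonal_neg_two_pow (N : ℕ) :
    ∑ p ∈ Finset.HasAntidiagonal.antidiagonal N,
      (-2 : ℝ) ^ p.1 / p.1.factorial * (p.2.factorial : ℝ)⁻¹ = (-1) ^ N / N.factorial := by
  have h : ((-2 : ℝ) + 1) ^ N = _ := (Commute.all (-2 : ℝ) 1).add_pow' N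
  rw [show (-2 : ℝ) + 1 = -1 by norm_num] at h
  rw [h, Finset.sum_div]
  refine Finset.sum_congr rfl fun p hp => ?_
  rw [Finset.HasAntidiagonal.mem_antidiagonal] at hp
  subst hp
  have h1 : ((p.1 + p.2).choose p.1 : ℝ) * p.1.factorial * p.2.factorial =
      (p.1 + p.2).factorial := by
    rw [Nat.choose_symm_add]
    exact_mod_cast Nat.add_choose_mul_factorial_mul_factorial p.1 p.2
  have h2 : (p.1.factorial : ℝ) ≠ 0 := by positivity
  have h3 : (p.2.factorial : ℝ) ≠ 0 := by positivity
  have h4 : ((p.1 + p.2).factorial : ℝ) ≠ 0 := by positivity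
  rw [one_pow, mul_one, nsmul_eq_mul]
  field_simp
  rw [← h1]
  ring

theorem summable_geometric_triple {c : ℝ} (h0 : 0 ≤ c) (h1 : c < 1) :
    Summable fun z : ℕ × ℕ × ℕ => c ^ z.1 * (c ^ z.2.1 * c ^ z.2.2) := by
  have h := summable_geometric_of_lt_one h0 h1
  have h2 := h.mul_of_nonneg h (fun n => by positivity) fun n => by positivity
  exact h.mul_of_nonneg h2 (fun n => by positivity) fun n => by
    simp only [Pi.zero_apply]; positivity

theorem factorial_add_le (m n : ℕ) :
    ((m + n).factorial : ℝ) ≤ 2 ^ (m + n) * (m.factorial * n.factorial) := by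
  have h1 : ((m + n).choose n : ℝ) * m.factorial * n.factorial = (m + n).factorial := by
    exact_mod_cast Nat.add_choose_mul_factorial_mul_factorial m n
  have h2 : ((m + n).choose n : ℝ) ≤ 2 ^ (m + n) := by exact_mod_cast Nat.choose_le_two_pow _ _
  rw [← h1, mul_assoc]
  gcongr

/-- The classes of the `F m` are absolutely summable in the complete space `L¹(μ; E)`, and their sum
represents the pointwise sum almost everywhere. -/
theorem ae_summable_of_summable_integral_norm {α E : Type*} [MeasurableSpace α] {μ : Measure α}
    [NormedAddCommGroup E] [CompleteSpace E] {F : ℕ → α → E}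
    (hF : ∀ m, Integrable (F m) μ) (hs : Summable fun m => ∫ t, ‖F m t‖ ∂μ) :
    (∀ᵐ t ∂μ, Summable fun m => F m t) ∧ Integrable (fun t => ∑' m, F m t) μ := by
  have h1 := Lp.hasSum_coeFn_tsum (p := 1) (μ := μ) (f := fun m => (hF m).toL1 (F m))
    (tsum_enorm_ne_top_iff_summable_norm.2 (by
      refine hs.congr fun m => ?_
      rw [L1.norm_eq_integral_norm]
      refine integral_congr_ae ?_
      filter_upwards [(hF m).coeFn_toL1] with t ht
      rw [ht]))
  have h2 : ∀ᵐ t ∂μ, HasSum (fun m => F m t) ((∑' m, (hF m).toL1 (F m) : Lp E 1 μ) t) := by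
    filter_upwards [h1, ae_all_iff.2 fun m => (hF m).coeFn_toL1] with t g1 g2
    simpa only [g2] using g1
  refine ⟨h2.mono fun t ht => ht.summable, ?_⟩
  refine (L1.integrable_coeFn (∑' m, (hF m).toL1 (F m))).congr ?_
  exact h2.mono fun t ht => ht.tsum_eq.symm

end Series

/-! ### Fubini for joined variables. -/

section Fubini

variable {T : ℝ} {E : Type*} [NormedAddCommGroup E]

theorem integrable_append {m n : ℕ} {F : (Fin (m + n) → ℝ) → E} (hF : Integrable F (cube T (m + n))) :
    Integrable (fun p : (Fin n → ℝ) × (Fin m → ℝ) => F (Fin.append p.2 p.1))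
      ((cube T n).prod (cube T m)) :=
  (measurePreserving_append_swap T m n).integrable_comp_of_integrable hF

variable [NormedSpace ℝ E]

theorem integral_integral_append {m n : ℕ} {F : (Fin (m + n) → ℝ) → E}
    (hF : Integrable F (cube T (m + n))) :
    ∫ t, ∫ s, F (Fin.append s t) ∂(cube T m) ∂(cube T n) = ∫ u, F u ∂(cube T (m + n)) := by
  rw [← integral_prod _ (integrable_append hF)]
  have h := (measurePreserving_append_swap T m n).map_eq
  have hF' : AEStronglyMeasurable F (((cube T n).prod (cube T m)).map
      fun p : (Fin n → ℝ) × (Fin m → ℝ) => Fin.append p.2 p.1) := by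
    rw [h]; exact hF.aestronglyMeasurable
  rw [← integral_map (measurePreserving_append_swap T m n).measurable.aemeasurable hF', h]

theorem integral_norm_integral_append_le {m n : ℕ} {F : (Fin (m + n) → ℝ) → E}
    (hF : Integrable F (cube T (m + n))) :
    ∫ t, ‖∫ s, F (Fin.append s t) ∂(cube T m)‖ ∂(cube T n) ≤ ∫ u, ‖F u‖ ∂(cube T (m + n)) := by
  rw [← integral_integral_append hF.norm]
  exact integral_mono (integrable_append hF).integral_prod_left.norm
    (integrable_append hF.norm).integral_prod_left fun t => norm_integral_le_integral_norm _

end Fubini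

/-! ### Estimates for the pairing. -/

section Pairing

variable {T : ℝ} {Ω : Type*} [MeasurableSpace Ω] {P : Measure Ω}

theorem integrable_mulCLM (r : ℕ) (U V : Lp (Lp ℝ 2 P) 2 (cube T r)) :
    Integrable (fun t => mulCLM P (U t) (V t)) (cube T r) :=
  (L1.integrable_coeFn ((mulCLM P).holder 1 U V)).congr ((mulCLM P).coeFn_holder (r := 1) U V)

theorem integral_norm_mulCLM_le (r : ℕ) (U V : Lp (Lp ℝ 2 P) 2 (cube T r)) :
    ∫ t, ‖mulCLM P (U t) (V t)‖ ∂(cube T r) ≤ ‖U‖ * ‖V‖ := by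
  have h : ‖mulCLM P‖ ≤ 1 :=
    (ContinuousLinearMap.norm_holderL_le _).trans (ContinuousLinearMap.opNorm_mul_le ℝ ℝ)
  calc ∫ t, ‖mulCLM P (U t) (V t)‖ ∂(cube T r) = ‖(mulCLM P).holder 1 U V‖ := by
        rw [L1.norm_eq_integral_norm]
        refine integral_congr_ae ?_
        filter_upwards [(mulCLM P).coeFn_holder (r := 1) U V] with t ht
        rw [ht]
    _ ≤ ‖mulCLM P‖ * ‖U‖ * ‖V‖ := (mulCLM P).norm_holder_apply_apply_le U V
    _ ≤ 1 * ‖U‖ * ‖V‖ := by gcongr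
    _ = _ := by rw [one_mul]

theorem norm_pairing_le (r : ℕ) (U V : Lp (Lp ℝ 2 P) 2 (cube T r)) :
    ‖pairing P T r U V‖ ≤ ‖U‖ * ‖V‖ := by
  rw [pairing, ContinuousLinearMap.lpPairing_eq_integral]
  exact (norm_integral_le_integral_norm _).trans (integral_norm_mulCLM_le r U V)

end Pairing

/-! ### Geometric bounds for the derivatives. -/

section Bounds

variable {T : ℝ} {Ω : Type*} [MeasurableSpace Ω] {B : Set.Icc (0 : ℝ) T → Ω → ℝ} {P : Measure Ω}
  [IsProbabilityMeasure P]

/-- The rate `1/32` leaves room for three later losses of a factor `2`: from the falling factorials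
(`1/16`), from `(m+n)!` against `m! n!` (`1/8`), and from `(-2)^n` (`1/4`). -/
theorem RapidDecay.exists_bound {h : ∀ n, L2Cube T n} (hh : RapidDecay h) :
    ∃ C, 0 ≤ C ∧ ∀ k, Real.sqrt k.factorial * ‖h k‖ ≤ C * (1 / 32) ^ k := by
  obtain ⟨C, hC⟩ := (hh 32).tendsto_atTop_zero.bddAbove_range
  have hC' : ∀ k, Real.sqrt k.factorial * ((32 : ℕ) : ℝ) ^ k * ‖h k‖ ≤ C := fun k => hC ⟨k, rfl⟩
  refine ⟨C, (by positivity : (0:ℝ) ≤ _).trans (hC' 0), fun k => ?_⟩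
  rw [one_div, inv_pow, ← div_eq_mul_inv, le_div_iff₀ (by positivity)]
  refine le_of_eq_of_le ?_ (hC' k)
  push_cast
  ring

theorem RapidDecay.exists_norm_derivTerm_le (hT : 0 < T) (hB : IsBrownianMotionOn B P)
    {h : ∀ n, L2Cube T n} (hh : RapidDecay h) :
    ∃ C, 0 ≤ C ∧ ∀ m N, ‖derivTerm hT hB m N (h (m + N))‖ ≤
      Real.sqrt N.factorial * (C * ((1 / 16) ^ m * (1 / 16) ^ N)) := by
  obtain ⟨C, hC0, hC⟩ := hh.exists_bound
  refine ⟨C, hC0, fun m N => (norm_derivTerm_le hT hB _).trans ?_⟩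
  calc Real.sqrt m.factorial * (((m + N).descFactorial N : ℝ) * ‖h (m + N)‖)
      = ((m + N).descFactorial N * Real.sqrt m.factorial) * ‖h (m + N)‖ := by ring
    _ ≤ (Real.sqrt N.factorial * (Real.sqrt (m + N).factorial * 2 ^ (m + N))) * ‖h (m + N)‖ := by
        exact mul_le_mul_of_nonneg_right (descFactorial_mul_sqrt_factorial_le m N) (norm_nonneg _)
    _ = Real.sqrt N.factorial * (2 ^ (m + N) * (Real.sqrt (m + N).factorial * ‖h (m + N)‖)) := by
        ring
    _ ≤ Real.sqrt N.factorial * (2 ^ (m + N) * (C * (1 / 32) ^ (m + N))) := by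
        refine mul_le_mul_of_nonneg_left (mul_le_mul_of_nonneg_left (hC _) ?_) ?_ <;> positivity
    _ = _ := by
        rw [← pow_add, show (1 / 16 : ℝ) = 2 * (1 / 32) by norm_num, mul_pow]
        ring

theorem RapidDecay.exists_norm_derivL2_le (hT : 0 < T) (hB : IsBrownianMotionOn B P)
    {h : ∀ n, L2Cube T n} (hh : RapidDecay h) :
    ∃ C, 0 ≤ C ∧ ∀ N, ‖derivL2 hT hB h N‖ ≤ Real.sqrt N.factorial * (C * (1 / 16) ^ N) := by
  obtain ⟨C, hC0, hC⟩ := hh.exists_norm_derivTerm_le hT hB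
  refine ⟨C * (1 - 1 / 16)⁻¹, by norm_num; positivity, fun N => ?_⟩
  have h1 := (hasSum_geometric_of_lt_one (r := (1 / 16 : ℝ)) (by norm_num) (by norm_num)).mul_left
    (Real.sqrt N.factorial * (C * (1 / 16) ^ N))
  refine (tsum_of_norm_bounded h1 fun m => (hC m N).trans_eq (by ring)).trans_eq (by ring)

theorem hasSum_derivL2 (hT : 0 < T) (hB : IsBrownianMotionOn B P) {h : ∀ n, L2Cube T n}
    (hh : RapidDecay h) (N : ℕ) :
    HasSum (fun m => derivTerm hT hB m N (h (m + N))) (derivL2 hT hB h N) :=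
  (hh.summable_norm_derivTerm hT hB N).of_norm.hasSum

end Bounds

/-! ### The Wick product as an alternating series of pairings. -/

section WickProduct

variable {T : ℝ} {Ω : Type*} [MeasurableSpace Ω] {B : Set.Icc (0 : ℝ) T → Ω → ℝ} {P : Measure Ω}
  [IsProbabilityMeasure P]

theorem norm_multipleIto_symTensor_le (hT : 0 < T) (hB : IsBrownianMotionOn B P) {k l : ℕ}
    (f : L2Cube T k) (g : L2Cube T l) : ‖multipleIto B P (k + l) (symTensor f g)‖ ≤
      (2 ^ k * (Real.sqrt k.factorial * ‖f‖)) * (2 ^ l * (Real.sqrt l.factorial * ‖g‖)) := by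
  rw [← itoCLM_apply hT hB, symTensor_eq, itoCLM_symL2]
  have h1 : Real.sqrt (k + l).factorial ≤
      2 ^ (k + l) * (Real.sqrt k.factorial * Real.sqrt l.factorial) := by
    rw [Real.sqrt_le_left (by positivity), mul_pow, mul_pow, Real.sq_sqrt (by positivity),
      Real.sq_sqrt (by positivity)]
    refine (factorial_add_le k l).trans ?_
    gcongr
    exact le_self_pow₀ (one_le_pow₀ one_le_two) two_ne_zero
  calc ‖itoCLM hT hB (k + l) (tensorL2 f g)‖ ≤ Real.sqrt (k + l).factorial * ‖tensorL2 f g‖ :=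
        norm_itoCLM_le hT hB _
    _ ≤ 2 ^ (k + l) * (Real.sqrt k.factorial * Real.sqrt l.factorial) * (‖f‖ * ‖g‖) := by
        rw [norm_tensorL2]
        exact mul_le_mul_of_nonneg_right h1 (by positivity)
    _ = _ := by rw [pow_add]; ring

theorem summable_multipleIto_symTensor (hT : 0 < T) (hB : IsBrownianMotionOn B P)
    {f g : ∀ n, L2Cube T n} (hf : RapidDecay f) (hg : RapidDecay g) :
    Summable fun q : ℕ × ℕ => multipleIto B P (q.1 + q.2) (symTensor (f q.1) (g q.2)) := by
  obtain ⟨C, hC0, hC⟩ := hf.exists_bound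
  obtain ⟨D, hD0, hD⟩ := hg.exists_bound
  have h := (summable_geometric_of_lt_one (r := (1 / 16 : ℝ)) (by norm_num) (by norm_num))
  have h2 := (h.mul_of_nonneg h (fun n => by positivity) fun n => by positivity).mul_left (C * D)
  refine Summable.of_norm_bounded h2 fun q => (norm_multipleIto_symTensor_le hT hB _ _).trans ?_
  calc (2 ^ q.1 * (Real.sqrt q.1.factorial * ‖f q.1‖)) *
        (2 ^ q.2 * (Real.sqrt q.2.factorial * ‖g q.2‖))
      ≤ (2 ^ q.1 * (C * (1 / 32) ^ q.1)) * (2 ^ q.2 * (D * (1 / 32) ^ q.2)) :=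
        mul_le_mul (mul_le_mul_of_nonneg_left (hC _) (by positivity))
          (mul_le_mul_of_nonneg_left (hD _) (by positivity)) (by positivity) (by positivity)
    _ = _ := by
        rw [show (1 / 16 : ℝ) = 2 * (1 / 32) by norm_num, mul_pow, mul_pow]
        ring

variable {X Y : Lp ℝ 2 P}

theorem hasSum_wick (hT : 0 < T) (hB : IsBrownianMotionOn B P) (hX : X ∈ G B P) (hY : Y ∈ G B P) :
    Summable (wickTerm B P X Y) ∧ HasSum (fun q : ℕ × ℕ => multipleIto B P (q.1 + q.2)
      (symTensor (chaosKernel B P X q.1) (chaosKernel B P Y q.2))) (wick B P X Y) := by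
  have h := (summable_multipleIto_symTensor hT hB (rapidDecay_of_mem_G hT hB hX)
    (rapidDecay_of_mem_G hT hB hY)).hasSum
  have h1 := hasSum_antidiagonal h
  refine ⟨h1.summable, ?_⟩
  have h2 : wick B P X Y = _ := h1.tsum_eq
  rw [h2]
  exact h

/-- The terms of the expansion of the Wick product into pairings of derivatives. -/
def wickPairingTerm (hT : 0 < T) (hB : IsBrownianMotionOn B P) (f g : ∀ n, L2Cube T n)
    (z : ℕ × ℕ × ℕ) : Lp ℝ 1 P :=
  ((-1 : ℝ) ^ z.1 / z.1.factorial) • pairing P T z.1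
    (derivTerm hT hB z.2.1 z.1 (f (z.2.1 + z.1))) (derivTerm hT hB z.2.2 z.1 (g (z.2.2 + z.1)))

theorem summable_wickPairingTerm (hT : 0 < T) (hB : IsBrownianMotionOn B P)
    {f g : ∀ n, L2Cube T n} (hf : RapidDecay f) (hg : RapidDecay g) :
    Summable (wickPairingTerm hT hB f g) := by
  obtain ⟨C, hC0, hC⟩ := hf.exists_norm_derivTerm_le hT hB
  obtain ⟨D, hD0, hD⟩ := hg.exists_norm_derivTerm_le hT hB
  refine Summable.of_norm_bounded ((summable_geometric_triple (c := 1 / 16) (by norm_num)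
    (by norm_num)).mul_left (C * D)) ?_
  rintro ⟨r, m, p⟩
  rw [wickPairingTerm, norm_smul]
  dsimp only
  have h1 : ‖((-1 : ℝ) ^ r / r.factorial)‖ = (r.factorial : ℝ)⁻¹ := by
    rw [norm_div, norm_pow, norm_neg, norm_one, one_pow, one_div, Real.norm_natCast]
  have h2 : (r.factorial : ℝ) ≠ 0 := by positivity
  have h3 : Real.sqrt r.factorial * Real.sqrt r.factorial = r.factorial :=
    Real.mul_self_sqrt (by positivity)
  rw [h1]
  calc (r.factorial : ℝ)⁻¹ * ‖pairing P T r (derivTerm hT hB m r (f (m + r)))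
        (derivTerm hT hB p r (g (p + r)))‖
      ≤ (r.factorial : ℝ)⁻¹ * ((Real.sqrt r.factorial * (C * ((1 / 16) ^ m * (1 / 16) ^ r))) *
        (Real.sqrt r.factorial * (D * ((1 / 16) ^ p * (1 / 16) ^ r)))) := by
        refine mul_le_mul_of_nonneg_left ((norm_pairing_le r _ _).trans ?_) (by positivity)
        exact mul_le_mul (hC m r) (hD p r) (norm_nonneg _) (by positivity)
    _ = ((r.factorial : ℝ)⁻¹ * (Real.sqrt r.factorial * Real.sqrt r.factorial)) *
        (C * D * ((1 / 16) ^ r * ((1 / 16) ^ m * (1 / 16) ^ p)) * (1 / 16) ^ r) := by ring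
    _ = C * D * ((1 / 16) ^ r * ((1 / 16) ^ m * (1 / 16) ^ p)) * (1 / 16) ^ r := by
        rw [h3, inv_mul_cancel₀ h2, one_mul]
    _ ≤ C * D * ((1 / 16) ^ r * ((1 / 16) ^ m * (1 / 16) ^ p)) * 1 :=
        mul_le_mul_of_nonneg_left (pow_le_one₀ (by norm_num) (by norm_num)) (by positivity)
    _ = _ := mul_one _

theorem hasSum_pairing_derivTerm (hT : 0 < T) (hB : IsBrownianMotionOn B P)
    {f g : ∀ n, L2Cube T n} (hf : RapidDecay f) (hg : RapidDecay g) (r : ℕ) :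
    HasSum (fun z => wickPairingTerm hT hB f g (r, z))
      (((-1 : ℝ) ^ r / r.factorial) •
        pairing P T r (derivL2 hT hB f r) (derivL2 hT hB g r)) := by
  obtain ⟨S, hS⟩ := (summable_wickPairingTerm hT hB hf hg).prod_factor r
  have h1 : ∀ m, HasSum (fun p => wickPairingTerm hT hB f g (r, m, p))
      (((-1 : ℝ) ^ r / r.factorial) •
        pairing P T r (derivTerm hT hB m r (f (m + r))) (derivL2 hT hB g r)) := fun m =>
    ((hasSum_derivL2 hT hB hg r).mapL (pairing P T r
      (derivTerm hT hB m r (f (m + r))))).const_smul _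
  have h2 := hS.prod_fiberwise h1
  have h3 : HasSum (fun m => ((-1 : ℝ) ^ r / r.factorial) •
        pairing P T r (derivTerm hT hB m r (f (m + r))) (derivL2 hT hB g r))
      (((-1 : ℝ) ^ r / r.factorial) •
        pairing P T r (derivL2 hT hB f r) (derivL2 hT hB g r)) :=
    ((hasSum_derivL2 hT hB hf r).mapL ((pairing P T r).flip (derivL2 hT hB g r))).const_smul _
  rw [← h2.unique h3]
  exact hS

/-- The Wick product as an alternating series of pairings of derivatives. -/
theorem hasSum_toL1_wick (hT : 0 < T) (hB : IsBrownianMotionOn B P) (hX : X ∈ G B P)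
    (hY : Y ∈ G B P) :
    HasSum (fun r : ℕ => ((-1 : ℝ) ^ r / r.factorial) • pairing P T r
      (derivL2 hT hB (chaosKernel B P X) r) (derivL2 hT hB (chaosKernel B P Y) r))
      (toL1 (wick B P X Y)) := by
  have hf := rapidDecay_of_mem_G hT hB hX
  have hg := rapidDecay_of_mem_G hT hB hY
  have hfs := (isChaosExpansion_of_mem_G hT hB hX).1
  have hgs := (isChaosExpansion_of_mem_G hT hB hY).1
  obtain ⟨S, hS⟩ := summable_wickPairingTerm hT hB hf hg
  -- The absolutely summable family over `(r, m, p)` is summed twice: for fixed `r` it gives the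
  -- pairing of the `r`-th derivatives, and for fixed `(k, l) = (m + r, p + r)` it gives one term of
  -- the Wick product.
  have h1 := hS.prod_fiberwise (hasSum_pairing_derivTerm hT hB hf hg)
  have h2 := hasSum_triple hS
  have h3 := (hasSum_wick hT hB hX hY).2.mapL ((mulCLM P).flip (toL2 P fun _ => 1))
  have h4 : (fun q : ℕ × ℕ => ∑ r ∈ Finset.range (min q.1 q.2 + 1),
        wickPairingTerm hT hB (chaosKernel B P X) (chaosKernel B P Y) (r, q.1 - r, q.2 - r)) =
      fun q : ℕ × ℕ => (mulCLM P).flip (toL2 P fun _ => 1) (multipleIto B P (q.1 + q.2)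
        (symTensor (chaosKernel B P X q.1) (chaosKernel B P Y q.2))) := by
    funext q
    rw [ContinuousLinearMap.flip_apply, ← toL1_eq_mulCLM,
      toL1_multipleIto_symTensor hT hB (hfs _) (hgs _)]
    refine Finset.sum_congr rfl fun r hr => ?_
    rw [Finset.mem_range] at hr
    obtain ⟨m, hm⟩ : ∃ m, q.1 = m + r := ⟨q.1 - r, by omega⟩
    obtain ⟨p, hp⟩ : ∃ p, q.2 = p + r := ⟨q.2 - r, by omega⟩
    rw [wickPairingTerm, hm, hp]
    dsimp only
    rw [Nat.add_sub_cancel, Nat.add_sub_cancel, derivChaos_family, derivChaos_family]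
  rw [h4] at h2
  rw [toL1_eq_mulCLM]
  rw [← ContinuousLinearMap.flip_apply, ← h2.unique h3]
  exact h1

end WickProduct

/-! ### From the coefficients `(-1)^N` to `(-2)^n`. -/

section Rearrangement

/-- One absolutely summable double series in `(n, m)`: along the antidiagonals `n + m = N` it is the
given series, along the rows it is the claimed one. -/
theorem hasSum_neg_two_pow_of_hasSum {E : Type*} [NormedAddCommGroup E] [NormedSpace ℝ E]
    [CompleteSpace E] {K : ℕ → E} {C : ℝ} (hC : 0 ≤ C)
    (hK : ∀ N, ‖K N‖ ≤ N.factorial * (C * (1 / 16) ^ N)) {S : E}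
    (hS : HasSum (fun N : ℕ => ((-1 : ℝ) ^ N / N.factorial) • K N) S) :
    HasSum (fun n : ℕ => ((-2 : ℝ) ^ n / n.factorial) •
      ∑' m : ℕ, (m.factorial : ℝ)⁻¹ • K (m + n)) S := by
  let F : ℕ × ℕ → E := fun q =>
    ((-2 : ℝ) ^ q.1 / q.1.factorial) • (q.2.factorial : ℝ)⁻¹ • K (q.2 + q.1)
  have hterm : ∀ n m : ℕ, (m.factorial : ℝ)⁻¹ * ‖K (m + n)‖ ≤
      n.factorial * (C * ((1 / 8) ^ m * (1 / 8) ^ n)) := by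
    intro n m
    have h2 : (m.factorial : ℝ) ≠ 0 := by positivity
    calc (m.factorial : ℝ)⁻¹ * ‖K (m + n)‖
        ≤ (m.factorial : ℝ)⁻¹ * ((2 ^ (m + n) * (m.factorial * n.factorial)) *
          (C * (1 / 16) ^ (m + n))) := by
          refine mul_le_mul_of_nonneg_left ((hK _).trans ?_) (by positivity)
          exact mul_le_mul_of_nonneg_right (factorial_add_le m n) (by positivity)
      _ = ((m.factorial : ℝ)⁻¹ * m.factorial) * (n.factorial * (C * (2 ^ (m + n) *
          (1 / 16) ^ (m + n)))) := by ring
      _ = _ := by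
          rw [inv_mul_cancel₀ h2, one_mul, ← mul_pow, ← pow_add]
          norm_num
  have hF : Summable F := by
    have h := (summable_geometric_of_lt_one (r := (1 / 4 : ℝ)) (by norm_num) (by norm_num))
    have h2 := (h.mul_of_nonneg h (fun n => by positivity) fun n => by positivity).mul_left C
    refine Summable.of_norm_bounded h2 ?_
    rintro ⟨n, m⟩
    have h3 : ‖((-2 : ℝ) ^ n / n.factorial)‖ = 2 ^ n / n.factorial := by
      rw [norm_div, norm_pow, norm_neg, Real.norm_natCast, Real.norm_ofNat]
    have h4 : ‖(m.factorial : ℝ)⁻¹‖ = (m.factorial : ℝ)⁻¹ := by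
      rw [norm_inv, Real.norm_natCast]
    have h5 : (n.factorial : ℝ) ≠ 0 := by positivity
    simp only [F, norm_smul, h3, h4]
    calc 2 ^ n / (n.factorial : ℝ) * ((m.factorial : ℝ)⁻¹ * ‖K (m + n)‖)
        ≤ 2 ^ n / n.factorial * (n.factorial * (C * ((1 / 8) ^ m * (1 / 8) ^ n))) :=
          mul_le_mul_of_nonneg_left (hterm n m) (by positivity)
      _ = C * ((1 / 4) ^ n * (1 / 8) ^ m) := by
          rw [show (1 / 4 : ℝ) = 2 * (1 / 8) by norm_num, mul_pow]
          field_simp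
      _ ≤ C * ((1 / 4) ^ n * (1 / 4) ^ m) := by gcongr; norm_num
  obtain ⟨S', hS'⟩ := hF
  have h1 := hasSum_antidiagonal hS'
  have h2 : (fun N => ∑ q ∈ Finset.HasAntidiagonal.antidiagonal N, F q) =
      fun N : ℕ => ((-1 : ℝ) ^ N / N.factorial) • K N := by
    funext N
    rw [← sum_antidiagonal_neg_two_pow, Finset.sum_smul]
    refine Finset.sum_congr rfl fun q hq => ?_
    rw [Finset.HasAntidiagonal.mem_antidiagonal] at hq
    simp only [F]
    rw [smul_smul, add_comm q.2, hq]
  rw [h2] at h1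
  rw [hS.unique h1]
  refine hS'.prod_fiberwise fun n => HasSum.const_smul _ (Summable.hasSum ?_)
  refine Summable.of_norm_bounded (((summable_geometric_of_lt_one (r := (1 / 8 : ℝ)) (by norm_num)
    (by norm_num)).mul_left (n.factorial * (C * (1 / 8) ^ n)))) fun m => ?_
  rw [norm_smul, norm_inv, Real.norm_natCast]
  exact (hterm n m).trans_eq (by ring)

end Rearrangement

/-! ### Anti-Wick products of derivatives and their integrals. -/

section AntiWickProduct

variable {T : ℝ} {Ω : Type*} [MeasurableSpace Ω] {B : Set.Icc (0 : ℝ) T → Ω → ℝ} {P : Measure Ω}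
  [IsProbabilityMeasure P] {X Y : Lp ℝ 2 P}

theorem mulL1_hidaDeriv_ae_eq (hT : 0 < T) (hB : IsBrownianMotionOn B P) (hX : X ∈ G B P)
    (hY : Y ∈ G B P) (N : ℕ) :
    (fun z => mulL1 (hidaDeriv B P N X z) (hidaDeriv B P N Y z)) =ᵐ[cube T N] fun z =>
      mulCLM P (derivL2 hT hB (chaosKernel B P X) N z) (derivL2 hT hB (chaosKernel B P Y) N z) := by
  filter_upwards [ae_hidaDeriv hT hB hX N, ae_hidaDeriv hT hB hY N] with z h1 h2
  rw [mulCLM_eq_mulL1, h1.2.2.2, h2.2.2.2]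

theorem integrable_mulL1_hidaDeriv (hT : 0 < T) (hB : IsBrownianMotionOn B P) (hX : X ∈ G B P)
    (hY : Y ∈ G B P) (N : ℕ) :
    Integrable (fun z => mulL1 (hidaDeriv B P N X z) (hidaDeriv B P N Y z)) (cube T N) :=
  (integrable_mulCLM N _ _).congr (mulL1_hidaDeriv_ae_eq hT hB hX hY N).symm

theorem integral_mulL1_hidaDeriv (hT : 0 < T) (hB : IsBrownianMotionOn B P) (hX : X ∈ G B P)
    (hY : Y ∈ G B P) (N : ℕ) :
    ∫ z, mulL1 (hidaDeriv B P N X z) (hidaDeriv B P N Y z) ∂(cube T N) = pairing P T N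
      (derivL2 hT hB (chaosKernel B P X) N) (derivL2 hT hB (chaosKernel B P Y) N) := by
  rw [pairing, ContinuousLinearMap.lpPairing_eq_integral]
  exact integral_congr_ae (mulL1_hidaDeriv_ae_eq hT hB hX hY N)

theorem exists_integral_norm_mulL1_hidaDeriv_le (hT : 0 < T) (hB : IsBrownianMotionOn B P)
    (hX : X ∈ G B P) (hY : Y ∈ G B P) : ∃ C, 0 ≤ C ∧ ∀ N : ℕ,
    ∫ z, ‖mulL1 (hidaDeriv B P N X z) (hidaDeriv B P N Y z)‖ ∂(cube T N) ≤
      N.factorial * (C * (1 / 16) ^ N) := by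
  obtain ⟨C, hC0, hC⟩ := (rapidDecay_of_mem_G hT hB hX).exists_norm_derivL2_le hT hB
  obtain ⟨D, hD0, hD⟩ := (rapidDecay_of_mem_G hT hB hY).exists_norm_derivL2_le hT hB
  refine ⟨C * D, by positivity, fun N => ?_⟩
  have h3 : Real.sqrt N.factorial * Real.sqrt N.factorial = N.factorial :=
    Real.mul_self_sqrt (by positivity)
  have h4 : ((1 : ℝ) / 16) ^ N ≤ 1 := pow_le_one₀ (by norm_num) (by norm_num)
  calc ∫ z, ‖mulL1 (hidaDeriv B P N X z) (hidaDeriv B P N Y z)‖ ∂(cube T N)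
      = ∫ z, ‖mulCLM P (derivL2 hT hB (chaosKernel B P X) N z)
          (derivL2 hT hB (chaosKernel B P Y) N z)‖ ∂(cube T N) := by
        refine integral_congr_ae ?_
        filter_upwards [mulL1_hidaDeriv_ae_eq hT hB hX hY N] with z hz
        rw [hz]
    _ ≤ (Real.sqrt N.factorial * (C * (1 / 16) ^ N)) * (Real.sqrt N.factorial * (D * (1 / 16) ^ N)) :=
        (integral_norm_mulCLM_le N _ _).trans
          (mul_le_mul (hC N) (hD N) (norm_nonneg _) (by positivity))
    _ = (Real.sqrt N.factorial * Real.sqrt N.factorial) * (C * D * (1 / 16) ^ N) * (1 / 16) ^ N := by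
        ring
    _ ≤ (Real.sqrt N.factorial * Real.sqrt N.factorial) * (C * D * (1 / 16) ^ N) * 1 :=
        mul_le_mul_of_nonneg_left h4 (by positivity)
    _ = _ := by rw [h3, mul_one]

theorem ae_antiWickTerm_hidaDeriv (hT : 0 < T) (hB : IsBrownianMotionOn B P) (hX : X ∈ G B P)
    (hY : Y ∈ G B P) (n : ℕ) : ∀ᵐ t ∂(cube T n), ∀ m : ℕ,
      Integrable (fun s => mulL1 (hidaDeriv B P m (hidaDeriv B P n X t) s)
        (hidaDeriv B P m (hidaDeriv B P n Y t) s)) (cube T m) ∧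
      antiWickTerm B P (hidaDeriv B P n X t) (hidaDeriv B P n Y t) m =
        (m.factorial : ℝ)⁻¹ • ∫ s, mulL1 (hidaDeriv B P (m + n) X (Fin.append s t))
          (hidaDeriv B P (m + n) Y (Fin.append s t)) ∂(cube T m) := by
  rw [ae_all_iff]
  intro m
  filter_upwards [ae_hidaDeriv_hidaDeriv hT hB hX m n, ae_hidaDeriv_hidaDeriv hT hB hY m n,
    (integrable_append (integrable_mulL1_hidaDeriv hT hB hX hY (m + n))).prod_right_ae]
    with t h1 h2 h3
  have h4 : (fun s => mulL1 (hidaDeriv B P m (hidaDeriv B P n X t) s)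
        (hidaDeriv B P m (hidaDeriv B P n Y t) s)) =ᵐ[cube T m] fun s =>
      mulL1 (hidaDeriv B P (m + n) X (Fin.append s t))
          (hidaDeriv B P (m + n) Y (Fin.append s t)) := by
    filter_upwards [h1, h2] with s g1 g2
    rw [g1, g2]
  exact ⟨h3.congr h4.symm, by rw [antiWickTerm, integral_congr_ae h4]⟩

/-- By iteration, the `m`-th term at `t` is `1/m!` times the partial integral of `D^(m+n) X ·
D^(m+n) Y` over the first `m` variables. Fubini bounds its integrated norm by a constant depending
on `n` times `(1/8)^m`. Hence the series converges for almost every `t` and may be integrated term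
by term, and each integral becomes one over the cube of dimension `m + n`. -/
theorem antiWick_hidaDeriv (hT : 0 < T) (hB : IsBrownianMotionOn B P) (hX : X ∈ G B P)
    (hY : Y ∈ G B P) (n : ℕ) :
    (∀ᵐ t ∂(cube T n), AntiWickExists B P (hidaDeriv B P n X t) (hidaDeriv B P n Y t)) ∧
    Integrable (fun t => antiWick B P (hidaDeriv B P n X t) (hidaDeriv B P n Y t)) (cube T n) ∧
    ∫ t, antiWick B P (hidaDeriv B P n X t) (hidaDeriv B P n Y t) ∂(cube T n) =
      ∑' m : ℕ, (m.factorial : ℝ)⁻¹ • pairing P T (m + n)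
        (derivL2 hT hB (chaosKernel B P X) (m + n)) (derivL2 hT hB (chaosKernel B P Y) (m + n)) := by
  let Φ : ∀ N, (Fin N → ℝ) → Lp ℝ 1 P := fun N z =>
    mulL1 (hidaDeriv B P N X z) (hidaDeriv B P N Y z)
  let F : ℕ → (Fin n → ℝ) → Lp ℝ 1 P := fun m t =>
    (m.factorial : ℝ)⁻¹ • ∫ s, Φ (m + n) (Fin.append s t) ∂(cube T m)
  have hΦ : ∀ N, Integrable (Φ N) (cube T N) := integrable_mulL1_hidaDeriv hT hB hX hY
  have hF : ∀ m, Integrable (F m) (cube T n) := fun m =>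
    Integrable.smul (m.factorial : ℝ)⁻¹ (integrable_append (hΦ (m + n))).integral_prod_left
  obtain ⟨C, hC0, hC⟩ := exists_integral_norm_mulL1_hidaDeriv_le hT hB hX hY
  have hs : Summable fun m => ∫ t, ‖F m t‖ ∂(cube T n) := by
    refine Summable.of_nonneg_of_le (fun m => integral_nonneg fun t => norm_nonneg _) (fun m => ?_)
      (((summable_geometric_of_lt_one (r := (1 / 8 : ℝ)) (by norm_num)
        (by norm_num)).mul_left (n.factorial * (C * (1 / 8) ^ n))))
    have h2 : (m.factorial : ℝ) ≠ 0 := by positivity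
    simp only [F, norm_smul, norm_inv, Real.norm_natCast]
    rw [integral_const_mul]
    calc (m.factorial : ℝ)⁻¹ * ∫ t, ‖∫ s, Φ (m + n) (Fin.append s t) ∂(cube T m)‖ ∂(cube T n)
        ≤ (m.factorial : ℝ)⁻¹ * ((2 ^ (m + n) * (m.factorial * n.factorial)) *
          (C * (1 / 16) ^ (m + n))) := by
          refine mul_le_mul_of_nonneg_left
            ((integral_norm_integral_append_le (hΦ (m + n))).trans ((hC _).trans ?_))
            (by positivity)
          exact mul_le_mul_of_nonneg_right (factorial_add_le m n) (by positivity)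
      _ = ((m.factorial : ℝ)⁻¹ * m.factorial) * (n.factorial * (C * (2 * (1 / 16)) ^ (m + n))) := by
          rw [mul_pow]; ring
      _ = _ := by
          rw [inv_mul_cancel₀ h2, one_mul, show (2 * (1 / 16) : ℝ) = 1 / 8 by norm_num, pow_add]
          ring
  have hae := ae_antiWickTerm_hidaDeriv hT hB hX hY n
  have hsum := ae_summable_of_summable_integral_norm hF hs
  have hanti : (fun t => antiWick B P (hidaDeriv B P n X t) (hidaDeriv B P n Y t)) =ᵐ[cube T n]
      fun t => ∑' m, F m t := by
    filter_upwards [hae] with t ht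
    exact tsum_congr fun m => (ht m).2
  refine ⟨?_, hsum.2.congr hanti.symm, ?_⟩
  · filter_upwards [hae, hsum.1] with t h1 h2
    exact ⟨fun m => (h1 m).1, h2.congr fun m => (h1 m).2.symm⟩
  · rw [integral_congr_ae hanti, ← integral_tsum_of_summable_integral_norm hF hs]
    refine tsum_congr fun m => ?_
    simp only [F]
    rw [integral_smul, integral_integral_append (hΦ (m + n)),
      integral_mulL1_hidaDeriv hT hB hX hY]

end AntiWickProduct

end

end WickCalculus

theorem proposition5p2 {Ω : Type*} [MeasurableSpace Ω] (P : Measure Ω) [IsProbabilityMeasure P]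
    (T : ℝ) (hT : 0 < T) (B : Set.Icc (0 : ℝ) T → Ω → ℝ)
    (hB : WickCalculus.IsBrownianSpace B P)
    (X Y : Lp ℝ 2 P) (hX : X ∈ WickCalculus.G B P) (hY : Y ∈ WickCalculus.G B P) :
    -- the Wick product of `X` and `Y` exists
    Summable (WickCalculus.wickTerm B P X Y) ∧
    -- for almost every `t`, the derivatives exist and are in `𝒢`, and so does their product
    (∀ n : ℕ, ∀ᵐ t ∂(WickCalculus.cube T n),
      WickCalculus.HidaDerivExists B P n X t ∧ WickCalculus.HidaDerivExists B P n Y t ∧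
      WickCalculus.hidaDeriv B P n X t ∈ WickCalculus.G B P ∧
      WickCalculus.hidaDeriv B P n Y t ∈ WickCalculus.G B P ∧
      WickCalculus.AntiWickExists B P
        (WickCalculus.hidaDeriv B P n X t) (WickCalculus.hidaDeriv B P n Y t)) ∧
    -- the integrals over the cubes exist
    (∀ n : ℕ, Integrable
      (fun t => WickCalculus.antiWick B P
        (WickCalculus.hidaDeriv B P n X t) (WickCalculus.hidaDeriv B P n Y t))
      (WickCalculus.cube T n)) ∧
    -- the formula, with convergence in `L¹(Ω)`
    HasSum
      (fun n : ℕ => ((-2 : ℝ) ^ n / (n.factorial : ℝ)) •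
        ∫ t, WickCalculus.antiWick B P
          (WickCalculus.hidaDeriv B P n X t) (WickCalculus.hidaDeriv B P n Y t)
          ∂(WickCalculus.cube T n))
      (WickCalculus.toL1 (WickCalculus.wick B P X Y)) := by
  obtain ⟨h1, -⟩ := WickCalculus.hasSum_wick hT hB.brownian hX hY
  have hA := WickCalculus.antiWick_hidaDeriv hT hB.brownian hX hY
  refine ⟨h1, fun n => ?_, fun n => (hA n).2.1, ?_⟩
  · filter_upwards [WickCalculus.ae_hidaDeriv hT hB.brownian hX n,
      WickCalculus.ae_hidaDeriv hT hB.brownian hY n, (hA n).1] with t g1 g2 g3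
    exact ⟨g1.1, g2.1, g1.2.1, g2.2.1, g3⟩
  · obtain ⟨C, hC0, hC⟩ :=
      WickCalculus.exists_integral_norm_mulL1_hidaDeriv_le hT hB.brownian hX hY
    -- Here `K N` is the pairing of the `N`-th derivatives, that is, the integral of `D^N X · D^N
    -- Y`; the inner series over `m` is the integral of the anti-Wick product.
    refine (WickCalculus.hasSum_neg_two_pow_of_hasSum hC0 (fun N => ?_)
      (WickCalculus.hasSum_toL1_wick hT hB.brownian hX hY)).congr_fun fun n => ?_
    · rw [← WickCalculus.integral_mulL1_hidaDeriv hT hB.brownian hX hY]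
      exact (norm_integral_le_integral_norm _).trans (hC N)
    · rw [(hA n).2.2]
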